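/- Let $p>1$ be an integer. Let $\mu$ be a $p\times p$ complex matrix measure on the unit circle $\mathbb T$ that is Hermitian, nonnegative and normalized by $\mu(\mathbb T)=\mathbf 1$, and suppose that $\mu$ is non-trivial, i.e. $\operatorname{tr}\int f(e^{i\theta})^\dagger\, d\mu(\theta)\, f(e^{i\theta})>0$ for every non-zero $p\times p$ matrix polynomial $f$. Let $(\alpha_k)_{k\ge 0}$ be the matrix Verblunsky coefficients of $\mu$, given by the Schur algorithm: with $$F(z)=\int \frac{e^{i\theta}+z}{e^{i\theta}-z}\,d\mu(\theta),\qquad f_0(z)=z^{-1}(F(z)-\mathbf 1)(F(z)+\mathbf 1)^{-1}\qquad(|z|<1),$$ put, for $k\ge 0$, $\alpha_k=f_k(0)$, $\rho^R_k=(\mathbf 1-\alpha_k\alpha_k^\dagger)^{1/2}$, $\rho^L_k=(\mathbf 1-\alpha_k^\dagger\alpha_k)^{1/2}$ and $$f_{k+1}(z)=z^{-1}(\rho_k^R)^{-1}(f_k(z)-\alpha_k)(\mathbf 1-\alpha_k^\dagger f_k(z))^{-1}\rho_k^L ,$$ where each $f_k$ is extended analytically to $z=0$. For real $g$ with $|g|\le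 1$ let $d\lambda_g(\theta)=(1-g\cos\theta)\frac{d\theta}{2\pi}$ and $\Lambda_g=\mathbf 1\cdot\lambda_g$. Let $d\mu=h_g\,d\lambda_g+d\mu_{s}$ be the Lebesgue decomposition of $\mu$ with respect to $\lambda_g$, and define the relative entropy $$\mathcal K(\Lambda_g\,|\,\mu)=-\int_{\mathbb T}\log\det h_g(\theta)\,d\lambda_g(\theta)\in(-\infty,+\infty],$$ with $-\log 0=+\infty$. Then: 1. If $|g|<1$, then $$\mathcal K(\Lambda_g\,|\,\mu)<\infty\iff \sum_k \operatorname{tr}\alpha_k\alpha_k^\dagger<\infty .$$ 2. For $g=1$ and $g=-1$ respectively, $$\mathcal K(\Lambda_1\,|\,\mu)<\infty\iff \sum_k \operatorname{tr}(\alpha_k\alpha_k^\dagger)^2+\sum_k\operatorname{tr}(\alpha_{k+1}-\alpha_k)(\alpha_{k+1}^\dagger-\alpha_k^\dagger)<\infty ,$$ $$\mathcal K(\Lambda_{-1}\,|\,\mu)<\infty\iff \sum_k \operatorname{tr}(\alpha_k\alpha_k^\dagger)^2+\sum_k\operatorname{tr}(\alpha_{k+1}+\alpha_k)(\alpha_{k+1}^\dagger+\alpha_k^\dagger)<\infty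 .$$ -/

import Mathlib

open MeasureTheory
open scoped Matrix MatrixOrder ComplexOrder

noncomputable section

namespace MatrixOPUC

/-- The unit circle `𝕋`, parametrized by the angle `θ ∈ ℝ / 2πℤ`. -/
abbrev UCircle : Type := AddCircle (2 * Real.pi)

instance factTwoPiPos : Fact (0 < 2 * Real.pi) := ⟨Real.two_pi_pos⟩

/-- The point `e^{iθ}` of the complex plane. -/
def expI (θ : UCircle) : ℂ := (AddCircle.toCircle θ : ℂ)

/-- `dλ₀ = dθ / 2π`, the normalized Lebesgue measure on the circle. -/
def lam0 : Measure UCircle := AddCircle.haarAddCircle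

/-- `dλ_g = (1 - g cos θ) dλ₀`. -/
def lam (g : ℝ) : Measure UCircle :=
  lam0.withDensity fun θ => ENNReal.ofReal (1 - g * (expI θ).re)

variable {p : ℕ}

/-- Complex `p × p` matrices. -/
abbrev Mat (p : ℕ) : Type := Matrix (Fin p) (Fin p) ℂ

/-- A countably additive matrix-valued set function on the circle. -/
abbrev MatMeasure (p : ℕ) : Type := VectorMeasure UCircle (Mat p)

/-- The set `𝓜_p`: Hermitian nonnegative matrix measures with `μ(𝕋) = 1`. -/
structure IsNormalizedMatMeasure (μ : MatMeasure p) : Prop where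
  posSemidef : ∀ A : Set UCircle, MeasurableSet A → (μ A).PosSemidef
  normalized : μ Set.univ = 1

/-- The complex measure `A ↦ μ(A) i j`. -/
def entry (μ : MatMeasure p) (i j : Fin p) : ComplexMeasure UCircle :=
  μ.mapRange (Matrix.entryAddMonoidHom ℂ i j) (continuous_id.matrix_elem i j)

/-- The integral `∫ u dμ_{ij}` of a complex function against an entry of the matrix measure. -/
def entryIntegral (μ : MatMeasure p) (i j : Fin p) (u : UCircle → ℂ) : ℂ :=
  (entry μ i j).integral u (ContinuousLinearMap.mul ℝ ℂ)

/-- The value at `e^{iθ}` of a matrix polynomial `∑ₙ Aₙ zⁿ`. -/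
def evalCircle (f : Polynomial (Mat p)) (θ : UCircle) : Mat p :=
  f.eval (Matrix.scalar (Fin p) (expI θ))

/-- `⟨⟨f, g⟩⟩_R = ∫ f(e^{iθ})† dμ(θ) g(e^{iθ})`. -/
def innerR (μ : MatMeasure p) (f g : Polynomial (Mat p)) : Mat p :=
  Matrix.of fun a b => ∑ i, ∑ j,
    entryIntegral μ i j fun θ => star (evalCircle f θ i a) * evalCircle g θ j b

/-- `μ` is non-trivial: `tr ⟨⟨f, f⟩⟩_R > 0` for every non-zero matrix polynomial `f`. -/
def IsNontrivial (μ : MatMeasure p) : Prop :=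
  ∀ f : Polynomial (Mat p), f ≠ 0 → 0 < (innerR μ f f).trace

/-- The Carathéodory transform `F(z) = ∫ (e^{iθ} + z) / (e^{iθ} - z) dμ(θ)`. -/
def caratheodory (μ : MatMeasure p) (z : ℂ) : Mat p :=
  Matrix.of fun i j => entryIntegral μ i j fun θ => (expI θ + z) / (expI θ - z)

/-- `z⁻¹ (h(z) - h(0))` for `z ≠ 0`, continued to `z = 0` by the derivative `h'(0)`. -/
def divZ (h : ℂ → Mat p) (z : ℂ) : Mat p :=
  Matrix.of fun i j => dslope (fun w => h w i j) 0 z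

/-- The Schur transform `f(z) = z⁻¹ (F(z) - 1) (F(z) + 1)⁻¹` of a measure
(here `F(0) = μ(𝕋) = 1`, so that the function divided by `z` vanishes at `0`). -/
def schurFun (μ : MatMeasure p) : ℂ → Mat p :=
  divZ fun z => (caratheodory μ z - 1) * (caratheodory μ z + 1)⁻¹

/-- The right defect matrix `ρ^R = (1 - α α†)^{1/2}`. -/
def rhoR (α : Mat p) : Mat p := CFC.sqrt (1 - α * αᴴ)

/-- The left defect matrix `ρ^L = (1 - α† α)^{1/2}`. -/
def rhoL (α : Mat p) : Mat p := CFC.sqrt (1 - αᴴ * α)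

/-- One step of the Schur algorithm, with `α = f(0)`:
`(S f)(z) = z⁻¹ (ρ^R)⁻¹ (f(z) - α) (1 - α† f(z))⁻¹ ρ^L`. -/
def schurStep (f : ℂ → Mat p) (z : ℂ) : Mat p :=
  (rhoR (f 0))⁻¹ * divZ (fun w => (f w - f 0) * (1 - (f 0)ᴴ * f w)⁻¹) z * rhoL (f 0)

/-- The Verblunsky coefficients `α_k = f_k(0)`, where `f_0` is the Schur transform of `μ` and
`f_{k+1} = S f_k`. -/
def verblunsky (μ : MatMeasure p) (k : ℕ) : Mat p :=
  (schurStep^[k] (schurFun μ)) 0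

/-- The matrix density `h` in the Lebesgue decomposition `dμ = h dσ + dμ_s`. -/
def density (μ : MatMeasure p) (σ : Measure UCircle) (θ : UCircle) : Mat p :=
  Matrix.of fun i j => (entry μ i j).rnDeriv σ θ

/-- The extended real number `-log det h(θ)`, equal to `+∞` where `det h(θ) = 0`. -/
def negLogDet (μ : MatMeasure p) (σ : Measure UCircle) (θ : UCircle) : EReal :=
  -ENNReal.log (ENNReal.ofReal (density μ σ θ).det.re)

/-- The relative entropy `K(1·σ | μ) = -∫ log det h dσ`, where `dμ = h dσ + dμ_s`, as the integral
of the positive part of `-log det h` minus the integral of its negative part.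
(The latter is finite, since `log det h ≤ tr h - p`.) -/
def relEntropy (σ : Measure UCircle) (μ : MatMeasure p) : EReal :=
  ((∫⁻ θ, (negLogDet μ σ θ).toENNReal ∂σ : ENNReal) : EReal) -
    ((∫⁻ θ, (-negLogDet μ σ θ).toENNReal ∂σ : ENNReal) : EReal)

end MatrixOPUC

end

/-! Stopping the Schur algorithm after n steps with terminal value 0 produces matrix polynomials D =
v - zu and E = v + zu (`szegoPoly`, `szegoPoly₂`), with det D free of zeros in the closed disc. Two
facts tie them to μ: F D - E vanishes at 0 to order n + 1 (`caratheodory_relation`), and D†E + E†D =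
2 on the circle (`szegoPoly_defect_circle`). Hence the Bernstein–Szegő weight (DD†)⁻¹ dθ/2π shares
the moments of μ up to order n, and so its quadratic form on polynomials of degree at most n
(`integral_sandwich_szegoWeight`). With terminal value α_n one more order agrees and the form of μ
at D is 1 - α_n†α_n; non-triviality then shows inductively that every α_n is a strict contraction
(`posDef_one_sub_verblunsky`).

As log |det D| is the real part of an analytic function, its integral against 1 - g cos θ sees only
the first two Taylor coefficients of det D, and the recursion computes these
(`integral_log_norm_det_szegoPoly`): ∫ 2 log |det D| dλ_g = Σ -log det(1 - α_j†α_j) + g Re tr α_0 -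
g Σ Re tr α_j†α_{j+1}.

The entropy is finite exactly when these integrals (`szegoSum`) are bounded above in n. One
direction integrates log det(D†hD) ≤ tr(D†hD) - p, where ∫ tr D† dμ D = p
(`szegoSum_le_of_entropy`). The other is variational: Gibbs' inequality against the Bernstein–Szegő
weight bounds ∫ log det(c + BB†) dλ_g by a constant plus ∫ tr B† dμ B, for polynomial B and by L²
approximation for bounded measurable B (`integral_log_det_le_of_bounded`). The choice BB† = (c +
h)⁻¹ away from the singular part makes the last integral at most p, and c → 0 with Fatou's lemma
finishes (`entropy_ne_top_of_szegoSum_le`).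

It remains to decide when the explicit sums are bounded. Each cross term is at most half the sum of
the neighbouring tr α†α. For |g| < 1 it is absorbed by the logarithms. For g = ±1 it completes
squares tr|α_{k+1} ∓ α_k|², and what is left, -log det(1 - α†α) - tr α†α, is comparable to tr(α†α)²
for small α. -/

namespace MatrixOPUC

/-! ### Determinant and trace inequalities for positive matrices. -/

section LinearAlgebra

variable {p : ℕ}

theorem posSemidef_det_eq {A : Mat p} (hA : A.PosSemidef) : A.det = (A.det.re : ℂ) :=
  Complex.eq_re_of_ofReal_le (r := 0) (by simpa using hA.det_nonneg)

theorem posSemidef_det_re_nonneg {A : Mat p} (hA : A.PosSemidef) : 0 ≤ A.det.re :=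
  (Complex.le_def.1 hA.det_nonneg).1

theorem posDef_det_re_pos {A : Mat p} (hA : A.PosDef) : 0 < A.det.re :=
  (Complex.lt_def.1 hA.det_pos).1

theorem posSemidef_trace_re_nonneg {A : Mat p} (hA : A.PosSemidef) : 0 ≤ A.trace.re :=
  (Complex.le_def.1 hA.trace_nonneg).1

theorem det_re_eq_prod {A : Mat p} (hA : A.IsHermitian) :
    A.det.re = ∏ i, hA.eigenvalues i := by
  have h := hA.det_eq_prod_eigenvalues
  have h2 : A.det = ((∏ i, hA.eigenvalues i : ℝ) : ℂ) := by rw [h]; push_cast; rfl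
  rw [h2, Complex.ofReal_re]

theorem trace_re_eq_sum {A : Mat p} (hA : A.IsHermitian) :
    A.trace.re = ∑ i, hA.eigenvalues i := by
  have h := hA.trace_eq_sum_eigenvalues
  have h2 : A.trace = ((∑ i, hA.eigenvalues i : ℝ) : ℂ) := by rw [h]; push_cast; rfl
  rw [h2, Complex.ofReal_re]

theorem det_smul_one_sub_re_eq_prod {A : Mat p} (hA : A.IsHermitian) (t : ℝ) :
    (Matrix.scalar (Fin p) (t : ℂ) - A).det.re = ∏ i, (t - hA.eigenvalues i) := by
  have h2 : (Matrix.scalar (Fin p) (t : ℂ) - A).det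
      = ((∏ i, (t - hA.eigenvalues i) : ℝ) : ℂ) := by
    rw [← Matrix.eval_charpoly, hA.charpoly_eq, Polynomial.eval_prod]
    push_cast
    simp
  rw [h2, Complex.ofReal_re]

theorem trace_sq_re_eq_sum {A : Mat p} (hA : A.IsHermitian) :
    (A ^ 2).trace.re = ∑ i, hA.eigenvalues i ^ 2 := by
  have h := hA.spectral_theorem
  have h2 : (A ^ 2).trace = ((∑ i, hA.eigenvalues i ^ 2 : ℝ) : ℂ) := by
    conv_lhs => rw [h]
    rw [← map_pow, Unitary.conjStarAlgAut_apply, Matrix.trace_mul_comm, ← mul_assoc,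
      Unitary.coe_star_mul_self, one_mul, Matrix.diagonal_pow, Matrix.trace_diagonal]
    push_cast
    rfl
  rw [h2, Complex.ofReal_re]

/-- `log det X ≤ tr X - p`. -/
theorem log_det_le_trace_sub {X : Mat p} (hX : X.PosSemidef) (h0 : 0 < X.det.re) :
    Real.log X.det.re ≤ X.trace.re - p := by
  rw [det_re_eq_prod hX.1] at h0 ⊢
  rw [trace_re_eq_sum hX.1]
  have hne : ∀ i ∈ Finset.univ, hX.1.eigenvalues i ≠ 0 := fun i hi h =>
    h0.ne' (Finset.prod_eq_zero hi h)
  rw [Real.log_prod hne]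
  have : ∑ i, Real.log (hX.1.eigenvalues i) ≤ ∑ i : Fin p, (hX.1.eigenvalues i - 1) :=
    Finset.sum_le_sum fun i hi => Real.log_le_sub_one_of_pos
      (lt_of_le_of_ne (hX.eigenvalues_nonneg i) (hne i hi).symm)
  simpa [Finset.sum_sub_distrib] using this

theorem one_le_det_one_add {A : Mat p} (hA : A.PosSemidef) : 1 ≤ (1 + A).det.re := by
  -- The characteristic polynomial of -A at 1 is det(1 + A), and -A has nonpositive eigenvalues.
  have h := det_smul_one_sub_re_eq_prod (A := -A) hA.1.neg 1
  have e : Matrix.scalar (Fin p) ((1 : ℝ) : ℂ) - -A = 1 + A := by simp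
  have hpos : ∀ i, hA.1.neg.eigenvalues i ≤ 0 := by
    intro i
    have := hA.1.neg.eigenvalues_eq i
    rw [this]
    have h3 := hA.re_dotProduct_nonneg (hA.1.neg.eigenvectorBasis i).ofLp
    rw [Matrix.neg_mulVec, dotProduct_neg, map_neg]
    linarith
  rw [← e, h]
  calc (1 : ℝ) = ∏ _i : Fin p, (1 : ℝ) := by simp
    _ ≤ _ := Finset.prod_le_prod (fun _ _ => zero_le_one) fun i _ => by
      have := hpos i
      linarith

/-- Every positive semidefinite matrix is a Gram matrix. -/
theorem posSemidef_exists_gram {A : Mat p} (hA : A.PosSemidef) : ∃ B : Mat p, A = Bᴴ * B :=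
  CStarAlgebra.nonneg_iff_eq_star_mul_self.mp hA.nonneg

/-- The Gibbs inequality for positive matrices. -/
theorem log_det_add_log_det_le {A X : Mat p} (hA : A.PosDef) (hX : X.PosSemidef)
    (h0 : 0 < X.det.re) :
    Real.log A.det.re + Real.log X.det.re ≤ (A * X).trace.re - p := by
  obtain ⟨B, rfl⟩ := posSemidef_exists_gram hA.posSemidef
  have hd : (B * X * Bᴴ).det = (Bᴴ * B).det * X.det := by
    simp only [Matrix.det_mul]; ring
  have hdr : (B * X * Bᴴ).det.re = (Bᴴ * B).det.re * X.det.re := by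
    rw [hd, posSemidef_det_eq hA.posSemidef, posSemidef_det_eq hX, ← Complex.ofReal_mul,
      Complex.ofReal_re, Complex.ofReal_re, Complex.ofReal_re]
  have hpos := posDef_det_re_pos hA
  rw [← Real.log_mul hpos.ne' h0.ne', ← hdr]
  have := log_det_le_trace_sub (hX.mul_mul_conjTranspose_same B)
    (by rw [hdr]; exact mul_pos hpos h0)
  rwa [Matrix.trace_mul_comm, ← mul_assoc] at this

/-- Concavity of log det in the form of its tangent at B; this is Gibbs' inequality for the pair
B⁻¹, A. -/
theorem log_det_sub_log_det_le {A B : Mat p} (hA : A.PosDef) (hB : B.PosDef) :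
    Real.log A.det.re - Real.log B.det.re ≤ (B⁻¹ * (A - B)).trace.re := by
  have h := log_det_add_log_det_le hB.inv hA.posSemidef (posDef_det_re_pos hA)
  have hu : IsUnit B.det := (Matrix.isUnit_iff_isUnit_det _).1 hB.isUnit
  have h1 : B⁻¹.det.re = (B.det.re)⁻¹ := by
    rw [Matrix.det_nonsing_inv, Ring.inverse_eq_inv', posSemidef_det_eq hB.posSemidef,
      ← Complex.ofReal_inv, Complex.ofReal_re, Complex.ofReal_re]
  rw [h1, Real.log_inv] at h
  rw [mul_sub, Matrix.nonsing_inv_mul _ hu, Matrix.trace_sub, Complex.sub_re]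
  simp
  linarith

/-- The principal minor on the indices i, j gives |A_ij|² ≤ A_ii A_jj. This is why the trace measure
dominates every entry of a matrix measure. -/
theorem norm_entry_le_trace {A : Mat p} (hA : A.PosSemidef) (i j : Fin p) :
    ‖A i j‖ ≤ A.trace.re := by
  have hd : ∀ k, 0 ≤ (A k k).re ∧ A k k = ((A k k).re : ℂ) := by
    intro k
    have h := hA.diag_nonneg (i := k)
    exact ⟨(Complex.le_def.1 h).1, Complex.eq_re_of_ofReal_le (r := 0) (by simpa using h)⟩
  have hle : ∀ k, (A k k).re ≤ A.trace.re := by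
    intro k
    rw [Matrix.trace, Complex.re_sum]
    exact Finset.single_le_sum (f := fun l => (A.diag l).re) (fun l _ => (hd l).1)
      (Finset.mem_univ k)
  have h2 := (hA.submatrix ![i, j]).det_nonneg
  rw [Matrix.det_fin_two] at h2
  simp only [Matrix.submatrix_apply, Matrix.cons_val_zero, Matrix.cons_val_one] at h2
  have h3 : A j i = star (A i j) := by
    rw [← Matrix.conjTranspose_apply, hA.1.eq]
  rw [h3, (hd i).2, (hd j).2] at h2
  have h4 : ‖A i j‖ ^ 2 ≤ (A i i).re * (A j j).re := by
    have := (Complex.le_def.1 h2).1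
    simp [Complex.sq_norm, Complex.normSq_apply] at this ⊢
    linarith
  have h5 : ‖A i j‖ ^ 2 ≤ A.trace.re ^ 2 := by
    have := mul_le_mul (hle i) (hle j) (hd j).1 ((hd i).1.trans (hle i))
    nlinarith
  exact abs_le_of_sq_le_sq' h5 ((hd i).1.trans (hle i)) |>.2

/-- With X = c + A, the trace of 1 = cX⁻¹ + X⁻¹A is p and tr X⁻¹A ≥ 0, so tr X⁻¹ ≤ p / c; the trace
dominates the entries. -/
theorem norm_inv_entry_le {A : Mat p} {c : ℝ} (hc : 0 < c) (hA : A.PosSemidef) (i j : Fin p) :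
    ‖((Matrix.scalar (Fin p) (c : ℂ) + A)⁻¹ : Mat p) i j‖ ≤ p / c := by
  have hs : (Matrix.scalar (Fin p) (c : ℂ)).PosDef := by
    rw [Matrix.scalar_apply, Matrix.posDef_diagonal_iff]
    intro _; exact_mod_cast hc
  set X := Matrix.scalar (Fin p) (c : ℂ) + A with hX
  have hXd : X.PosDef := hs.add_posSemidef hA
  have hu : IsUnit X.det := (Matrix.isUnit_iff_isUnit_det _).1 hXd.isUnit
  refine (norm_entry_le_trace hXd.inv.posSemidef i j).trans ?_
  have h1 : X⁻¹ * Matrix.scalar (Fin p) (c : ℂ) + X⁻¹ * A = 1 := by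
    rw [← mul_add, Matrix.nonsing_inv_mul _ hu]
  have h2 : 0 ≤ (X⁻¹ * A).trace.re := by
    obtain ⟨B, hB⟩ := posSemidef_exists_gram hA
    rw [hB, ← mul_assoc, Matrix.trace_mul_comm, ← mul_assoc]
    exact posSemidef_trace_re_nonneg (hXd.inv.posSemidef.mul_mul_conjTranspose_same B)
  have h3 := congrArg (fun Y : Mat p => Y.trace.re) h1
  have h4 : X⁻¹ * Matrix.scalar (Fin p) (c : ℂ) = (c : ℂ) • X⁻¹ := by
    rw [Matrix.scalar_apply, ← Matrix.smul_one_eq_diagonal]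
    simp
  simp only [h4, Matrix.trace_add, Matrix.trace_smul, Complex.add_re, smul_eq_mul,
    Complex.re_ofReal_mul, Matrix.trace_one, Fintype.card_fin, Complex.natCast_re] at h3
  rw [le_div_iff₀ hc]
  linarith

/-! ### Strict contractions: comparing -log det(1 - α†α) with traces. -/

section Contraction

variable {α : Mat p}

theorem contraction_eigenvalues_lt_one (h : (1 - αᴴ * α).PosDef) (i : Fin p) :
    (Matrix.posSemidef_conjTranspose_mul_self α).1.eigenvalues i < 1 := by
  set hA := (Matrix.posSemidef_conjTranspose_mul_self α).1
  set x := (hA.eigenvectorBasis i).ofLp with hx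
  have hne : x ≠ 0 := by
    intro h0
    have h1 : hA.eigenvectorBasis i = 0 := by
      ext k; exact congrFun h0 k
    exact hA.eigenvectorBasis.orthonormal.ne_zero i h1
  have h2 := h.dotProduct_mulVec_pos hne
  rw [Matrix.sub_mulVec, Matrix.one_mulVec, hx, hA.mulVec_eigenvectorBasis, ← hx, dotProduct_sub,
    dotProduct_smul] at h2
  have h3 : 0 < star x ⬝ᵥ x := Matrix.dotProduct_star_self_pos_iff.2 hne
  have h4 := (Complex.lt_def.1 h2).1
  have h5 := (Complex.lt_def.1 h3).1
  simp at h4 h5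
  by_contra hcon
  push Not at hcon
  nlinarith

theorem trace_conjTranspose_mul_self_re_nonneg (α : Mat p) : 0 ≤ (αᴴ * α).trace.re :=
  posSemidef_trace_re_nonneg (Matrix.posSemidef_conjTranspose_mul_self α)

theorem trace_sq_mul_conjTranspose (α : Mat p) :
    ((α * αᴴ) ^ 2).trace = ((αᴴ * α) ^ 2).trace := by
  rw [pow_two, pow_two, mul_assoc, Matrix.trace_mul_comm]
  simp only [mul_assoc]

theorem det_one_sub_eq_prod (α : Mat p) :
    (1 - αᴴ * α).det.re =
      ∏ i, (1 - (Matrix.posSemidef_conjTranspose_mul_self α).1.eigenvalues i) := by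
  have := det_smul_one_sub_re_eq_prod (Matrix.posSemidef_conjTranspose_mul_self α).1 1
  simpa using this

theorem neg_log_det_eq_sum (h : (1 - αᴴ * α).PosDef) :
    -Real.log (1 - αᴴ * α).det.re =
      ∑ i, -Real.log (1 - (Matrix.posSemidef_conjTranspose_mul_self α).1.eigenvalues i) := by
  rw [det_one_sub_eq_prod, Real.log_prod, Finset.sum_neg_distrib]
  intro i _
  have := contraction_eigenvalues_lt_one h i
  linarith

theorem trace_sq_le_trace (h : (1 - αᴴ * α).PosDef) :
    ((αᴴ * α) ^ 2).trace.re ≤ (αᴴ * α).trace.re := by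
  rw [trace_sq_re_eq_sum (Matrix.posSemidef_conjTranspose_mul_self α).1,
    trace_re_eq_sum (Matrix.posSemidef_conjTranspose_mul_self α).1]
  refine Finset.sum_le_sum fun i _ => ?_
  have h1 := contraction_eigenvalues_lt_one h i
  have h2 := (Matrix.posSemidef_conjTranspose_mul_self α).eigenvalues_nonneg i
  nlinarith

theorem trace_le_card (h : (1 - αᴴ * α).PosDef) : (αᴴ * α).trace.re ≤ p := by
  rw [trace_re_eq_sum (Matrix.posSemidef_conjTranspose_mul_self α).1]
  calc _ ≤ ∑ i : Fin p, (1 : ℝ) :=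
        Finset.sum_le_sum fun i _ => (contraction_eigenvalues_lt_one h i).le
    _ = p := by simp

theorem trace_sq_nonneg (α : Mat p) : 0 ≤ ((αᴴ * α) ^ 2).trace.re := by
  rw [trace_sq_re_eq_sum (Matrix.posSemidef_conjTranspose_mul_self α).1]
  positivity

/-- `x + x² / 2 ≤ -log (1 - x)` for `0 ≤ x < 1`. -/
theorem add_sq_half_le_neg_log {x : ℝ} (h0 : 0 ≤ x) (h1 : x < 1) :
    x + x ^ 2 / 2 ≤ -Real.log (1 - x) := by
  have h := Real.hasSum_pow_div_log_of_abs_lt_one (abs_lt.2 ⟨by linarith, h1⟩)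
  have h2 := sum_le_hasSum (Finset.range 2) (fun i _ => by positivity) h
  simp [Finset.sum_range_succ] at h2
  norm_num at h2
  linarith

/-- `-log (1 - x) ≤ x + 2 x²` for `0 ≤ x ≤ 1 / 2`. -/
theorem neg_log_le_add_sq {x : ℝ} (h0 : 0 ≤ x) (h1 : x ≤ 1 / 2) :
    -Real.log (1 - x) ≤ x + 2 * x ^ 2 := by
  have hb := Real.abs_log_sub_add_sum_range_le (x := x) (abs_lt.2 ⟨by linarith, by linarith⟩) 1
  simp at hb
  have h2 := (abs_le.1 hb).1
  have h3 : x ^ 2 / (1 - |x|) ≤ 2 * x ^ 2 := by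
    rw [abs_of_nonneg h0, div_le_iff₀ (by linarith)]
    nlinarith
  linarith

/-- The quadratic term is kept because at g = ±1 the linear one is consumed by the cross terms. -/
theorem trace_add_half_trace_sq_le (h : (1 - αᴴ * α).PosDef) :
    (αᴴ * α).trace.re + ((αᴴ * α) ^ 2).trace.re / 2 ≤ -Real.log (1 - αᴴ * α).det.re := by
  rw [neg_log_det_eq_sum h, trace_sq_re_eq_sum (Matrix.posSemidef_conjTranspose_mul_self α).1,
    trace_re_eq_sum (Matrix.posSemidef_conjTranspose_mul_self α).1, Finset.sum_div,
    ← Finset.sum_add_distrib]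
  exact Finset.sum_le_sum fun i _ => add_sq_half_le_neg_log
    ((Matrix.posSemidef_conjTranspose_mul_self α).eigenvalues_nonneg i)
    (contraction_eigenvalues_lt_one h i)

/-- A sum of squared eigenvalues of at most 1/4 puts each eigenvalue in [0, 1/2], the range of
`neg_log_le_add_sq`. -/
theorem neg_log_det_le (h : (1 - αᴴ * α).PosDef) (hb : ((αᴴ * α) ^ 2).trace.re ≤ 1 / 4) :
    -Real.log (1 - αᴴ * α).det.re ≤ (αᴴ * α).trace.re + 2 * ((αᴴ * α) ^ 2).trace.re := by
  rw [trace_sq_re_eq_sum (Matrix.posSemidef_conjTranspose_mul_self α).1] at hb ⊢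
  rw [neg_log_det_eq_sum h,
    trace_re_eq_sum (Matrix.posSemidef_conjTranspose_mul_self α).1,
    Finset.mul_sum, ← Finset.sum_add_distrib]
  refine Finset.sum_le_sum fun i _ => neg_log_le_add_sq
    ((Matrix.posSemidef_conjTranspose_mul_self α).eigenvalues_nonneg i) ?_
  have h1 := Finset.single_le_sum (f := fun j =>
    (Matrix.posSemidef_conjTranspose_mul_self α).1.eigenvalues j ^ 2)
    (fun j _ => sq_nonneg _) (Finset.mem_univ i)
  have h2 := (Matrix.posSemidef_conjTranspose_mul_self α).eigenvalues_nonneg i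
  have h3 : (Matrix.posSemidef_conjTranspose_mul_self α).1.eigenvalues i ^ 2 ≤ 1 / 4 := h1.trans hb
  nlinarith

end Contraction

end LinearAlgebra

/-! ### Fourier coefficients of log |q| on the circle, and the measures λ_g. -/

section CircleIntegrals

instance isProbabilityMeasure_lam0 : IsProbabilityMeasure lam0 :=
  inferInstanceAs (IsProbabilityMeasure AddCircle.haarAddCircle)

theorem continuous_expI : Continuous expI :=
  continuous_subtype_val.comp AddCircle.continuous_toCircle

theorem norm_expI (θ : UCircle) : ‖expI θ‖ = 1 := Circle.norm_coe _

theorem expI_ne_zero (θ : UCircle) : expI θ ≠ 0 := by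
  rw [← norm_ne_zero_iff, norm_expI]; exact one_ne_zero

theorem star_expI (θ : UCircle) : star (expI θ) = (expI θ)⁻¹ :=
  (Circle.coe_inv_eq_conj _).symm

theorem continuous_integrable {E : Type*} [NormedAddCommGroup E] {f : UCircle → E}
    (hf : Continuous f) (ν : Measure UCircle) [IsFiniteMeasure ν] : Integrable f ν :=
  hf.integrable_of_hasCompactSupport (HasCompactSupport.of_compactSpace f)

theorem integral_lam0_eq_circleAverage {E : Type*} [NormedAddCommGroup E] [NormedSpace ℝ E]
    (f : ℂ → E) : ∫ θ, f (expI θ) ∂lam0 = Real.circleAverage f 0 1 := by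
  rw [lam0, AddCircle.integral_haarAddCircle, Real.circleAverage,
    ← AddCircle.intervalIntegral_preimage (2 * Real.pi) 0, zero_add]
  congr 1
  refine intervalIntegral.integral_congr fun x _ => ?_
  simp only [expI, AddCircle.toCircle_apply_mk, Circle.coe_exp, circleMap]
  rw [div_self Real.two_pi_pos.ne']
  simp

/-- The mean value property. -/
theorem integral_lam0_of_differentiableOn {E : Type*} [NormedAddCommGroup E] [NormedSpace ℂ E]
    [CompleteSpace E] {f : ℂ → E} {U : Set ℂ} (hf : DifferentiableOn ℂ f U)
    (hU : Metric.closedBall 0 1 ⊆ U) : ∫ θ, f (expI θ) ∂lam0 = f 0 := by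
  rw [integral_lam0_eq_circleAverage]
  refine DiffContOnCl.circleAverage ?_
  rw [abs_one]
  exact hf.diffContOnCl_ball hU

theorem integral_expI_mul {f : ℂ → ℂ} {U : Set ℂ} (hf : DifferentiableOn ℂ f U)
    (hU : Metric.closedBall 0 1 ⊆ U) : ∫ θ, expI θ * f (expI θ) ∂lam0 = 0 := by
  have := integral_lam0_of_differentiableOn (f := fun z => z * f z) (differentiableOn_id.mul hf) hU
  simpa using this

theorem integral_expI : ∫ θ, expI θ ∂lam0 = 0 := by
  have := integral_expI_mul (f := fun _ => 1) (U := Set.univ) (by fun_prop) (Set.subset_univ _)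
  simpa using this

/-- Since f 0 = 0, f(z)/z continues analytically to 0 as `dslope`, with value f'(0) there; the mean
value property applies to it. -/
theorem integral_inv_expI_mul {f : ℂ → ℂ} {U : Set ℂ} (hf : DifferentiableOn ℂ f U)
    (hU : Metric.closedBall 0 1 ⊆ U) (h0 : f 0 = 0) :
    ∫ θ, (expI θ)⁻¹ * f (expI θ) ∂lam0 = deriv f 0 := by
  have hn : U ∈ nhds (0 : ℂ) :=
    Filter.mem_of_superset (Metric.closedBall_mem_nhds 0 one_pos) hU
  have := integral_lam0_of_differentiableOn ((Complex.differentiableOn_dslope hn).2 hf) hU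
  rw [dslope_same] at this
  rw [← this]
  refine integral_congr_ae (Filter.Eventually.of_forall fun θ => ?_)
  simp [dslope_of_ne _ (expI_ne_zero θ), slope_def_field, h0, div_eq_inv_mul]

/-- For `|a| < 1`: the zeroth and the first cosine Fourier coefficient of
`log |1 - a e^{iθ}|`. -/
theorem integral_log_one_sub {a : ℂ} (ha : ‖a‖ < 1) :
    ∫ θ, Real.log ‖1 - a * expI θ‖ ∂lam0 = 0 ∧
    ∫ θ, (expI θ).re * Real.log ‖1 - a * expI θ‖ ∂lam0 = -a.re / 2 := by
  set U : Set ℂ := {z | ‖a * z‖ < 1} with hUdef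
  have hU : Metric.closedBall 0 1 ⊆ U := by
    intro z hz
    have hz' : ‖z‖ ≤ 1 := by simpa using hz
    simp only [hUdef, Set.mem_ofPred_eq, norm_mul]
    nlinarith [norm_nonneg a, norm_nonneg z]
  set f : ℂ → ℂ := fun z => Complex.log (1 - a * z) with hf
  have hslit : ∀ z ∈ U, 1 - a * z ∈ Complex.slitPlane := by
    intro z hz
    left
    have := (Complex.re_le_norm (a * z)).trans_lt hz
    simpa using this
  have hd : DifferentiableOn ℂ f U := fun z hz =>
    ((((differentiableAt_const _).sub
      ((differentiableAt_const _).mul differentiableAt_id)).clog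
        (hslit z hz))).differentiableWithinAt
  have hmem : ∀ θ, expI θ ∈ U := fun θ => hU (by simp [norm_expI])
  have hre : ∀ θ, Real.log ‖1 - a * expI θ‖ = (f (expI θ)).re := fun θ => (Complex.log_re _).symm
  have hc : Continuous fun θ => f (expI θ) := by
    rw [continuous_iff_continuousAt]
    intro θ
    exact ContinuousAt.clog (by have := continuous_expI; fun_prop) (hslit _ (hmem θ))
  have h0 : f 0 = 0 := by simp [hf]
  have h1 := integral_lam0_of_differentiableOn hd hU
  have h2 := integral_expI_mul hd hU
  have h3 := integral_inv_expI_mul hd hU h0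
  have hder : deriv f 0 = -a := by
    have : HasDerivAt f (-a / (1 - a * 0)) 0 := by
      refine HasDerivAt.clog ?_ (by simp)
      simpa using ((hasDerivAt_id (0 : ℂ)).const_mul a).const_sub 1
    simpa using this.deriv
  have hinv : Continuous fun θ => (expI θ)⁻¹ := continuous_expI.inv₀ expI_ne_zero
  refine ⟨?_, ?_⟩
  · simp_rw [hre]
    have := integral_re (continuous_integrable hc lam0)
    simp only [RCLike.re_eq_complex_re] at this
    rw [this, h1, h0, Complex.zero_re]
  -- 2 cos θ = z + z⁻¹ on the circle. Of the two products, z f integrates to 0 and z⁻¹ f to f'(0) =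
  -- -a.
  · have key : ∀ θ, (expI θ).re * Real.log ‖1 - a * expI θ‖ =
        ((expI θ * f (expI θ) + (expI θ)⁻¹ * f (expI θ)) / 2).re := by
      intro θ
      rw [hre, ← add_mul, ← star_expI, Complex.star_def, Complex.add_conj, mul_div_right_comm,
        Complex.mul_re]
      simp
    simp_rw [key]
    have i1 : Integrable (fun θ => expI θ * f (expI θ)) lam0 :=
      continuous_integrable (continuous_expI.mul hc) lam0
    have i2 : Integrable (fun θ => (expI θ)⁻¹ * f (expI θ)) lam0 :=
      continuous_integrable (hinv.mul hc) lam0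
    have := integral_re ((i1.add i2).div_const 2)
    simp only [RCLike.re_eq_complex_re, Pi.add_apply] at this
    rw [this, integral_div, integral_add i1 i2, h2, h3, hder]
    simp

theorem continuous_log_norm {f : UCircle → ℂ} (hf : Continuous f) (h0 : ∀ θ, f θ ≠ 0) :
    Continuous fun θ => Real.log ‖f θ‖ :=
  hf.norm.log fun θ => norm_ne_zero_iff.2 (h0 θ)

open Polynomial in
/-- The zeroth and the first cosine Fourier coefficient of `log |q|` for a polynomial without
zeros in the closed unit disc. -/
theorem integral_log_norm_polynomial (q : ℂ[X]) (hq : ∀ z : ℂ, ‖z‖ ≤ 1 → q.eval z ≠ 0) :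
    ∫ θ, Real.log ‖q.eval (expI θ)‖ ∂lam0 = Real.log ‖q.coeff 0‖ ∧
    ∫ θ, (expI θ).re * Real.log ‖q.eval (expI θ)‖ ∂lam0 = (q.coeff 1 / q.coeff 0).re / 2 := by
  -- Both sides of both identities turn products into sums, so constants and linear factors suffice.
  have hmul : ∀ q₁ q₂ : ℂ[X], (∀ z : ℂ, ‖z‖ ≤ 1 → (q₁ * q₂).eval z ≠ 0) →
      (∫ θ, Real.log ‖q₁.eval (expI θ)‖ ∂lam0 = Real.log ‖q₁.coeff 0‖ ∧
        ∫ θ, (expI θ).re * Real.log ‖q₁.eval (expI θ)‖ ∂lam0 =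
          (q₁.coeff 1 / q₁.coeff 0).re / 2) →
      (∫ θ, Real.log ‖q₂.eval (expI θ)‖ ∂lam0 = Real.log ‖q₂.coeff 0‖ ∧
        ∫ θ, (expI θ).re * Real.log ‖q₂.eval (expI θ)‖ ∂lam0 =
          (q₂.coeff 1 / q₂.coeff 0).re / 2) →
      (∫ θ, Real.log ‖(q₁ * q₂).eval (expI θ)‖ ∂lam0 = Real.log ‖(q₁ * q₂).coeff 0‖ ∧
        ∫ θ, (expI θ).re * Real.log ‖(q₁ * q₂).eval (expI θ)‖ ∂lam0 =
          ((q₁ * q₂).coeff 1 / (q₁ * q₂).coeff 0).re / 2) := by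
    intro q₁ q₂ h h1 h2
    have hn : ∀ z : ℂ, ‖z‖ ≤ 1 → q₁.eval z ≠ 0 ∧ q₂.eval z ≠ 0 := by
      intro z hz
      have := h z hz
      rw [eval_mul] at this
      exact mul_ne_zero_iff.1 this
    have hc : ∀ q : ℂ[X], Continuous fun θ => q.eval (expI θ) := fun q =>
      q.continuous.comp continuous_expI
    have e1 : ∀ θ, q₁.eval (expI θ) ≠ 0 := fun θ => (hn _ (norm_expI θ).le).1
    have e2 : ∀ θ, q₂.eval (expI θ) ≠ 0 := fun θ => (hn _ (norm_expI θ).le).2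
    have c1 := continuous_log_norm (hc q₁) e1
    have c2 := continuous_log_norm (hc q₂) e2
    have hl : ∀ θ, Real.log ‖(q₁ * q₂).eval (expI θ)‖ =
        Real.log ‖q₁.eval (expI θ)‖ + Real.log ‖q₂.eval (expI θ)‖ := fun θ => by
      rw [eval_mul, norm_mul, Real.log_mul (norm_ne_zero_iff.2 (e1 θ)) (norm_ne_zero_iff.2 (e2 θ))]
    have z0 := hn 0 (by simp)
    rw [← coeff_zero_eq_eval_zero, ← coeff_zero_eq_eval_zero] at z0
    have hre : Continuous fun θ => (expI θ).re := Complex.continuous_re.comp continuous_expI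
    have i1 : Integrable (fun θ => (expI θ).re * Real.log ‖q₁.eval (expI θ)‖) lam0 :=
      continuous_integrable (hre.mul c1) _
    have i2 : Integrable (fun θ => (expI θ).re * Real.log ‖q₂.eval (expI θ)‖) lam0 :=
      continuous_integrable (hre.mul c2) _
    simp_rw [hl, mul_add]
    rw [integral_add (continuous_integrable c1 _) (continuous_integrable c2 _),
      integral_add i1 i2,
      h1.1, h2.1, h1.2, h2.2, mul_coeff_zero, norm_mul,
      Real.log_mul (norm_ne_zero_iff.2 z0.1) (norm_ne_zero_iff.2 z0.2)]
    refine ⟨rfl, ?_⟩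
    rw [← add_div, ← Complex.add_re, mul_coeff_one]
    congr 2
    have := z0.1; have := z0.2
    field_simp
    ring
  have hconst : ∀ c : ℂ, ∫ θ, Real.log ‖(C c).eval (expI θ)‖ ∂lam0 = Real.log ‖(C c).coeff 0‖ ∧
        ∫ θ, (expI θ).re * Real.log ‖(C c).eval (expI θ)‖ ∂lam0 =
          ((C c).coeff 1 / (C c).coeff 0).re / 2 := by
    intro c
    have h := integral_re (continuous_integrable continuous_expI lam0)
    simp only [RCLike.re_eq_complex_re, integral_expI] at h
    simp [integral_mul_const, h, coeff_C]
  have hlin : ∀ ζ : ℂ, 1 < ‖ζ‖ →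
      ∫ θ, Real.log ‖(X - C ζ).eval (expI θ)‖ ∂lam0 = Real.log ‖(X - C ζ).coeff 0‖ ∧
        ∫ θ, (expI θ).re * Real.log ‖(X - C ζ).eval (expI θ)‖ ∂lam0 =
          ((X - C ζ).coeff 1 / (X - C ζ).coeff 0).re / 2 := by
    intro ζ hζ
    have hζ0 : ζ ≠ 0 := by rintro rfl; norm_num at hζ
    -- A root outside the closed disc gives a factor 1 - az with a = ζ⁻¹ of modulus less than 1.
    have e : X - C ζ = C (-ζ) * (C 1 - C ζ⁻¹ * X) := by
      rw [mul_sub, ← mul_assoc, ← C_mul, ← C_mul]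
      simp [hζ0]
      ring
    rw [e]
    have ha : ‖ζ⁻¹‖ < 1 := by rw [norm_inv]; exact inv_lt_one_of_one_lt₀ hζ
    refine hmul _ _ ?_ (hconst _) ?_
    · intro z hz
      rw [← e]
      simp only [eval_sub, eval_X, eval_C]
      intro h
      rw [sub_eq_zero.1 h] at hz
      linarith
    · have h := integral_log_one_sub ha
      simpa [coeff_X, coeff_one, neg_div] using h
  have hsplit := (IsAlgClosed.splits q).eq_prod_roots
  have hprod : ∀ s : Multiset ℂ, (∀ ζ ∈ s, 1 < ‖ζ‖) →
      ((∀ z : ℂ, ‖z‖ ≤ 1 → ((s.map fun a => X - C a).prod).eval z ≠ 0) ∧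
      ∫ θ, Real.log ‖((s.map fun a => X - C a).prod).eval (expI θ)‖ ∂lam0 =
        Real.log ‖((s.map fun a => X - C a).prod).coeff 0‖ ∧
        ∫ θ, (expI θ).re * Real.log ‖((s.map fun a => X - C a).prod).eval (expI θ)‖ ∂lam0 =
          (((s.map fun a => X - C a).prod).coeff 1 /
            ((s.map fun a => X - C a).prod).coeff 0).re / 2) := by
    intro s
    induction s using Multiset.induction_on with
    | empty =>
      intro _
      refine ⟨by simp, ?_⟩
      simpa using hconst 1
    | cons a s ih =>
      intro h
      have ih' := ih fun ζ hζ => h ζ (Multiset.mem_cons_of_mem hζ)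
      have ha := h a (Multiset.mem_cons_self a s)
      have hz : ∀ z : ℂ, ‖z‖ ≤ 1 →
          ((X - C a) * (s.map fun a => X - C a).prod).eval z ≠ 0 := by
        intro z hz
        rw [eval_mul]
        refine mul_ne_zero ?_ (ih'.1 z hz)
        simp only [eval_sub, eval_X, eval_C]
        intro h
        rw [sub_eq_zero.1 h] at hz
        linarith
      rw [Multiset.map_cons, Multiset.prod_cons]
      exact ⟨hz, hmul _ _ hz (hlin a ha) ih'.2⟩
  have hroots : ∀ ζ ∈ q.roots, 1 < ‖ζ‖ := by
    intro ζ hζ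
    by_contra hcon
    exact hq ζ (not_lt.1 hcon) (isRoot_of_mem_roots hζ)
  rw [hsplit] at hq ⊢
  exact hmul _ _ hq (hconst _) (by simpa using (hprod _ hroots).2)

/-- The density of `λ_g` with respect to `λ₀`. -/
noncomputable def weight (g : ℝ) (θ : UCircle) : ℝ := 1 - g * (expI θ).re

theorem continuous_weight (g : ℝ) : Continuous (weight g) := by
  have := Complex.continuous_re.comp continuous_expI
  unfold weight
  fun_prop

theorem abs_mul_re_expI_le {g : ℝ} (hg : |g| ≤ 1) (θ : UCircle) : |g * (expI θ).re| ≤ 1 := by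
  rw [abs_mul]
  have h := Complex.abs_re_le_norm (expI θ)
  rw [norm_expI] at h
  nlinarith [abs_nonneg g, abs_nonneg (expI θ).re]

theorem weight_nonneg {g : ℝ} (hg : |g| ≤ 1) (θ : UCircle) : 0 ≤ weight g θ := by
  have := (abs_le.1 (abs_mul_re_expI_le hg θ)).2
  unfold weight; linarith

theorem weight_le_two {g : ℝ} (hg : |g| ≤ 1) (θ : UCircle) : weight g θ ≤ 2 := by
  have := (abs_le.1 (abs_mul_re_expI_le hg θ)).1
  unfold weight; linarith

theorem integral_lam {E : Type*} [NormedAddCommGroup E] [NormedSpace ℝ E] {g : ℝ} (hg : |g| ≤ 1)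
    (f : UCircle → E) : ∫ θ, f θ ∂(lam g) = ∫ θ, weight g θ • f θ ∂lam0 := by
  have hm : Measurable fun θ => ENNReal.ofReal (weight g θ) :=
    (continuous_weight g).measurable.ennreal_ofReal
  have := integral_withDensity_eq_integral_toReal_smul (μ := lam0) hm
    (Filter.Eventually.of_forall fun _ => ENNReal.ofReal_lt_top) f
  rw [lam]
  refine this.trans (integral_congr_ae (Filter.Eventually.of_forall fun θ => ?_))
  simp only
  rw [ENNReal.toReal_ofReal (weight_nonneg hg θ)]

theorem integral_weight (g : ℝ) : ∫ θ, weight g θ ∂lam0 = 1 := by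
  have h := integral_re (continuous_integrable continuous_expI lam0)
  simp only [RCLike.re_eq_complex_re, integral_expI, Complex.zero_re] at h
  have hre : Continuous fun θ => (expI θ).re := Complex.continuous_re.comp continuous_expI
  unfold weight
  rw [integral_sub (integrable_const _) (continuous_integrable (hre.const_mul g) _),
    integral_const_mul, h]
  simp

theorem isProbabilityMeasure_lam {g : ℝ} (hg : |g| ≤ 1) : IsProbabilityMeasure (lam g) := by
  refine ⟨?_⟩
  have : lam g Set.univ = ∫⁻ θ, ENNReal.ofReal (weight g θ) ∂lam0 := by
    rw [lam, withDensity_apply _ MeasurableSet.univ, Measure.restrict_univ]; rfl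
  rw [this, ← ofReal_integral_eq_lintegral_ofReal
    (continuous_integrable (continuous_weight g) _)
    (Filter.Eventually.of_forall (weight_nonneg hg)), integral_weight]
  simp

open Polynomial in
theorem integral_lam_log_norm_polynomial {g : ℝ} (hg : |g| ≤ 1) (q : ℂ[X])
    (hq : ∀ z : ℂ, ‖z‖ ≤ 1 → q.eval z ≠ 0) :
    ∫ θ, Real.log ‖q.eval (expI θ)‖ ∂(lam g) =
      Real.log ‖q.coeff 0‖ - g * ((q.coeff 1 / q.coeff 0).re / 2) := by
  have hc : Continuous fun θ => Real.log ‖q.eval (expI θ)‖ :=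
    continuous_log_norm (q.continuous.comp continuous_expI) fun θ => hq _ (norm_expI θ).le
  have hre : Continuous fun θ => (expI θ).re := Complex.continuous_re.comp continuous_expI
  have h := integral_log_norm_polynomial q hq
  have i2 : Integrable (fun θ => g * ((expI θ).re * Real.log ‖q.eval (expI θ)‖)) lam0 :=
    continuous_integrable ((hre.mul hc).const_mul g) _
  rw [integral_lam hg]
  simp only [weight, smul_eq_mul, sub_mul, one_mul, mul_assoc]
  rw [integral_sub (continuous_integrable hc _) i2, integral_const_mul]
  exact congrArg₂ _ h.1 (congrArg _ h.2)

end CircleIntegrals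

/-! ### Complex and signed measures given by densities. -/

section VectorMeasureIntegral

variable {X : Type*} [MeasurableSpace X]

theorem integrable_mul_of_integrable_withDensity_enorm {τ : Measure X} {m f : X → ℂ}
    (hm : Measurable m) (hf : Integrable f (τ.withDensity fun x => ‖m x‖ₑ)) :
    Integrable (fun x => f x * m x) τ := by
  have h1 := (integrable_withDensity_iff_integrable_smul' (μ := τ) hm.enorm
    (Filter.Eventually.of_forall fun x => enorm_lt_top)).1 hf
  -- f m is |m| f times the phase m/|m|, which is bounded by 1 and equals 0 where m vanishes.
  have h2 : Integrable (fun x => (‖m x‖ₑ.toReal • f x) * (m x * ((‖m x‖ : ℂ))⁻¹)) τ := by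
    refine h1.mul_bdd (c := 1) ?_ (Filter.Eventually.of_forall fun x => ?_)
    · have := hm.norm
      exact (by fun_prop : Measurable fun x => m x * ((‖m x‖ : ℂ))⁻¹).aestronglyMeasurable
    · simp only [norm_mul, norm_inv, Complex.norm_real, norm_norm]
      exact mul_inv_le_one
  refine h2.congr (Filter.Eventually.of_forall fun x => ?_)
  simp only [toReal_enorm, Complex.real_smul]
  by_cases h : m x = 0
  · simp [h]
  · have : (‖m x‖ : ℂ) ≠ 0 := by simpa using h
    field_simp

/-- Integration against a complex measure with a density. -/
theorem integral_withDensityᵥ_mul {τ : Measure X} {m : X → ℂ}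
    (hm : Measurable m) (hmi : Integrable m τ) {f : X → ℂ}
    (hf : Integrable f (τ.withDensity fun x => ‖m x‖ₑ)) :
    (τ.withDensityᵥ m).integral f (ContinuousLinearMap.mul ℝ ℂ) = ∫ x, f x * m x ∂τ := by
  have hvar : (τ.withDensityᵥ m).variation = τ.withDensity fun x => ‖m x‖ₑ :=
    Measure.variation_withDensityᵥ hmi
  have hfin : IsFiniteMeasure (τ.withDensity fun x => ‖m x‖ₑ) :=
    isFiniteMeasure_withDensity hmi.2.ne
  have hfin' : IsFiniteMeasure (τ.withDensityᵥ m).variation := hvar ▸ hfin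
  refine Integrable.induction
    (P := fun f => (τ.withDensityᵥ m).integral f (ContinuousLinearMap.mul ℝ ℂ) =
      ∫ x, f x * m x ∂τ) ?_ ?_ ?_ ?_ hf
  · intro c s hs _
    rw [VectorMeasure.integral_indicator hs]
    have h1 : ∀ x, s.indicator (fun _ => c) x * m x = s.indicator (fun x => c * m x) x := by
      intro x; by_cases hx : x ∈ s <;> simp [hx]
    simp_rw [h1]
    have hfr : IsFiniteMeasure ((τ.withDensityᵥ m).restrict s).variation := by
      rw [VectorMeasure.variation_restrict hs]; infer_instance
    rw [integral_indicator hs, integral_const_mul, VectorMeasure.integral_const,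
      VectorMeasure.restrict_apply _ hs MeasurableSet.univ, Set.univ_inter,
      withDensityᵥ_apply hmi hs]
    rfl
  · intro f g _ hf hg h1 h2
    have e : ∀ x, (f + g) x * m x = f x * m x + g x * m x := fun x => add_mul _ _ _
    simp_rw [e]
    rw [integral_add (integrable_mul_of_integrable_withDensity_enorm hm hf)
      (integrable_mul_of_integrable_withDensity_enorm hm hg), ← h1, ← h2]
    exact VectorMeasure.integral_add (show MeasureTheory.Integrable f _ from hvar.symm ▸ hf)
      (show MeasureTheory.Integrable g _ from hvar.symm ▸ hg)
  · refine isClosed_eq ?_ ?_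
    · have := VectorMeasure.continuous_integral (μ := τ.withDensityᵥ m)
        (B := ContinuousLinearMap.mul ℝ ℂ)
      rwa [hvar] at this
    -- The L¹ norm for the variation |m| τ is ∫ |f| |m| dτ, so f ↦ ∫ f m dτ is 1-Lipschitz.
    · refine (LipschitzWith.of_dist_le_mul (K := 1) fun f g => ?_).continuous
      have hfi := integrable_mul_of_integrable_withDensity_enorm hm (L1.integrable_coeFn f)
      have hgi := integrable_mul_of_integrable_withDensity_enorm hm (L1.integrable_coeFn g)
      rw [dist_eq_norm, dist_eq_norm, ← integral_sub hfi hgi, NNReal.coe_one, one_mul,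
        L1.norm_eq_integral_norm]
      refine (norm_integral_le_integral_norm _).trans (le_of_eq ?_)
      rw [integral_withDensity_eq_integral_toReal_smul hm.enorm
        (Filter.Eventually.of_forall fun x => enorm_lt_top)]
      refine integral_congr_ae ?_
      have h1 := (ae_withDensity_iff hm.enorm).1 (Lp.coeFn_sub f g)
      filter_upwards [h1] with x hx
      by_cases h : m x = 0
      · simp [h]
      · rw [hx (by simpa using h), ← sub_mul, norm_mul, toReal_enorm, smul_eq_mul, mul_comm]
        rfl
  · intro f g hfg hf h
    rw [← VectorMeasure.integral_congr_ae (hvar.symm ▸ hfg), h]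
    refine integral_congr_ae ?_
    filter_upwards [(ae_withDensity_iff hm.enorm).1 hfg] with x hx
    by_cases h : m x = 0
    · simp [h]
    · rw [hx (by simpa using h)]

/-- The Radon-Nikodym derivative, with respect to `σ`, of the signed measure `m τ`. -/
theorem rnDeriv_withDensityᵥ {τ σ : Measure X} [IsFiniteMeasure τ] [IsFiniteMeasure σ]
    {m : X → ℝ} (hm : Integrable m τ) :
    SignedMeasure.rnDeriv (τ.withDensityᵥ m) σ =ᵐ[σ] fun x => (τ.rnDeriv σ x).toReal * m x := by
  have hle : σ.withDensity (τ.rnDeriv σ) ≤ τ := Measure.withDensity_rnDeriv_le τ σ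
  have hm1 : Integrable m (σ.withDensity (τ.rnDeriv σ)) := hm.mono_measure hle
  have hm2 : Integrable m (τ.singularPart σ) := hm.mono_measure (Measure.singularPart_le τ σ)
  have hfi : Integrable (fun x => (τ.rnDeriv σ x).toReal • m x) σ :=
    (integrable_withDensity_iff_integrable_smul' (Measure.measurable_rnDeriv τ σ)
      (Measure.rnDeriv_lt_top τ σ)).1 hm1
  -- Multiplying the Lebesgue decomposition of τ by m decomposes mτ; uniqueness identifies the
  -- density.
  refine (SignedMeasure.eq_rnDeriv ((τ.singularPart σ).withDensityᵥ m) _ hfi ?_ ?_).symm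
  · obtain ⟨s, hs, h1, h2⟩ := Measure.mutuallySingular_singularPart τ σ
    refine VectorMeasure.MutuallySingular.mk s hs ?_ ?_
    · intro t ht htm
      rw [withDensityᵥ_apply hm2 htm, Measure.restrict_zero_set (measure_mono_null ht h1),
        integral_zero_measure]
    · intro t ht htm
      rw [Measure.toENNRealVectorMeasure_apply_measurable htm]
      exact measure_mono_null ht h2
  · rw [withDensityᵥ_smul_eq_withDensityᵥ_withDensity'
      (Measure.measurable_rnDeriv τ σ).aemeasurable (Measure.rnDeriv_lt_top τ σ) hfi]
    ext s hs
    rw [_root_.add_apply, withDensityᵥ_apply hm hs, withDensityᵥ_apply hm2 hs,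
      withDensityᵥ_apply hm1 hs, ← integral_add_measure hm2.integrableOn hm1.integrableOn,
      ← Measure.restrict_add, Measure.singularPart_add_rnDeriv]

end VectorMeasureIntegral

/-! ### The matrix measure as a bounded nonnegative density times its trace measure. -/

section MatrixMeasure

variable {p : ℕ} {μ : MatMeasure p}

theorem entry_apply (μ : MatMeasure p) (i j : Fin p) (A : Set UCircle) :
    entry μ i j A = μ A i j := rfl

/-- The signed measure `A ↦ tr μ(A)`. -/
noncomputable def traceSigned (μ : MatMeasure p) : SignedMeasure UCircle :=
  ∑ i, (entry μ i i).re

theorem traceSigned_apply (μ : MatMeasure p) (A : Set UCircle) :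
    traceSigned μ A = (μ A).trace.re := by
  have : traceSigned μ A = ∑ i, (entry μ i i).re A := by
    rw [traceSigned]
    simp
  rw [this, Matrix.trace, Complex.re_sum]
  rfl

theorem traceSigned_nonneg (hμ : IsNormalizedMatMeasure μ) : 0 ≤[Set.univ] traceSigned μ := by
  refine VectorMeasure.restrict_le_restrict_of_subset_le _ _ fun A hA _ => ?_
  rw [traceSigned_apply]
  exact posSemidef_trace_re_nonneg (hμ.posSemidef A hA)

/-- The trace measure `tr μ`. -/
noncomputable def traceMeasure (hμ : IsNormalizedMatMeasure μ) : Measure UCircle :=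
  (traceSigned μ).toMeasureOfZeroLE Set.univ MeasurableSet.univ (traceSigned_nonneg hμ)

instance isFiniteMeasure_traceMeasure (hμ : IsNormalizedMatMeasure μ) :
    IsFiniteMeasure (traceMeasure hμ) :=
  SignedMeasure.toMeasureOfZeroLE_finite _ _ _

theorem traceMeasure_real (hμ : IsNormalizedMatMeasure μ) {A : Set UCircle}
    (hA : MeasurableSet A) : (traceMeasure hμ).real A = (μ A).trace.re := by
  rw [traceMeasure, SignedMeasure.toMeasureOfZeroLE_real_apply _ _ _ hA, Set.univ_inter,
    traceSigned_apply]

theorem entry_eq_zero_of_traceMeasure (hμ : IsNormalizedMatMeasure μ) {A : Set UCircle}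
    (hA : MeasurableSet A) (h0 : traceMeasure hμ A = 0) (i j : Fin p) : μ A i j = 0 := by
  have h1 := traceMeasure_real hμ hA
  rw [measureReal_def, h0, ENNReal.toReal_zero] at h1
  have h2 := norm_entry_le_trace (hμ.posSemidef A hA) i j
  rw [← h1] at h2
  exact norm_le_zero_iff.1 h2

theorem setIntegral_density_traceMeasure (hμ : IsNormalizedMatMeasure μ) (i j : Fin p)
    {A : Set UCircle} (hA : MeasurableSet A) :
    ∫ θ in A, density μ (traceMeasure hμ) θ i j ∂(traceMeasure hμ) = μ A i j := by
  set τ := traceMeasure hμ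
  have hac : entry μ i j ≪ᵥ τ.toENNRealVectorMeasure := by
    refine VectorMeasure.AbsolutelyContinuous.mk fun A hA h => ?_
    rw [Measure.toENNRealVectorMeasure_apply_measurable hA] at h
    exact entry_eq_zero_of_traceMeasure hμ hA h i j
  have h1 := (ComplexMeasure.absolutelyContinuous_ennreal_iff _ _).1 hac
  have hre := SignedMeasure.withDensityᵥ_rnDeriv_eq _ τ h1.1
  have him := SignedMeasure.withDensityᵥ_rnDeriv_eq _ τ h1.2
  have hi := (ComplexMeasure.integrable_rnDeriv (entry μ i j) τ).integrableOn (s := A)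
  have e : ∀ θ, density μ τ θ i j = (entry μ i j).rnDeriv τ θ := fun θ => rfl
  simp_rw [e]
  have r1 : τ.withDensityᵥ ((entry μ i j).re.rnDeriv τ) A = (entry μ i j).re A := by rw [hre]
  have r2 : τ.withDensityᵥ ((entry μ i j).im.rnDeriv τ) A = (entry μ i j).im A := by rw [him]
  rw [withDensityᵥ_apply (SignedMeasure.integrable_rnDeriv _ _) hA] at r1 r2
  apply Complex.ext
  · have := integral_re hi
    simp only [RCLike.re_eq_complex_re] at this
    rw [← this]
    exact r1
  · have := integral_im hi
    simp only [RCLike.im_eq_complex_im] at this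
    rw [← this]
    exact r2

theorem integrable_density (μ : MatMeasure p) (σ : Measure UCircle) (i j : Fin p) :
    Integrable (fun θ => density μ σ θ i j) σ :=
  ComplexMeasure.integrable_rnDeriv (entry μ i j) σ

theorem measurable_density (μ : MatMeasure p) (σ : Measure UCircle) (i j : Fin p) :
    Measurable fun θ => density μ σ θ i j := by
  have h1 := SignedMeasure.measurable_rnDeriv (entry μ i j).re σ
  have h2 := SignedMeasure.measurable_rnDeriv (entry μ i j).im σ
  have e : (fun θ => density μ σ θ i j) = fun θ =>
      (((entry μ i j).re.rnDeriv σ θ : ℂ)) + ((entry μ i j).im.rnDeriv σ θ : ℂ) * Complex.I := by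
    funext θ
    exact (Complex.re_add_im ((entry μ i j).rnDeriv σ θ)).symm
  rw [e]
  fun_prop

theorem ae_density_traceMeasure_trace (hμ : IsNormalizedMatMeasure μ) :
    ∀ᵐ θ ∂(traceMeasure hμ), (density μ (traceMeasure hμ) θ).trace.re = 1 := by
  set τ := traceMeasure hμ with hτ
  have hi : Integrable (fun θ => (density μ τ θ).trace.re) τ := by
    have : Integrable (fun θ => ∑ i, density μ τ θ i i) τ :=
      integrable_finsetSum _ fun i _ => integrable_density μ τ i i
    exact this.re
  refine hi.ae_eq_of_forall_setIntegral_eq _ (fun _ => (1 : ℝ)) (integrable_const _) ?_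
  intro A hA _
  have h0 : ∫ θ in A, ∑ i, density μ τ θ i i ∂τ = (μ A).trace := by
    rw [integral_finsetSum _ fun i _ => (integrable_density μ τ i i).integrableOn]
    exact Finset.sum_congr rfl fun i _ => setIntegral_density_traceMeasure hμ i i hA
  have h1 := integral_re (𝕜 := ℂ) (μ := τ.restrict A) (f := fun θ => ∑ i, density μ τ θ i i)
    (integrable_finsetSum _ fun i _ => (integrable_density μ τ i i).integrableOn)
  simp only [RCLike.re_eq_complex_re] at h1
  rw [h0] at h1
  rw [setIntegral_const, smul_eq_mul, mul_one, hτ, traceMeasure_real hμ hA]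
  exact h1

theorem ae_density_traceMeasure_isHermitian (hμ : IsNormalizedMatMeasure μ) :
    ∀ᵐ θ ∂(traceMeasure hμ), (density μ (traceMeasure hμ) θ).IsHermitian := by
  set τ := traceMeasure hμ with hτ
  have h : ∀ i j, ∀ᵐ θ ∂τ, star (density μ τ θ j i) = density μ τ θ i j := by
    intro i j
    have hi := integrable_density μ τ j i
    refine Integrable.ae_eq_of_forall_setIntegral_eq _ _ ?_ (integrable_density μ τ i j) ?_
    · exact (LinearIsometryEquiv.integrable_comp_iff Complex.conjLIE).2 hi
    · intro A hA _
      rw [hτ, setIntegral_density_traceMeasure hμ i j hA]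
      have := integral_conj (μ := τ.restrict A) (f := fun θ => density μ τ θ j i)
      simp only [Complex.star_def]
      rw [this, hτ, setIntegral_density_traceMeasure hμ j i hA, ← Complex.star_def,
        ← Matrix.conjTranspose_apply, (hμ.posSemidef A hA).1.eq]
  filter_upwards [ae_all_iff.2 fun i => ae_all_iff.2 (h i)] with θ hθ
  ext i j
  exact hθ i j

/-- For a fixed vector x the form is nonnegative almost everywhere, but the null set depends on x. A
countable dense set of vectors gives one null set, and continuity in x covers the rest. -/
theorem ae_density_traceMeasure_posSemidef (hμ : IsNormalizedMatMeasure μ) :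
    ∀ᵐ θ ∂(traceMeasure hμ), (density μ (traceMeasure hμ) θ).PosSemidef := by
  set τ := traceMeasure hμ with hτ
  have expand : ∀ (A : Mat p) (x : Fin p → ℂ),
      star x ⬝ᵥ A *ᵥ x = ∑ i, ∑ j, star (x i) * A i j * x j := by
    intro A x
    simp only [dotProduct, Matrix.mulVec, Pi.star_apply, Finset.mul_sum, mul_assoc]
  have hx : ∀ x : Fin p → ℂ, ∀ᵐ θ ∂τ, 0 ≤ (star x ⬝ᵥ density μ τ θ *ᵥ x).re := by
    intro x
    have hint : Integrable (fun θ => ∑ i, ∑ j, star (x i) * density μ τ θ i j * x j) τ :=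
      integrable_finsetSum _ fun i _ => integrable_finsetSum _ fun j _ =>
        ((integrable_density μ τ i j).const_mul _).mul_const _
    simp_rw [expand]
    refine ae_nonneg_of_forall_setIntegral_nonneg hint.re ?_
    intro A hA _
    have h1 := integral_re (hint.integrableOn (s := A))
    simp only [RCLike.re_eq_complex_re] at h1
    rw [h1, integral_finsetSum _ fun i _ => integrable_finsetSum _ fun j _ =>
        (((integrable_density μ τ i j).const_mul _).mul_const _).integrableOn]
    have h2 : ∑ i, ∫ θ in A, ∑ j, star (x i) * density μ τ θ i j * x j ∂τ =
        star x ⬝ᵥ μ A *ᵥ x := by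
      rw [expand]
      refine Finset.sum_congr rfl fun i _ => ?_
      rw [integral_finsetSum _ fun j _ =>
        (((integrable_density μ τ i j).const_mul _).mul_const _).integrableOn]
      refine Finset.sum_congr rfl fun j _ => ?_
      rw [integral_mul_const, integral_const_mul, hτ, setIntegral_density_traceMeasure hμ i j hA]
    rw [h2]
    exact (hμ.posSemidef A hA).re_dotProduct_nonneg x
  have hall := ae_all_iff.2 fun n : ℕ => hx (TopologicalSpace.denseSeq (Fin p → ℂ) n)
  filter_upwards [hall, ae_density_traceMeasure_isHermitian hμ] with θ hθ hH
  refine Matrix.PosSemidef.of_dotProduct_mulVec_nonneg hH fun x => ?_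
  have hc : Continuous fun x : Fin p → ℂ => (star x ⬝ᵥ density μ τ θ *ᵥ x).re := by
    simp_rw [expand]
    fun_prop
  have hre : 0 ≤ (star x ⬝ᵥ density μ τ θ *ᵥ x).re := by
    have hcl : IsClosed {x : Fin p → ℂ | 0 ≤ (star x ⬝ᵥ density μ τ θ *ᵥ x).re} :=
      isClosed_le continuous_const hc
    have hd := (TopologicalSpace.denseRange_denseSeq (Fin p → ℂ)).closure_range
    have hsub : Set.range (TopologicalSpace.denseSeq (Fin p → ℂ)) ⊆
        {x : Fin p → ℂ | 0 ≤ (star x ⬝ᵥ density μ τ θ *ᵥ x).re} := by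
      rintro _ ⟨n, rfl⟩
      exact hθ n
    have := closure_minimal hsub hcl
    rw [hd] at this
    exact this (Set.mem_univ x)
  rw [Complex.le_def]
  refine ⟨hre, ?_⟩
  have him : star (star x ⬝ᵥ density μ τ θ *ᵥ x) = star x ⬝ᵥ density μ τ θ *ᵥ x := by
    rw [← Matrix.star_dotProduct, Matrix.star_mulVec, hH.eq, ← Matrix.dotProduct_mulVec]
  exact (Complex.conj_eq_iff_im.1 him).symm

/-- A matrix measure has a bounded nonnegative density with respect to a finite positive
measure, and this density computes its integrals and its Lebesgue decompositions. -/
theorem exists_density (hμ : IsNormalizedMatMeasure μ) :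
    ∃ (τ : Measure UCircle) (M : UCircle → Mat p), IsFiniteMeasure τ ∧
      (∀ i j, Measurable fun θ => M θ i j) ∧ (∀ θ, (M θ).PosSemidef) ∧
      (∀ θ i j, ‖M θ i j‖ ≤ 1) ∧
      (∀ i j u, Continuous u → entryIntegral μ i j u = ∫ θ, u θ * M θ i j ∂τ) ∧
      (∀ i j, ∫ θ, M θ i j ∂τ = (1 : Mat p) i j) ∧
      ∀ σ : Measure UCircle, IsFiniteMeasure σ →
        ∀ᵐ θ ∂σ, density μ σ θ = ((τ.rnDeriv σ θ).toReal : ℂ) • M θ := by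
  set τ := traceMeasure hμ with hτ
  have hae := (ae_density_traceMeasure_posSemidef hμ).and (ae_density_traceMeasure_trace hμ)
  -- On this null set the density is replaced by 0, so that positivity and the bound on entries hold
  -- everywhere. The bound 1 comes from the trace being 1 elsewhere.
  set N := toMeasurable τ {θ | ¬ ((density μ τ θ).PosSemidef ∧ (density μ τ θ).trace.re = 1)}
  have hN0 : τ N = 0 := by rw [measure_toMeasurable]; exact hae
  have hNm : MeasurableSet N := measurableSet_toMeasurable _ _
  set M : UCircle → Mat p := fun θ => open Classical in if θ ∈ N then 0 else density μ τ θ with hM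
  have hMae : ∀ᵐ θ ∂τ, M θ = density μ τ θ := by
    filter_upwards [measure_eq_zero_iff_ae_notMem.1 hN0] with θ hθ
    simp [hM, hθ]
  have hgood : ∀ θ, θ ∉ N → (density μ τ θ).PosSemidef ∧ (density μ τ θ).trace.re = 1 := by
    intro θ hθ
    by_contra hcon
    exact hθ (subset_toMeasurable τ _ hcon)
  have hMm : ∀ i j, Measurable fun θ => M θ i j := by
    intro i j
    have : (fun θ => M θ i j) = open Classical in fun θ =>
        if θ ∈ N then 0 else density μ τ θ i j := by
      funext θ
      by_cases h : θ ∈ N <;> simp [hM, h]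
    rw [this]
    exact Measurable.ite hNm measurable_const (measurable_density μ τ i j)
  have hMp : ∀ θ, (M θ).PosSemidef := by
    intro θ
    by_cases h : θ ∈ N
    · simp only [hM, h, if_true]; exact Matrix.PosSemidef.zero
    · simp only [hM, h, if_false]; exact (hgood θ h).1
  have hMb : ∀ θ i j, ‖M θ i j‖ ≤ 1 := by
    intro θ i j
    by_cases h : θ ∈ N
    · simp [hM, h]
    · simp only [hM, h, if_false]
      exact (norm_entry_le_trace (hgood θ h).1 i j).trans (hgood θ h).2.le
  have hMi : ∀ i j, Integrable (fun θ => M θ i j) τ := fun i j =>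
    Integrable.of_bound (hMm i j).aestronglyMeasurable 1
      (Filter.Eventually.of_forall fun θ => hMb θ i j)
  have hset : ∀ i j A, MeasurableSet A → ∫ θ in A, M θ i j ∂τ = μ A i j := by
    intro i j A hA
    rw [← setIntegral_density_traceMeasure hμ i j hA]
    refine integral_congr_ae (ae_restrict_of_ae ?_)
    filter_upwards [hMae] with θ hθ
    rw [hθ]
  have hent : ∀ i j, entry μ i j = τ.withDensityᵥ fun θ => M θ i j := by
    intro i j
    ext A hA : 1
    rw [withDensityᵥ_apply (hMi i j) hA, hset i j A hA, entry_apply]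
  refine ⟨τ, M, inferInstance, hMm, hMp, hMb, ?_, ?_, ?_⟩
  · intro i j u hu
    rw [entryIntegral, hent i j]
    have hfin : IsFiniteMeasure (τ.withDensity fun θ => ‖M θ i j‖ₑ) :=
      isFiniteMeasure_withDensity (hMi i j).2.ne
    exact integral_withDensityᵥ_mul (hMm i j) (hMi i j) (continuous_integrable hu _)
  · intro i j
    have := hset i j Set.univ MeasurableSet.univ
    rwa [Measure.restrict_univ, hμ.normalized] at this
  · intro σ hσ
    have h : ∀ i j, ∀ᵐ θ ∂σ, density μ σ θ i j = ((τ.rnDeriv σ θ).toReal : ℂ) * M θ i j := by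
      intro i j
      have hre : (entry μ i j).re = τ.withDensityᵥ fun θ => (M θ i j).re := by
        ext A hA
        have hr : Integrable (fun θ => (M θ i j).re) τ := (hMi i j).re
        rw [withDensityᵥ_apply hr hA]
        have := integral_re ((hMi i j).integrableOn (s := A))
        simp only [RCLike.re_eq_complex_re] at this
        rw [this, hset i j A hA]
        rfl
      have him : (entry μ i j).im = τ.withDensityᵥ fun θ => (M θ i j).im := by
        ext A hA
        have hr : Integrable (fun θ => (M θ i j).im) τ := (hMi i j).im
        rw [withDensityᵥ_apply hr hA]
        have := integral_im ((hMi i j).integrableOn (s := A))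
        simp only [RCLike.im_eq_complex_im] at this
        rw [this, hset i j A hA]
        rfl
      have d1 := rnDeriv_withDensityᵥ (σ := σ) (hMi i j).re
      have d2 := rnDeriv_withDensityᵥ (σ := σ) (hMi i j).im
      simp only [RCLike.re_eq_complex_re, RCLike.im_eq_complex_im] at d1 d2
      rw [← hre] at d1
      rw [← him] at d2
      filter_upwards [d1, d2] with θ e1 e2
      apply Complex.ext
      · rw [Complex.re_ofReal_mul]; exact e1
      · rw [Complex.im_ofReal_mul]; exact e2
    filter_upwards [ae_all_iff.2 fun i => ae_all_iff.2 (h i)] with θ hθ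
    ext i j
    exact hθ i j

end MatrixMeasure

/-! ### The defect matrices ρ^L and ρ^R of a strict contraction. -/

section DefectMatrices

variable {p : ℕ} {α : Mat p}

theorem posDef_one_sub_mul_conjTranspose (h : (1 - αᴴ * α).PosDef) : (1 - α * αᴴ).PosDef := by
  have hu : IsUnit (1 - αᴴ * α).det := (Matrix.isUnit_iff_isUnit_det _).1 h.isUnit
  have hH : (1 - α * αᴴ).IsHermitian :=
    Matrix.isHermitian_one.sub (Matrix.isHermitian_mul_conjTranspose_self α)
  -- This identity gives semidefiniteness; definiteness follows because det(1 - αα†) = det(1 - α†α)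
  -- ≠ 0.
  have e : 1 - α * αᴴ = (1 - α * αᴴ) * (1 - α * αᴴ)ᴴ + α * (1 - αᴴ * α) * αᴴ := by
    rw [hH.eq]
    noncomm_ring
  have hps : (1 - α * αᴴ).PosSemidef := by
    rw [e]
    exact (Matrix.posSemidef_self_mul_conjTranspose _).add
      (h.posSemidef.mul_mul_conjTranspose_same α)
  refine hps.posDef_iff_isUnit.2 ((Matrix.isUnit_iff_isUnit_det _).2 ?_)
  rwa [Matrix.det_one_sub_mul_comm]

theorem sqrt_posDef {A : Mat p} (hA : A.PosDef) :
    (CFC.sqrt A).PosDef ∧ CFC.sqrt A * CFC.sqrt A = A := by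
  have h := CFC.sqrt_mul_sqrt_self A hA.posSemidef.nonneg
  refine ⟨(Matrix.nonneg_iff_posSemidef.1 (CFC.sqrt_nonneg A)).posDef_iff_isUnit.2 ?_, h⟩
  have h2 := (Matrix.isUnit_iff_isUnit_det _).1 hA.isUnit
  rw [← h, Matrix.det_mul] at h2
  exact (Matrix.isUnit_iff_isUnit_det _).2 (isUnit_of_mul_isUnit_left h2)

theorem rhoL_posDef (h : (1 - αᴴ * α).PosDef) : (rhoL α).PosDef := (sqrt_posDef h).1

theorem rhoR_posDef (h : (1 - αᴴ * α).PosDef) : (rhoR α).PosDef :=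
  (sqrt_posDef (posDef_one_sub_mul_conjTranspose h)).1

theorem rhoL_mul_self (h : (1 - αᴴ * α).PosDef) : rhoL α * rhoL α = 1 - αᴴ * α :=
  (sqrt_posDef h).2

theorem rhoR_mul_self (h : (1 - αᴴ * α).PosDef) : rhoR α * rhoR α = 1 - α * αᴴ :=
  (sqrt_posDef (posDef_one_sub_mul_conjTranspose h)).2

theorem isUnit_det_rhoL (h : (1 - αᴴ * α).PosDef) : IsUnit (rhoL α).det :=
  (Matrix.isUnit_iff_isUnit_det _).1 (rhoL_posDef h).isUnit

theorem isUnit_det_rhoR (h : (1 - αᴴ * α).PosDef) : IsUnit (rhoR α).det :=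
  (Matrix.isUnit_iff_isUnit_det _).1 (rhoR_posDef h).isUnit

/-- The Sylvester equation `X Z + Z Y = 0` with positive `X`, `Y` has only the trivial solution. -/
theorem eq_zero_of_sylvester {X Y Z : Mat p} (hX : X.PosDef) (hY : Y.PosDef)
    (h : X * Z + Z * Y = 0) : Z = 0 := by
  have h1 : (Zᴴ * X * Z).PosSemidef := hX.posSemidef.conjTranspose_mul_mul_same Z
  have h2 : (Z * Y * Zᴴ).PosSemidef := hY.posSemidef.mul_mul_conjTranspose_same Z
  -- The trace of Z† times the equation is a sum of two nonnegative terms, so both vanish.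
  have h3 : (Zᴴ * X * Z).trace + (Z * Y * Zᴴ).trace = 0 := by
    rw [Matrix.trace_mul_comm (Z * Y), ← Matrix.trace_add, mul_assoc, ← mul_add, h]
    simp
  have h4 : (Zᴴ * X * Z).trace = 0 :=
    ((add_eq_zero_iff_of_nonneg h1.trace_nonneg h2.trace_nonneg).1 h3).1
  have h5 := h1.trace_eq_zero_iff.1 h4
  obtain ⟨B, rfl⟩ := posSemidef_exists_gram hX.posSemidef
  have h6 : (B * Z)ᴴ * (B * Z) = 0 := by
    rw [Matrix.conjTranspose_mul, ← h5]; simp only [mul_assoc]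
  have h7 := Matrix.conjTranspose_mul_self_eq_zero.1 h6
  have hB : IsUnit B.det := by
    have := (Matrix.isUnit_iff_isUnit_det _).1 hX.isUnit
    rw [Matrix.det_mul] at this
    exact isUnit_of_mul_isUnit_right this
  have := congrArg (B⁻¹ * ·) h7
  simpa [← mul_assoc, Matrix.nonsing_inv_mul _ hB] using this

/-- The defect matrices are intertwined by `α†`. -/
theorem rhoL_mul_conjTranspose (h : (1 - αᴴ * α).PosDef) :
    rhoL α * αᴴ = αᴴ * rhoR α := by
  rw [← sub_eq_zero]
  refine eq_zero_of_sylvester (rhoL_posDef h) (rhoR_posDef h) ?_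
  -- (ρ^L)²α† = α†(ρ^R)² holds algebraically; the difference of the first powers then solves a
  -- Sylvester equation.
  have h1 : rhoL α * (rhoL α * αᴴ - αᴴ * rhoR α) + (rhoL α * αᴴ - αᴴ * rhoR α) * rhoR α =
      rhoL α * rhoL α * αᴴ - αᴴ * (rhoR α * rhoR α) := by noncomm_ring
  rw [h1, rhoL_mul_self h, rhoR_mul_self h]
  noncomm_ring

end DefectMatrices

/-! ### Matrix polynomials evaluated at scalars, and their determinants. -/

section PolynomialEvaluation

variable {p : ℕ}

open Polynomial

/-- The value at `z` of a matrix polynomial. -/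
noncomputable def evalMat (f : (Mat p)[X]) (z : ℂ) : Mat p := f.eval (Matrix.scalar (Fin p) z)

theorem commute_scalar_mat (z : ℂ) (A : Mat p) : Commute A (Matrix.scalar (Fin p) z) :=
  (Matrix.scalar_commute z (fun _ => Commute.all _ _) A).symm

@[simp] theorem evalMat_add (f g : (Mat p)[X]) (z : ℂ) :
    evalMat (f + g) z = evalMat f z + evalMat g z := eval_add

@[simp] theorem evalMat_sub (f g : (Mat p)[X]) (z : ℂ) :
    evalMat (f - g) z = evalMat f z - evalMat g z := eval_sub ..

@[simp] theorem evalMat_C (A : Mat p) (z : ℂ) : evalMat (C A) z = A := eval_C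

@[simp] theorem evalMat_one (z : ℂ) : evalMat (1 : (Mat p)[X]) z = 1 := eval_one

@[simp] theorem evalMat_zero (z : ℂ) : evalMat (0 : (Mat p)[X]) z = 0 := eval_zero

-- Over a noncommutative ring evaluation is not multiplicative in general; scalar points commute
-- with all coefficients.
@[simp] theorem evalMat_mul (f g : (Mat p)[X]) (z : ℂ) :
    evalMat (f * g) z = evalMat f z * evalMat g z :=
  eval₂_mul_noncomm _ _ fun _ => commute_scalar_mat z _

theorem scalar_mul_eq_smul (z : ℂ) (A : Mat p) : Matrix.scalar (Fin p) z * A = z • A := by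
  rw [Matrix.scalar_apply, ← Matrix.smul_eq_diagonal_mul]

@[simp] theorem evalMat_mul_X (f : (Mat p)[X]) (z : ℂ) : evalMat (f * X) z = z • evalMat f z := by
  rw [evalMat_mul, evalMat, evalMat, eval_X, (commute_scalar_mat z _).eq, scalar_mul_eq_smul]

theorem evalMat_mul_X_pow (f : (Mat p)[X]) (n : ℕ) (z : ℂ) :
    evalMat (f * X ^ n) z = z ^ n • evalMat f z := by
  induction n with
  | zero => simp
  | succ n ih => rw [pow_succ, ← mul_assoc, evalMat_mul_X, ih, smul_smul, pow_succ, mul_comm]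

theorem evalMat_eq_sum (f : (Mat p)[X]) {N : ℕ} (hN : ∀ m, N ≤ m → f.coeff m = 0) (z : ℂ) :
    evalMat f z = ∑ k ∈ Finset.range N, z ^ k • f.coeff k := by
  have hd : f.degree < N := by
    rw [degree_lt_iff_coeff_zero]; exact hN
  by_cases h0 : f = 0
  · simp [h0]
  rw [evalMat, eval_eq_sum_range' ((natDegree_lt_iff_degree_lt h0).2 hd)]
  refine Finset.sum_congr rfl fun k _ => ?_
  rw [← map_pow, (commute_scalar_mat _ _).eq, scalar_mul_eq_smul]

theorem evalMat_zero_right (f : (Mat p)[X]) : evalMat f 0 = f.coeff 0 := by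
  rw [evalMat, map_zero, coeff_zero_eq_eval_zero]

theorem evalMat_apply (f : (Mat p)[X]) (z : ℂ) (i j : Fin p) :
    evalMat f z i j = ((matPolyEquiv.symm f) i j).eval z := by
  have h := matPolyEquiv_eval (matPolyEquiv.symm f) z i j
  rw [AlgEquiv.apply_symm_apply] at h
  exact h

theorem det_evalMat (f : (Mat p)[X]) (z : ℂ) :
    (evalMat f z).det = ((matPolyEquiv.symm f).det).eval z := by
  rw [eval_det, AlgEquiv.apply_symm_apply, evalMat]

theorem continuous_evalMat_expI (f : (Mat p)[X]) (i j : Fin p) :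
    Continuous fun θ => evalMat f (expI θ) i j := by
  simp_rw [evalMat_apply]
  exact (Polynomial.continuous _).comp continuous_expI

theorem det_matPolyEquiv_symm_coeff_zero (f : (Mat p)[X]) :
    ((matPolyEquiv.symm f).det).coeff 0 = (f.coeff 0).det := by
  rw [coeff_zero_eq_eval_zero, ← det_evalMat, evalMat_zero_right]

/-- The logarithmic derivative at `0` of the determinant of a matrix polynomial. -/
theorem det_matPolyEquiv_symm_coeff_one (f : (Mat p)[X]) (h : IsUnit (f.coeff 0).det) :
    ((matPolyEquiv.symm f).det).coeff 1 / ((matPolyEquiv.symm f).det).coeff 0 =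
      ((f.coeff 0)⁻¹ * f.coeff 1).trace := by
  set A := f.coeff 0 with hA
  -- After the factor f(0) is taken out, det(1 + zN) = 1 + z tr N + O(z²) yields the first
  -- coefficient.
  have e1 : f = C A * (1 + (C A⁻¹ * f.divX) * X) := by
    rw [mul_add, mul_one, mul_assoc, ← mul_assoc, ← C_mul, Matrix.mul_nonsing_inv _ h, C_1,
      one_mul, add_comm, hA, divX_mul_X_add]
  set N := matPolyEquiv.symm (C A⁻¹ * f.divX) with hN
  have e2 : matPolyEquiv.symm f =
      (A.map C) * (1 + (X : ℂ[X]) • N) := by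
    rw [e1, map_mul, map_add, map_one, map_mul, ← hN]
    congr 1
    · rw [AlgEquiv.symm_apply_eq, matPolyEquiv_map_C]
    · congr 1
      have : matPolyEquiv.symm (X : (Mat p)[X]) = Matrix.scalar (Fin p) (X : ℂ[X]) := by
        rw [AlgEquiv.symm_apply_eq]
        ext k i j
        rw [matPolyEquiv_coeff_apply, Matrix.scalar_apply, Matrix.diagonal_apply, coeff_X]
        by_cases hij : i = j <;> by_cases hk : 1 = k <;> simp [hij, hk, Matrix.one_apply, coeff_X]
      rw [this, Matrix.scalar_apply, ← Matrix.smul_one_eq_diagonal, Matrix.mul_smul, mul_one]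
  have e3 : (matPolyEquiv.symm f).det = C A.det * (1 + N.trace * X +
      (Matrix.det (1 + (X : ℂ[X][X]) • N.map C)).divX.divX.eval X * X ^ 2) := by
    rw [e2, Matrix.det_mul, Matrix.det_one_add_smul]
    congr 1
    exact (RingHom.map_det C A).symm
  have h0 := h.ne_zero
  have e4 : N.trace.coeff 0 = (A⁻¹ * f.coeff 1).trace := by
    rw [Matrix.trace, finsetSum_coeff, Matrix.trace]
    refine Finset.sum_congr rfl fun i _ => ?_
    simp only [Matrix.diag_apply]
    rw [hN, ← matPolyEquiv_coeff_apply, AlgEquiv.apply_symm_apply, coeff_C_mul, coeff_divX]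
  rw [e3]
  simp only [coeff_C_mul, coeff_add, coeff_mul_X, coeff_one, mul_coeff_zero, coeff_X_pow]
  have c2 : ∀ q : ℂ[X], (q * X ^ 2).coeff 1 = 0 := fun q => by
    rw [coeff_mul_X_pow']; simp
  rw [c2, e4]
  simp
  field_simp

end PolynomialEvaluation

/-! ### The Szegő recursion, its J-form and the sum rule. -/

section SzegoPolynomials

open Polynomial

variable {p : ℕ}

/-- The numerator and the denominator of the Schur function with Schur parameters
`α k, …, α (k + n - 1)` followed by the constant function `a`. -/
noncomputable def schurPair (α : ℕ → Mat p) (a : Mat p) : ℕ → ℕ → (Mat p)[X] × (Mat p)[X]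
  | 0, _ => (C a, 1)
  | n + 1, k =>
    (C (rhoR (α k))⁻¹ * (schurPair α a n (k + 1)).1 * X +
        C (α k * (rhoL (α k))⁻¹) * (schurPair α a n (k + 1)).2,
      C (rhoL (α k))⁻¹ * (schurPair α a n (k + 1)).2 +
        C ((α k)ᴴ * (rhoR (α k))⁻¹) * (schurPair α a n (k + 1)).1 * X)

/-- The numerator of the rational Schur function. -/
noncomputable abbrev schurNum (α : ℕ → Mat p) (a : Mat p) (n k : ℕ) : (Mat p)[X] :=
  (schurPair α a n k).1

/-- The denominator of the rational Schur function. -/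
noncomputable abbrev schurDen (α : ℕ → Mat p) (a : Mat p) (n k : ℕ) : (Mat p)[X] :=
  (schurPair α a n k).2

/-- The reversed orthonormal polynomial `v - z u`. -/
noncomputable def szegoPoly (α : ℕ → Mat p) (a : Mat p) (n : ℕ) : (Mat p)[X] :=
  schurDen α a n 0 - schurNum α a n 0 * X

/-- The reversed second kind polynomial `v + z u`. -/
noncomputable def szegoPoly₂ (α : ℕ → Mat p) (a : Mat p) (n : ℕ) : (Mat p)[X] :=
  schurDen α a n 0 + schurNum α a n 0 * X

variable {α : ℕ → Mat p} {a : Mat p}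

/-- `e` measures the degree cost of the terminal value: e = 0 requires a = 0, and e = 1 allows any
a. Hence `szegoPoly` has degree at most n for a = 0 and n + 1 otherwise. -/
theorem schurPair_coeff_eq_zero {e : ℕ} (he : e ≤ 1)
    (ha : ∀ m, e ≤ m → (C a : (Mat p)[X]).coeff m = 0) (n : ℕ) : ∀ k,
    (∀ m, n + e ≤ m → (schurNum α a n k).coeff m = 0) ∧
    (∀ m, n + 1 ≤ m → (schurDen α a n k).coeff m = 0) := by
  induction n with
  | zero =>
    intro k
    refine ⟨fun m hm => ha m (by omega), fun m hm => ?_⟩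
    simp only [schurDen, schurPair, coeff_one]
    rw [if_neg (by omega)]
  | succ n ih =>
    intro k
    have h := ih (k + 1)
    refine ⟨fun m hm => ?_, fun m hm => ?_⟩
    · obtain ⟨m, rfl⟩ : ∃ l, m = l + 1 := ⟨m - 1, by omega⟩
      simp only [schurNum, schurPair, coeff_add, coeff_C_mul, mul_assoc, coeff_mul_X]
      rw [h.1 m (by omega), h.2 (m + 1) (by omega)]
      simp
    · obtain ⟨m, rfl⟩ : ∃ l, m = l + 1 := ⟨m - 1, by omega⟩
      simp only [schurDen, schurPair, coeff_add, coeff_C_mul, mul_assoc, coeff_mul_X]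
      rw [h.1 m (by omega), h.2 (m + 1) (by omega)]
      simp

theorem szegoPoly_coeff_eq_zero {e : ℕ} (he : e ≤ 1)
    (ha : ∀ m, e ≤ m → (C a : (Mat p)[X]).coeff m = 0) (n m : ℕ) (hm : n + e + 1 ≤ m) :
    (szegoPoly α a n).coeff m = 0 := by
  have h := schurPair_coeff_eq_zero (α := α) he ha n 0
  obtain ⟨m, rfl⟩ : ∃ l, m = l + 1 := ⟨m - 1, by omega⟩
  rw [szegoPoly, coeff_sub, coeff_mul_X, h.1 m (by omega), h.2 (m + 1) (by omega), sub_zero]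

theorem smul_conjTranspose_mul_smul (z : ℂ) (A : Mat p) :
    (z • A)ᴴ * (z • A) = ((‖z‖ ^ 2 : ℝ) : ℂ) • (Aᴴ * A) := by
  rw [Matrix.conjTranspose_smul, Matrix.smul_mul, Matrix.mul_smul, smul_smul]
  congr 1
  rw [Complex.star_def, mul_comm, Complex.mul_conj, Complex.normSq_eq_norm_sq]

/-- One step of the recursion is `J`-unitary. -/
theorem defect_step {α : Mat p} (h : (1 - αᴴ * α).PosDef) (u v : Mat p) :
    ((rhoL α)⁻¹ * v + αᴴ * (rhoR α)⁻¹ * u)ᴴ * ((rhoL α)⁻¹ * v + αᴴ * (rhoR α)⁻¹ * u) -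
      ((rhoR α)⁻¹ * u + α * (rhoL α)⁻¹ * v)ᴴ * ((rhoR α)⁻¹ * u + α * (rhoL α)⁻¹ * v) =
    vᴴ * v - uᴴ * u := by
  -- Writing u = ρ^R x and v = ρ^L y removes all inverses; only the squares of the defect matrices
  -- remain.
  obtain ⟨x, rfl⟩ : ∃ x, u = rhoR α * x :=
    ⟨(rhoR α)⁻¹ * u, by rw [← mul_assoc, Matrix.mul_nonsing_inv _ (isUnit_det_rhoR h), one_mul]⟩
  obtain ⟨y, rfl⟩ : ∃ y, v = rhoL α * y :=
    ⟨(rhoL α)⁻¹ * v, by rw [← mul_assoc, Matrix.mul_nonsing_inv _ (isUnit_det_rhoL h), one_mul]⟩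
  have e1 : (rhoL α)⁻¹ * (rhoL α * y) = y := by
    rw [← mul_assoc, Matrix.nonsing_inv_mul _ (isUnit_det_rhoL h), one_mul]
  have e2 : (rhoR α)⁻¹ * (rhoR α * x) = x := by
    rw [← mul_assoc, Matrix.nonsing_inv_mul _ (isUnit_det_rhoR h), one_mul]
  rw [mul_assoc αᴴ, mul_assoc α, e1, e2]
  simp only [Matrix.conjTranspose_mul, Matrix.conjTranspose_add, (rhoR_posDef h).1.eq,
    (rhoL_posDef h).1.eq, Matrix.conjTranspose_conjTranspose]
  have l : yᴴ * rhoL α * (rhoL α * y) = yᴴ * (1 - αᴴ * α) * y := by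
    rw [← rhoL_mul_self h]; noncomm_ring
  have r : xᴴ * rhoR α * (rhoR α * x) = xᴴ * (1 - α * αᴴ) * x := by
    rw [← rhoR_mul_self h]; noncomm_ring
  rw [l, r]
  noncomm_ring

/-- The `J`-form of the pair at the point `z`. -/
noncomputable def schurDefect (α : ℕ → Mat p) (a : Mat p) (n k : ℕ) (z : ℂ) : Mat p :=
  (evalMat (schurDen α a n k) z)ᴴ * evalMat (schurDen α a n k) z -
    (evalMat (schurNum α a n k) z)ᴴ * evalMat (schurNum α a n k) z

theorem evalMat_schurNum_succ (n k : ℕ) (z : ℂ) :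
    evalMat (schurNum α a (n + 1) k) z =
      (rhoR (α k))⁻¹ * (z • evalMat (schurNum α a n (k + 1)) z) +
        α k * (rhoL (α k))⁻¹ * evalMat (schurDen α a n (k + 1)) z := by
  rw [schurNum, schurPair, evalMat_add, evalMat_mul_X, evalMat_mul, evalMat_mul, evalMat_C,
    evalMat_C, Matrix.mul_smul]

theorem evalMat_schurDen_succ (n k : ℕ) (z : ℂ) :
    evalMat (schurDen α a (n + 1) k) z =
      (rhoL (α k))⁻¹ * evalMat (schurDen α a n (k + 1)) z +
        (α k)ᴴ * (rhoR (α k))⁻¹ * (z • evalMat (schurNum α a n (k + 1)) z) := by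
  rw [schurDen, schurPair, evalMat_add, evalMat_mul_X, evalMat_mul, evalMat_mul, evalMat_C,
    evalMat_C, Matrix.mul_smul]

/-- The J-unitary step preserves v†v - u†u but is fed zu in place of u; the factor |z|² produces the
extra nonnegative term in the disc. -/
theorem schurDefect_succ (n k : ℕ) (h : (1 - (α k)ᴴ * α k).PosDef) (z : ℂ) :
    schurDefect α a (n + 1) k z = schurDefect α a n (k + 1) z + ((1 - ‖z‖ ^ 2 : ℝ) : ℂ) •
      ((evalMat (schurNum α a n (k + 1)) z)ᴴ * evalMat (schurNum α a n (k + 1)) z) := by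
  have h1 := defect_step h (z • evalMat (schurNum α a n (k + 1)) z)
    (evalMat (schurDen α a n (k + 1)) z)
  rw [smul_conjTranspose_mul_smul] at h1
  rw [schurDefect, schurDefect, evalMat_schurNum_succ, evalMat_schurDen_succ, h1]
  push_cast
  rw [sub_smul, one_smul]
  abel

theorem schurDefect_circle (n : ℕ) : ∀ k, (∀ j, k ≤ j → j < k + n → (1 - (α j)ᴴ * α j).PosDef) →
    ∀ z : ℂ, ‖z‖ = 1 → schurDefect α a n k z = 1 - aᴴ * a := by
  induction n with
  | zero => intro k _ z _; simp [schurDefect, schurNum, schurDen, schurPair]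
  | succ n ih =>
    intro k h z hz
    rw [schurDefect_succ n k (h k le_rfl (by omega)),
      ih (k + 1) (fun j h1 h2 => h j (by omega) (by omega)) z hz, hz]
    simp

theorem schurDefect_sub_one_posSemidef (n : ℕ) :
    ∀ k, (∀ j, k ≤ j → j < k + n → (1 - (α j)ᴴ * α j).PosDef) →
    ∀ z : ℂ, ‖z‖ ≤ 1 → (schurDefect α 0 n k z - 1).PosSemidef := by
  induction n with
  | zero => intro k _ z _; simpa [schurDefect, schurNum, schurDen, schurPair] using
      (Matrix.PosSemidef.zero : (0 : Mat p).PosSemidef)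
  | succ n ih =>
    intro k h z hz
    rw [schurDefect_succ n k (h k le_rfl (by omega)), add_sub_right_comm]
    refine (ih (k + 1) (fun j h1 h2 => h j (by omega) (by omega)) z hz).add ?_
    refine (Matrix.posSemidef_conjTranspose_mul_self _).smul ?_
    have : 0 ≤ 1 - ‖z‖ ^ 2 := by nlinarith [norm_nonneg z]
    exact_mod_cast this

theorem szegoPoly_defect (n : ℕ) (z : ℂ) :
    (evalMat (szegoPoly α a n) z)ᴴ * evalMat (szegoPoly₂ α a n) z +
      (evalMat (szegoPoly₂ α a n) z)ᴴ * evalMat (szegoPoly α a n) z =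
    (2 : ℂ) • (schurDefect α a n 0 z + ((1 - ‖z‖ ^ 2 : ℝ) : ℂ) •
      ((evalMat (schurNum α a n 0) z)ᴴ * evalMat (schurNum α a n 0) z)) := by
  have h := smul_conjTranspose_mul_smul z (evalMat (schurNum α a n 0) z)
  simp only [schurDefect, szegoPoly, szegoPoly₂, evalMat_add, evalMat_sub, evalMat_mul_X]
  push_cast at h ⊢
  rw [sub_smul, one_smul, ← h]
  generalize z • evalMat (schurNum α a n 0) z = w
  rw [two_smul, Matrix.conjTranspose_sub, Matrix.conjTranspose_add]
  noncomm_ring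

theorem szegoPoly_defect_circle (n : ℕ) (h : ∀ j, j < n → (1 - (α j)ᴴ * α j).PosDef) {z : ℂ}
    (hz : ‖z‖ = 1) :
    (evalMat (szegoPoly α a n) z)ᴴ * evalMat (szegoPoly₂ α a n) z +
      (evalMat (szegoPoly₂ α a n) z)ᴴ * evalMat (szegoPoly α a n) z =
    (2 : ℂ) • (1 - aᴴ * a) := by
  rw [szegoPoly_defect, schurDefect_circle n 0 (fun j _ h2 => h j (by omega)) z hz, hz]
  simp

/-- A kernel vector of D(z) annihilates the form D†E + E†D, whereas by `szegoPoly_defect` that form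
is at least 2 in the closed disc when a = 0. -/
theorem det_szegoPoly_ne_zero (n : ℕ) (h : ∀ j, j < n → (1 - (α j)ᴴ * α j).PosDef) {z : ℂ}
    (hz : ‖z‖ ≤ 1) : (evalMat (szegoPoly α 0 n) z).det ≠ 0 := by
  intro hdet
  obtain ⟨x, hx0, hx⟩ := Matrix.exists_mulVec_eq_zero_iff.2 hdet
  have hD := szegoPoly_defect (α := α) (a := 0) n z
  set D := evalMat (szegoPoly α 0 n) z
  set E := evalMat (szegoPoly₂ α 0 n) z
  have h1 := congrArg (fun A : Mat p => star x ⬝ᵥ A *ᵥ x) hD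
  have h2 : star x ⬝ᵥ (Dᴴ * E + Eᴴ * D) *ᵥ x = 0 := by
    rw [Matrix.add_mulVec, dotProduct_add, ← Matrix.mulVec_mulVec, ← Matrix.mulVec_mulVec, hx,
      Matrix.dotProduct_mulVec, ← Matrix.star_mulVec, hx]
    simp
  simp only [h2] at h1
  have hp : (schurDefect α 0 n 0 z + ((1 - ‖z‖ ^ 2 : ℝ) : ℂ) •
      ((evalMat (schurNum α 0 n 0) z)ᴴ * evalMat (schurNum α 0 n 0) z)).PosDef := by
    have e : schurDefect α 0 n 0 z = 1 + (schurDefect α 0 n 0 z - 1) := by abel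
    rw [e, add_assoc]
    refine Matrix.PosDef.one.add_posSemidef
      ((schurDefect_sub_one_posSemidef n 0 (fun j _ h2 => h j (by omega)) z hz).add ?_)
    refine (Matrix.posSemidef_conjTranspose_mul_self _).smul ?_
    have : 0 ≤ 1 - ‖z‖ ^ 2 := by nlinarith [norm_nonneg z]
    exact_mod_cast this
  have h3 := hp.dotProduct_mulVec_pos hx0
  rw [Matrix.smul_mulVec, dotProduct_smul] at h1
  simp only [smul_eq_mul, zero_eq_mul, OfNat.ofNat_ne_zero, false_or] at h1
  exact h3.ne' h1

theorem schurPair_coeff_zero (n k : ℕ) :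
    (schurDen α a (n + 1) k).coeff 0 = (rhoL (α k))⁻¹ * (schurDen α a n (k + 1)).coeff 0 ∧
    (schurNum α a (n + 1) k).coeff 0 = α k * (schurDen α a (n + 1) k).coeff 0 := by
  simp [schurNum, schurDen, schurPair, mul_coeff_zero, mul_assoc]

theorem isUnit_det_schurDen_coeff_zero (n : ℕ) :
    ∀ k, (∀ j, k ≤ j → j < k + n → (1 - (α j)ᴴ * α j).PosDef) →
    IsUnit ((schurDen α a n k).coeff 0).det := by
  induction n with
  | zero => intro k _; simp [schurDen, schurPair]
  | succ n ih =>
    intro k h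
    rw [(schurPair_coeff_zero n k).1, Matrix.det_mul]
    exact (Matrix.isUnit_nonsing_inv_det _ (isUnit_det_rhoL (h k le_rfl (by omega)))).mul
      (ih (k + 1) fun j h1 h2 => h j (by omega) (by omega))

theorem log_norm_det_schurDen_coeff_zero (n : ℕ) :
    ∀ k, (∀ j, k ≤ j → j < k + n → (1 - (α j)ᴴ * α j).PosDef) →
    2 * Real.log ‖((schurDen α a n k).coeff 0).det‖ =
      ∑ j ∈ Finset.range n, -Real.log (1 - (α (k + j))ᴴ * α (k + j)).det.re := by
  induction n with
  | zero => intro k _; simp [schurDen, schurPair]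
  | succ n ih =>
    intro k h
    have hk := h k le_rfl (by omega)
    have hu := (isUnit_det_rhoL hk).ne_zero
    rw [(schurPair_coeff_zero n k).1, Matrix.det_mul, norm_mul, Real.log_mul, mul_add,
      ih (k + 1) fun j h1 h2 => h j (by omega) (by omega), Finset.sum_range_succ', add_comm]
    · congr 1
      · refine Finset.sum_congr rfl fun j _ => ?_
        rw [show k + 1 + j = k + (j + 1) by ring]
      · have e := congrArg (fun A : Mat p => A.det) (rhoL_mul_self hk)
        simp only [Matrix.det_mul] at e
        rw [add_zero, ← e, Matrix.det_nonsing_inv, Ring.inverse_eq_inv', norm_inv, Real.log_inv,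
          posSemidef_det_eq (rhoL_posDef hk).posSemidef, ← Complex.ofReal_mul, Complex.ofReal_re,
          Complex.norm_real, Real.norm_eq_abs, Real.log_abs, Real.log_mul]
        · ring
        · exact (posDef_det_re_pos (rhoL_posDef hk)).ne'
        · exact (posDef_det_re_pos (rhoL_posDef hk)).ne'
    · exact norm_ne_zero_iff.2
        (Matrix.isUnit_nonsing_inv_det _ (isUnit_det_rhoL hk)).ne_zero
    · exact norm_ne_zero_iff.2 (isUnit_det_schurDen_coeff_zero n (k + 1)
        fun j h1 h2 => h j (by omega) (by omega)).ne_zero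

/-- Each step adds tr(v₀⁻¹ α_k† u₀), where v₀ and u₀ are the constant terms of the tail pair at k +
1. As u₀ = α_{k+1} v₀, this is tr α_k†α_{k+1}. The last step adds nothing since the terminal
numerator is 0, so n + 1 parameters give n terms. -/
theorem trace_schurDen_log_deriv (n : ℕ) :
    ∀ k, (∀ j, k ≤ j → j < k + (n + 1) → (1 - (α j)ᴴ * α j).PosDef) →
    (((schurDen α 0 (n + 1) k).coeff 0)⁻¹ * (schurDen α 0 (n + 1) k).coeff 1).trace =
      ∑ j ∈ Finset.range n, ((α (k + j))ᴴ * α (k + j + 1)).trace := by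
  have step : ∀ n k, (∀ j, k ≤ j → j < k + (n + 1) → (1 - (α j)ᴴ * α j).PosDef) →
      (((schurDen α 0 (n + 1) k).coeff 0)⁻¹ * (schurDen α 0 (n + 1) k).coeff 1).trace =
      (((schurDen α 0 n (k + 1)).coeff 0)⁻¹ * (schurDen α 0 n (k + 1)).coeff 1).trace +
      (((schurDen α 0 n (k + 1)).coeff 0)⁻¹ * (α k)ᴴ *
        (schurNum α 0 n (k + 1)).coeff 0).trace := by
    intro n k h
    have hk := h k le_rfl (by omega)
    have e1 : (schurDen α 0 (n + 1) k).coeff 1 = (rhoL (α k))⁻¹ *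
        (schurDen α 0 n (k + 1)).coeff 1 + (α k)ᴴ * (rhoR (α k))⁻¹ *
        (schurNum α 0 n (k + 1)).coeff 0 := by
      simp [schurNum, schurDen, schurPair, mul_assoc, coeff_C_mul, coeff_mul_X]
    have e2 : rhoL (α k) * ((α k)ᴴ * (rhoR (α k))⁻¹) = (α k)ᴴ := by
      rw [← mul_assoc, rhoL_mul_conjTranspose hk, mul_assoc,
        Matrix.mul_nonsing_inv _ (isUnit_det_rhoR hk), mul_one]
    rw [(schurPair_coeff_zero n k).1, e1, Matrix.mul_inv_rev,
      Matrix.nonsing_inv_nonsing_inv _ (isUnit_det_rhoL hk), mul_add, Matrix.trace_add]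
    congr 2
    · rw [mul_assoc, ← mul_assoc (rhoL (α k)), Matrix.mul_nonsing_inv _ (isUnit_det_rhoL hk),
        one_mul]
    · rw [mul_assoc, ← mul_assoc (rhoL (α k)), e2, mul_assoc]
  induction n with
  | zero =>
    intro k h
    rw [step 0 k h]
    simp [schurNum, schurDen, schurPair, coeff_one]
  | succ n ih =>
    intro k h
    rw [step (n + 1) k h, ih (k + 1) fun j h1 h2 => h j (by omega) (by omega),
      Finset.sum_range_succ']
    congr 1
    · refine Finset.sum_congr rfl fun j _ => ?_
      rw [show k + 1 + j = k + (j + 1) by ring]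
    · rw [(schurPair_coeff_zero n (k + 1)).2, mul_assoc, Matrix.trace_mul_comm, add_zero,
        mul_assoc, mul_assoc, Matrix.mul_nonsing_inv _ (isUnit_det_schurDen_coeff_zero (n + 1)
          (k + 1) fun j h1 h2 => h j (by omega) (by omega)), mul_one]

theorem szegoPoly_coeff_zero (n : ℕ) :
    (szegoPoly α a n).coeff 0 = (schurDen α a n 0).coeff 0 := by
  simp [szegoPoly, mul_coeff_zero]

/-- The sum rule for the Bernstein–Szegő approximations. -/
theorem integral_log_norm_det_szegoPoly {g : ℝ} (hg : |g| ≤ 1) (n : ℕ)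
    (h : ∀ j, j < n + 1 → (1 - (α j)ᴴ * α j).PosDef) :
    ∫ θ, 2 * Real.log ‖(evalMat (szegoPoly α 0 (n + 1)) (expI θ)).det‖ ∂(lam g) =
      ∑ j ∈ Finset.range (n + 1), -Real.log (1 - (α j)ᴴ * α j).det.re +
        g * (α 0).trace.re - g * ∑ j ∈ Finset.range n, ((α j)ᴴ * α (j + 1)).trace.re := by
  have h' : ∀ j, 0 ≤ j → j < 0 + (n + 1) → (1 - (α j)ᴴ * α j).PosDef :=
    fun j _ h2 => h j (by omega)
  have hu := isUnit_det_schurDen_coeff_zero (a := 0) (n + 1) 0 h'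
  rw [integral_const_mul]
  simp_rw [det_evalMat]
  rw [integral_lam_log_norm_polynomial hg _ fun z hz => by
    rw [← det_evalMat]; exact det_szegoPoly_ne_zero (n + 1) h hz]
  rw [det_matPolyEquiv_symm_coeff_one _ (by rw [szegoPoly_coeff_zero]; exact hu),
    det_matPolyEquiv_symm_coeff_zero, szegoPoly_coeff_zero, mul_sub,
    log_norm_det_schurDen_coeff_zero (n + 1) 0 h']
  -- The -zu part of D contributes -α₀v₀, the source of the boundary term g Re tr α₀.
  have e : (szegoPoly α 0 (n + 1)).coeff 1 =
      (schurDen α 0 (n + 1) 0).coeff 1 - α 0 * (schurDen α 0 (n + 1) 0).coeff 0 := by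
    rw [szegoPoly, coeff_sub, coeff_mul_X, (schurPair_coeff_zero n 0).2]
  rw [e, mul_sub, Matrix.trace_sub, trace_schurDen_log_deriv n 0 h',
    Matrix.trace_mul_comm _ (_ * _),
    mul_assoc, Matrix.mul_nonsing_inv _ hu, mul_one, Complex.sub_re, Complex.re_sum]
  simp only [zero_add]
  ring

end SzegoPolynomials

/-! ### Matrix functions analytic at 0, and divisibility by powers of z. -/

section MatrixAnalytic

variable {p : ℕ}

/-- All entries of the matrix function are analytic at `0`. -/
def EntriesAnalytic (f : ℂ → Mat p) : Prop := ∀ i j, AnalyticAt ℂ (fun z => f z i j) 0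

namespace EntriesAnalytic

variable {f g : ℂ → Mat p}

theorem const (A : Mat p) : EntriesAnalytic fun _ => A := fun _ _ => analyticAt_const

theorem add (hf : EntriesAnalytic f) (hg : EntriesAnalytic g) :
    EntriesAnalytic fun z => f z + g z := fun i j => (hf i j).add (hg i j)

theorem sub (hf : EntriesAnalytic f) (hg : EntriesAnalytic g) :
    EntriesAnalytic fun z => f z - g z := fun i j => (hf i j).sub (hg i j)

theorem mul (hf : EntriesAnalytic f) (hg : EntriesAnalytic g) :
    EntriesAnalytic fun z => f z * g z := fun i j => by
  simp only [Matrix.mul_apply]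
  exact Finset.analyticAt_fun_sum _ fun k _ => (hf i k).mul (hg k j)

theorem smul {u : ℂ → ℂ} (hu : AnalyticAt ℂ u 0) (hf : EntriesAnalytic f) :
    EntriesAnalytic fun z => u z • f z := fun i j => hu.mul (hf i j)

theorem det (hf : EntriesAnalytic f) : AnalyticAt ℂ (fun z => (f z).det) 0 := by
  simp only [Matrix.det_apply, Units.smul_def, zsmul_eq_mul]
  exact Finset.analyticAt_fun_sum _ fun σ _ =>
    analyticAt_const.mul (Finset.analyticAt_fun_prod _ fun i _ => hf _ _)

theorem eventually_isUnit_det (hf : EntriesAnalytic f) (h : IsUnit (f 0).det) :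
    ∀ᶠ z in nhds (0 : ℂ), IsUnit (f z).det :=
  (hf.det.continuousAt.eventually_ne h.ne_zero).mono fun _ hz => isUnit_iff_ne_zero.2 hz

theorem inv (hf : EntriesAnalytic f) (h : IsUnit (f 0).det) :
    EntriesAnalytic fun z => (f z)⁻¹ := fun i j => by
  simp only [Matrix.inv_def, Ring.inverse_eq_inv', Matrix.smul_apply, smul_eq_mul,
    Matrix.adjugate_apply]
  refine (hf.det.inv h.ne_zero).mul (EntriesAnalytic.det fun k l => ?_)
  by_cases hk : k = j
  · subst hk
    simp only [Matrix.updateRow_self]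
    exact analyticAt_const
  · simp only [Matrix.updateRow_ne hk]
    exact hf k l

theorem divZ (hf : EntriesAnalytic f) : EntriesAnalytic (divZ f) := fun i j => by
  obtain ⟨q, hq⟩ := hf i j
  exact ⟨_, hq.has_fpower_series_dslope_fslope⟩

theorem evalMat (q : Polynomial (Mat p)) : EntriesAnalytic (evalMat q) := fun i j => by
  simp only [evalMat_apply]
  exact (Polynomial.differentiable _).analyticAt 0

end EntriesAnalytic

theorem smul_divZ (f : ℂ → Mat p) (z : ℂ) : z • divZ f z = f z - f 0 := by
  ext i j
  have h := sub_smul_dslope (fun w => f w i j) 0 z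
  rw [sub_zero] at h
  exact h

/-- The identity is required only on a punctured neighbourhood, so that the induction may cancel a
factor z. -/
theorem polynomial_X_pow_dvd {m : ℕ} : ∀ {q : Polynomial ℂ} {G : ℂ → ℂ}, ContinuousAt G 0 →
    (∀ᶠ z in nhdsWithin (0 : ℂ) {0}ᶜ, q.eval z = z ^ m * G z) → Polynomial.X ^ m ∣ q := by
  induction m with
  | zero => intro q G _ _; simp
  | succ m ih =>
    intro q G hG h
    have h0 : q.eval 0 = 0 := by
      have t1 : Filter.Tendsto (fun z => q.eval z) (nhdsWithin (0 : ℂ) {0}ᶜ) (nhds (q.eval 0)) :=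
        (q.continuous.tendsto 0).mono_left nhdsWithin_le_nhds
      have t2 : Filter.Tendsto (fun z : ℂ => z ^ (m + 1) * G z) (nhdsWithin (0 : ℂ) {0}ᶜ)
          (nhds ((0 : ℂ) ^ (m + 1) * G 0)) :=
        (((continuous_pow (m + 1)).tendsto 0).mul hG).mono_left nhdsWithin_le_nhds
      have := tendsto_nhds_unique (t1.congr' h) t2
      simpa using this
    have hX : Polynomial.X ∣ q :=
      Polynomial.X_dvd_iff.2 (by rwa [Polynomial.coeff_zero_eq_eval_zero])
    obtain ⟨r, rfl⟩ := hX
    rw [pow_succ, mul_comm]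
    refine mul_dvd_mul_left _ (ih hG ?_)
    filter_upwards [h, self_mem_nhdsWithin] with z hz hz0
    rw [Polynomial.eval_mul, Polynomial.eval_X, pow_succ, mul_comm (z ^ m), mul_assoc] at hz
    exact mul_left_cancel₀ hz0 hz

/-- This carries a vanishing order at 0, known only locally, over to the unit circle: for a
polynomial it is divisibility by z^m. -/
theorem exists_evalMat_eq_pow_smul {m : ℕ} {q : Polynomial (Mat p)} {G : ℂ → Mat p}
    (hG : EntriesAnalytic G) (h : ∀ᶠ z in nhds (0 : ℂ), evalMat q z = z ^ m • G z) :
    ∃ r : Polynomial (Mat p), ∀ z, evalMat q z = z ^ m • evalMat r z := by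
  have h1 : ∀ i j, ∃ r : Polynomial ℂ, (matPolyEquiv.symm q) i j = Polynomial.X ^ m * r := by
    intro i j
    refine polynomial_X_pow_dvd (hG i j).continuousAt ?_
    filter_upwards [h.filter_mono nhdsWithin_le_nhds] with z hz
    rw [← evalMat_apply, hz]
    rfl
  choose r hr using h1
  refine ⟨matPolyEquiv (Matrix.of r), fun z => ?_⟩
  ext i j
  rw [Matrix.smul_apply, evalMat_apply, evalMat_apply, hr, AlgEquiv.symm_apply_apply]
  simp

end MatrixAnalytic

/-! ### Approximation of the Schur and Carathéodory functions at 0. -/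

section SchurAlgorithm

variable {p : ℕ}

/-- Moving the factor across creates 1 - α†f on the right, where it cancels the inverse in the Schur
step. The proof rests on (1 - αα†)⁻¹α = α(1 - α†α)⁻¹. -/
theorem schur_intertwining {α : Mat p} (h : (1 - αᴴ * α).PosDef) (f : Mat p) :
    (1 - f * αᴴ) * (1 - α * αᴴ)⁻¹ * (f - α) = (f - α) * (1 - αᴴ * α)⁻¹ * (1 - αᴴ * f) := by
  have hL : IsUnit (1 - αᴴ * α).det := (Matrix.isUnit_iff_isUnit_det _).1 h.isUnit
  have hR : IsUnit (1 - α * αᴴ).det :=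
    (Matrix.isUnit_iff_isUnit_det _).1 (posDef_one_sub_mul_conjTranspose h).isUnit
  set A := (1 - α * αᴴ)⁻¹
  set B := (1 - αᴴ * α)⁻¹
  have hA : A * (1 - α * αᴴ) = 1 := Matrix.nonsing_inv_mul _ hR
  have hA' : (1 - α * αᴴ) * A = 1 := Matrix.mul_nonsing_inv _ hR
  have hB : B * (1 - αᴴ * α) = 1 := Matrix.nonsing_inv_mul _ hL
  have hB' : (1 - αᴴ * α) * B = 1 := Matrix.mul_nonsing_inv _ hL
  have e1 : A * α = α * B := by
    calc A * α = A * α * ((1 - αᴴ * α) * B) := by rw [hB', mul_one]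
      _ = A * (1 - α * αᴴ) * α * B := by noncomm_ring
      _ = α * B := by rw [hA, one_mul]
  have e2 : αᴴ * A = B * αᴴ := by
    calc αᴴ * A = B * (1 - αᴴ * α) * αᴴ * A := by rw [hB, one_mul]
      _ = B * αᴴ * ((1 - α * αᴴ) * A) := by noncomm_ring
      _ = B * αᴴ := by rw [hA', mul_one]
  have e3 : A = 1 + α * B * αᴴ := by
    rw [← e1, ← sub_eq_iff_eq_add, ← hA]; noncomm_ring
  have e4 : B = 1 + αᴴ * A * α := by
    rw [e2, ← sub_eq_iff_eq_add, ← hB]; noncomm_ring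
  calc (1 - f * αᴴ) * A * (f - α)
      = A * f - A * α - f * (αᴴ * A) * f + f * (αᴴ * A * α) := by noncomm_ring
    _ = (1 + α * B * αᴴ) * f - α * B - f * (B * αᴴ) * f + f * (B - 1) := by
        rw [e1, ← e3, e2, ← e2, ← sub_eq_iff_eq_add'.2 e4]
    _ = (f - α) * B * (1 - αᴴ * f) := by noncomm_ring

theorem inv_rhoR_mul_self {α : Mat p} (h : (1 - αᴴ * α).PosDef) :
    (rhoR α)⁻¹ * (rhoR α)⁻¹ = (1 - α * αᴴ)⁻¹ := by
  rw [← Matrix.mul_inv_rev, rhoR_mul_self h]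

theorem inv_one_sub_mul_rhoL {α : Mat p} (h : (1 - αᴴ * α).PosDef) :
    (1 - αᴴ * α)⁻¹ * rhoL α = (rhoL α)⁻¹ := by
  rw [← rhoL_mul_self h, Matrix.mul_inv_rev, mul_assoc, Matrix.nonsing_inv_mul _
    (isUnit_det_rhoL h), mul_one]

variable {f : ℂ → Mat p}

theorem entriesAnalytic_schurQuotient (hf : EntriesAnalytic f)
    (h : (1 - (f 0)ᴴ * f 0).PosDef) :
    EntriesAnalytic fun w => (f w - f 0) * (1 - (f 0)ᴴ * f w)⁻¹ :=
  (hf.sub (.const _)).mul (((EntriesAnalytic.const _).sub ((EntriesAnalytic.const _).mul hf)).inv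
    ((Matrix.isUnit_iff_isUnit_det _).1 h.isUnit))

theorem entriesAnalytic_schurStep (hf : EntriesAnalytic f) (h : (1 - (f 0)ᴴ * f 0).PosDef) :
    EntriesAnalytic (schurStep f) :=
  ((EntriesAnalytic.const _).mul (entriesAnalytic_schurQuotient hf h).divZ).mul (.const _)

/-- The Schur step as a relation without division. -/
theorem schurStep_relation (hf : EntriesAnalytic f) (h : (1 - (f 0)ᴴ * f 0).PosDef) :
    ∀ᶠ z in nhds (0 : ℂ), (1 - f z * (f 0)ᴴ) * (rhoR (f 0))⁻¹ * (z • schurStep f z) =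
      (f z - f 0) * (rhoL (f 0))⁻¹ := by
  have hu := ((EntriesAnalytic.const (1 : Mat p)).sub ((EntriesAnalytic.const (f 0)ᴴ).mul
    hf)).eventually_isUnit_det ((Matrix.isUnit_iff_isUnit_det _).1 h.isUnit)
  filter_upwards [hu] with z hz
  rw [schurStep, ← Matrix.smul_mul, ← Matrix.mul_smul, smul_divZ, sub_self, zero_mul, sub_zero]
  calc _ = (1 - f z * (f 0)ᴴ) * ((rhoR (f 0))⁻¹ * (rhoR (f 0))⁻¹) * (f z - f 0) *
        (1 - (f 0)ᴴ * f z)⁻¹ * rhoL (f 0) := by simp only [mul_assoc]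
    _ = _ := by
      rw [inv_rhoR_mul_self h, schur_intertwining h, mul_assoc _ (1 - (f 0)ᴴ * f z),
        Matrix.mul_nonsing_inv _ hz, mul_one, mul_assoc, inv_one_sub_mul_rhoL h]

/-- The factor f_n - a in the remainder is kept because it supplies one more power of z when a =
f_n(0). Only analyticity of G matters. The offset k lets the induction peel off the first parameter.
-/
theorem schurIterate_relation (a : Mat p) (n : ℕ) : ∀ (f : ℂ → Mat p) (α : ℕ → Mat p) (k : ℕ),
    EntriesAnalytic f → (∀ j, j < n → α (k + j) = (schurStep^[j] f) 0) →
    (∀ j, j < n → (1 - (α (k + j))ᴴ * α (k + j)).PosDef) →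
    EntriesAnalytic (schurStep^[n] f) ∧ ∃ G, EntriesAnalytic G ∧ ∀ᶠ z in nhds (0 : ℂ),
      f z * evalMat (schurDen α a n k) z - evalMat (schurNum α a n k) z =
        z ^ n • (G z * ((schurStep^[n] f) z - a)) := by
  induction n with
  | zero =>
    intro f α k hf _ _
    exact ⟨hf, fun _ => 1, .const 1, .of_forall fun z => by simp [schurDen, schurNum, schurPair]⟩
  | succ n ih =>
    intro f α k hf hα h
    have hk : α k = f 0 := hα 0 (by omega)
    have h0 : (1 - (f 0)ᴴ * f 0).PosDef := by rw [← hk]; exact h 0 (by omega)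
    have hs : ∀ j, k + 1 + j = k + (j + 1) := fun j => by ring
    obtain ⟨hn, G, hG, hr⟩ := ih (schurStep f) α (k + 1) (entriesAnalytic_schurStep hf h0)
      (fun j hj => by rw [hs]; exact hα (j + 1) (by omega))
      (fun j hj => by rw [hs]; exact h (j + 1) (by omega))
    refine ⟨hn, fun z => (1 - f z * (f 0)ᴴ) * (rhoR (f 0))⁻¹ * G z,
      (((EntriesAnalytic.const 1).sub (hf.mul (.const _))).mul (.const _)).mul hG, ?_⟩
    filter_upwards [hr, schurStep_relation hf h0] with z hz hz'
    rw [evalMat_schurNum_succ, evalMat_schurDen_succ, hk, Function.iterate_succ_apply]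
    set u := evalMat (schurNum α a n (k + 1)) z
    set v := evalMat (schurDen α a n (k + 1)) z
    calc _ = (f z - f 0) * (rhoL (f 0))⁻¹ * v -
          (1 - f z * (f 0)ᴴ) * (rhoR (f 0))⁻¹ * (z • u) := by
          generalize z • u = w
          noncomm_ring
      _ = z • ((1 - f z * (f 0)ᴴ) * (rhoR (f 0))⁻¹ * (schurStep f z * v - u)) := by
          rw [← hz', mul_sub, smul_sub, ← mul_assoc _ (schurStep f z)]
          simp only [Matrix.mul_smul, Matrix.smul_mul]
      _ = _ := by
          rw [hz, Matrix.mul_smul, smul_smul, ← pow_succ', mul_assoc (_ * _) (G z)]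

variable {F : ℂ → Mat p}

/-- The Carathéodory function is approximated by the rational functions of the Schur algorithm. -/
theorem caratheodory_relation {α : ℕ → Mat p} (a : Mat p) (n : ℕ) (hF : EntriesAnalytic F)
    (hF0 : F 0 = 1)
    (hα : ∀ j, α j = (schurStep^[j] (divZ fun z => (F z - 1) * (F z + 1)⁻¹)) 0)
    (h : ∀ j, j < n → (1 - (α j)ᴴ * α j).PosDef) :
    EntriesAnalytic (schurStep^[n] (divZ fun z => (F z - 1) * (F z + 1)⁻¹)) ∧
    ∃ G, EntriesAnalytic G ∧ ∀ᶠ z in nhds (0 : ℂ),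
      F z * evalMat (szegoPoly α a n) z - evalMat (szegoPoly₂ α a n) z =
        z ^ (n + 1) • (G z *
          ((schurStep^[n] (divZ fun z => (F z - 1) * (F z + 1)⁻¹)) z - a)) := by
  have hF1 := hF.add (EntriesAnalytic.const (1 : Mat p))
  have h2 : IsUnit (F 0 + 1).det := by
    rw [hF0, ← two_smul ℂ, Matrix.det_smul, Matrix.det_one]
    simp
  have hq := (hF.sub (EntriesAnalytic.const (1 : Mat p))).mul (hF1.inv h2)
  obtain ⟨hn, G, hG, hr⟩ := schurIterate_relation a n _ α 0 hq.divZ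
    (fun j _ => by rw [zero_add]; exact hα j) (fun j hj => by rw [zero_add]; exact h j hj)
  refine ⟨hn, fun z => (F z + 1) * G z, hF1.mul hG, ?_⟩
  filter_upwards [hr, hF1.eventually_isUnit_det h2] with z hz hu
  have hd := smul_divZ (fun z => (F z - 1) * (F z + 1)⁻¹) z
  simp only [hF0, sub_self, zero_mul, sub_zero] at hd
  set f0 := divZ (fun z => (F z - 1) * (F z + 1)⁻¹) z
  -- The Cayley transform without division; it converts an estimate for f v - u into one for F(v -
  -- zu) - (v + zu).
  have hc : (F z + 1) * (z • f0) = F z - 1 := by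
    have e : (F z + 1) * (F z - 1) = (F z - 1) * (F z + 1) := by noncomm_ring
    rw [hd, ← mul_assoc, e, mul_assoc, Matrix.mul_nonsing_inv _ hu, mul_one]
  have hs : z ^ (n + 1) • ((F z + 1) * G z *
      ((schurStep^[n] (divZ fun z => (F z - 1) * (F z + 1)⁻¹)) z - a)) =
      (F z - 1) * evalMat (schurDen α a n 0) z -
        (F z + 1) * (z • evalMat (schurNum α a n 0) z) := by
    rw [mul_assoc (F z + 1), pow_succ', mul_smul, ← Matrix.mul_smul (F z + 1), ← hz,
      ← Matrix.mul_smul (F z + 1), smul_sub, mul_sub (F z + 1), ← Matrix.smul_mul,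
      ← mul_assoc (F z + 1), hc]
  rw [hs, szegoPoly, szegoPoly₂, evalMat_sub, evalMat_add, evalMat_mul_X]
  generalize z • evalMat (schurNum α a n 0) z = w
  noncomm_ring

end SchurAlgorithm

/-! ### Moments, Taylor expansion of F and the Padé property. -/

section Moments

variable {p : ℕ} {μ : MatMeasure p}

/-- A scalar measure `τ` and a nonnegative density `M` representing the matrix measure. -/
structure Represents (μ : MatMeasure p) (τ : Measure UCircle) (M : UCircle → Mat p) : Prop where
  finite : IsFiniteMeasure τ
  measurable : ∀ i j, Measurable fun θ => M θ i j
  posSemidef : ∀ θ, (M θ).PosSemidef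
  norm_le : ∀ θ i j, ‖M θ i j‖ ≤ 1
  entryIntegral_eq : ∀ i j u, Continuous u → entryIntegral μ i j u = ∫ θ, u θ * M θ i j ∂τ
  integral_eq : ∀ i j, ∫ θ, M θ i j ∂τ = (1 : Mat p) i j

/-- The moments of a matrix measure. -/
noncomputable def moment (τ : Measure UCircle) (M : UCircle → Mat p) (k : ℕ) : Mat p :=
  Matrix.of fun i j => ∫ θ, star (expI θ) ^ k * M θ i j ∂τ

/-- The Taylor polynomial of the Carathéodory function with moments `c`. -/
noncomputable def caratheodoryPoly (c : ℕ → Mat p) (N : ℕ) : Polynomial (Mat p) :=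
  1 + ∑ k ∈ Finset.range N, Polynomial.C ((2 : ℂ) • c (k + 1)) * Polynomial.X ^ (k + 1)

theorem evalMat_caratheodoryPoly (c : ℕ → Mat p) (N : ℕ) (z : ℂ) :
    evalMat (caratheodoryPoly c N) z =
      1 + ∑ k ∈ Finset.range N, (2 * z ^ (k + 1)) • c (k + 1) := by
  rw [caratheodoryPoly, evalMat_add, evalMat_one]
  congr 1
  induction N with
  | zero => simp
  | succ N ih =>
    rw [Finset.sum_range_succ, evalMat_add, ih, Finset.sum_range_succ, evalMat_mul_X_pow, evalMat_C,
      smul_smul, mul_comm]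

/-- Differentiation under the integral on |z| < 1/2, where the kernel is bounded by 2 and its
derivative by 4. -/
theorem analyticAt_cauchyIntegral {τ : Measure UCircle} [IsFiniteMeasure τ] {φ : UCircle → ℂ}
    (hφ : Measurable φ) (hb : ∀ θ, ‖φ θ‖ ≤ 1) :
    AnalyticAt ℂ (fun z => ∫ θ, (expI θ - z)⁻¹ * φ θ ∂τ) 0 := by
  have hlow : ∀ z ∈ Metric.ball (0 : ℂ) (1 / 2), ∀ θ, 1 / 2 ≤ ‖expI θ - z‖ := by
    intro z hz θ
    rw [mem_ball_zero_iff] at hz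
    have := norm_sub_norm_le (expI θ) z
    rw [norm_expI] at this
    linarith
  have hinv : ∀ z ∈ Metric.ball (0 : ℂ) (1 / 2), ∀ θ, ‖(expI θ - z)⁻¹‖ ≤ 2 := by
    intro z hz θ
    rw [norm_inv]
    exact inv_le_of_inv_le₀ (by norm_num) (by have := hlow z hz θ; linarith)
  have hexp : Measurable expI := continuous_expI.measurable
  have hd : DifferentiableOn ℂ (fun z => ∫ θ, (expI θ - z)⁻¹ * φ θ ∂τ)
      (Metric.ball (0 : ℂ) (1 / 2)) := by
    intro z hz
    refine ((hasDerivAt_integral_of_dominated_loc_of_deriv_le (bound := fun _ => 4)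
      (F' := fun z θ => ((expI θ - z)⁻¹ * (expI θ - z)⁻¹) * φ θ)
      (Metric.isOpen_ball.mem_nhds hz) ?_ ?_ ?_ ?_ (integrable_const _)
      ?_).2.differentiableAt).differentiableWithinAt
    · exact .of_forall fun w => ((hexp.sub_const w).inv.mul hφ).aestronglyMeasurable
    · refine Integrable.of_bound ((hexp.sub_const z).inv.mul hφ).aestronglyMeasurable 2
        (.of_forall fun θ => ?_)
      rw [norm_mul]
      nlinarith [hinv z hz θ, hb θ, norm_nonneg (φ θ), norm_nonneg (expI θ - z)⁻¹]
    · exact (((hexp.sub_const z).inv.mul (hexp.sub_const z).inv).mul hφ).aestronglyMeasurable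
    · refine .of_forall fun θ w hw => ?_
      rw [norm_mul, norm_mul]
      have h1 := hinv w hw θ
      have h2 := norm_nonneg (expI θ - w)⁻¹
      calc ‖(expI θ - w)⁻¹‖ * ‖(expI θ - w)⁻¹‖ * ‖φ θ‖ ≤ 2 * 2 * 1 := by
            gcongr
            exact hb θ
        _ = 4 := by norm_num
    · refine .of_forall fun θ w hw => HasDerivAt.mul_const ?_ _
      have h0 : expI θ - w ≠ 0 := by
        rw [← norm_pos_iff]; linarith [hlow w hw θ]
      have := ((hasDerivAt_id w).const_sub (expI θ)).inv h0
      simp only [id] at this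
      have e : (expI θ - w)⁻¹ * (expI θ - w)⁻¹ = - -1 / (expI θ - w) ^ 2 := by
        field_simp
      rw [e]
      exact this
  exact hd.analyticAt (Metric.ball_mem_nhds 0 (by norm_num))

theorem star_expI_mul (θ : UCircle) : star (expI θ) * expI θ = 1 := by
  rw [star_expI, inv_mul_cancel₀ (expI_ne_zero θ)]

theorem cauchyKernel_expansion {e z : ℂ} (he : star e * e = 1) (hz : e - z ≠ 0) (N : ℕ) :
    (e + z) / (e - z) = 1 + ∑ k ∈ Finset.range N, 2 * z ^ (k + 1) * star e ^ (k + 1) +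
      z ^ (N + 1) * (2 * star e ^ N * (e - z)⁻¹) := by
  induction N with
  | zero => field_simp; simp; ring
  | succ N ih =>
    rw [ih, Finset.sum_range_succ]
    have : 2 * star e ^ N * (e - z)⁻¹ = 2 * star e ^ (N + 1) + z * (2 * star e ^ (N + 1) *
        (e - z)⁻¹) := by
      field_simp
      rw [pow_succ]
      linear_combination (-star e ^ N) * he
    rw [this]
    ring

/-- The finite geometric expansion with remainder is integrated term by term; the remainder is again
a Cauchy integral, so no infinite series is summed. -/
theorem caratheodory_taylor {τ : Measure UCircle} {M : UCircle → Mat p} (h : Represents μ τ M)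
    (N : ℕ) : ∃ G, EntriesAnalytic G ∧ ∀ z : ℂ, ‖z‖ < 1 →
      caratheodory μ z = evalMat (caratheodoryPoly (moment τ M) N) z + z ^ (N + 1) • G z := by
  have := h.finite
  have hexp : Measurable expI := continuous_expI.measurable
  have hstar : Measurable fun θ => star (expI θ) := (continuous_expI.star).measurable
  refine ⟨fun z => (2 : ℂ) • Matrix.of fun i j => ∫ θ, (expI θ - z)⁻¹ *
    (star (expI θ) ^ N * M θ i j) ∂τ, EntriesAnalytic.smul analyticAt_const fun i j => ?_,
    fun z hz => ?_⟩
  · refine analyticAt_cauchyIntegral ((hstar.pow_const N).mul (h.measurable i j)) fun θ => ?_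
    rw [norm_mul, norm_pow, norm_star, norm_expI, one_pow, one_mul]
    exact h.norm_le θ i j
  · have hne : ∀ θ, expI θ - z ≠ 0 := fun θ h0 => by
      rw [← sub_eq_zero.1 h0, norm_expI] at hz
      exact lt_irrefl _ hz
    have hi : ∀ i j (u : UCircle → ℂ), Continuous u → Integrable (fun θ => u θ * M θ i j) τ := by
      intro i j u hu
      refine (continuous_integrable hu τ).mul_bdd (c := 1)
        (h.measurable i j).aestronglyMeasurable (.of_forall fun θ => h.norm_le θ i j)
    have hk : ∀ k : ℕ, Continuous fun θ => star (expI θ) ^ k := fun k => continuous_expI.star.pow k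
    have hc : Continuous fun θ => (expI θ - z)⁻¹ := (continuous_expI.sub continuous_const).inv₀ hne
    rw [evalMat_caratheodoryPoly]
    ext i j
    rw [caratheodory, Matrix.of_apply, h.entryIntegral_eq]
    · have e : ∀ θ, (expI θ + z) / (expI θ - z) * M θ i j = M θ i j +
          ∑ k ∈ Finset.range N, 2 * z ^ (k + 1) * (star (expI θ) ^ (k + 1) * M θ i j) +
          z ^ (N + 1) * 2 * ((expI θ - z)⁻¹ * star (expI θ) ^ N * M θ i j) := by
        intro θ
        rw [cauchyKernel_expansion (star_expI_mul θ) (hne θ) N, add_mul, add_mul, Finset.sum_mul,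
          one_mul]
        congr 1
        · congr 1
          exact Finset.sum_congr rfl fun k _ => by ring
        · ring
      simp_rw [e]
      have i1 : Integrable (fun θ => M θ i j) τ := by
        simpa using hi i j (fun _ => 1) continuous_const
      have i2 : ∀ k ∈ Finset.range N, Integrable
          (fun θ => 2 * z ^ (k + 1) * (star (expI θ) ^ (k + 1) * M θ i j)) τ := fun k _ =>
        (hi i j _ (hk (k + 1))).const_mul _
      have i12 : Integrable (fun θ => M θ i j + ∑ k ∈ Finset.range N,
          2 * z ^ (k + 1) * (star (expI θ) ^ (k + 1) * M θ i j)) τ :=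
        i1.add (integrable_finsetSum _ i2)
      have i3 : Integrable (fun θ => z ^ (N + 1) * 2 *
          ((expI θ - z)⁻¹ * star (expI θ) ^ N * M θ i j)) τ :=
        (hi i j _ (hc.mul (hk N))).const_mul _
      rw [integral_add i12 i3, integral_add i1 (integrable_finsetSum _ i2),
        integral_finsetSum _ i2, h.integral_eq]
      simp only [integral_const_mul, Matrix.add_apply, Matrix.smul_apply, Matrix.of_apply,
        smul_eq_mul, Matrix.sum_apply, moment, mul_assoc]
    · exact (continuous_expI.add continuous_const).div (continuous_expI.sub continuous_const) hne

theorem entriesAnalytic_caratheodory {τ : Measure UCircle} {M : UCircle → Mat p}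
    (h : Represents μ τ M) : EntriesAnalytic (caratheodory μ) ∧ caratheodory μ 0 = 1 := by
  obtain ⟨G, hG, hr⟩ := caratheodory_taylor h 0
  constructor
  · intro i j
    refine (((EntriesAnalytic.evalMat (caratheodoryPoly (moment τ M) 0)).add
      (hG.smul (analyticAt_id.pow 1))) i j).congr ?_
    filter_upwards [Metric.ball_mem_nhds (0 : ℂ) one_pos] with z hz
    rw [hr z (by simpa using hz)]
    simp
  · rw [hr 0 (by simp)]
    simp [caratheodoryPoly]

theorem verblunsky_eq (μ : MatMeasure p) (k : ℕ) : verblunsky μ k =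
    (schurStep^[k] (divZ fun z => (caratheodory μ z - 1) * (caratheodory μ z + 1)⁻¹)) 0 := rfl

/-- The Padé property of the Szegő polynomials. -/
theorem exists_caratheodoryPoly_mul_szegoPoly {τ : Measure UCircle} {M : UCircle → Mat p}
    (h : Represents μ τ M) (n : ℕ)
    (hα : ∀ j, j < n → (1 - (verblunsky μ j)ᴴ * verblunsky μ j).PosDef) (a : Mat p) (e : ℕ)
    (he : e = 0 ∨ e = 1 ∧ a = verblunsky μ n) :
    ∃ R : Polynomial (Mat p), ∀ z, evalMat (caratheodoryPoly (moment τ M) (n + e)) z *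
      evalMat (szegoPoly (verblunsky μ) a n) z - evalMat (szegoPoly₂ (verblunsky μ) a n) z =
        z ^ (n + e + 1) • evalMat R z := by
  obtain ⟨hF, hF0⟩ := entriesAnalytic_caratheodory h
  obtain ⟨hn, G, hG, hr⟩ := caratheodory_relation a n hF hF0 (verblunsky_eq μ) hα
  obtain ⟨H, hH, hr'⟩ := caratheodory_taylor h (n + e)
  obtain ⟨K, hK, hr''⟩ : ∃ K, EntriesAnalytic K ∧ ∀ᶠ z in nhds (0 : ℂ),
      caratheodory μ z * evalMat (szegoPoly (verblunsky μ) a n) z -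
        evalMat (szegoPoly₂ (verblunsky μ) a n) z = z ^ (n + e + 1) • K z := by
    -- For a = α_n the factor f_n - a vanishes at 0 and `divZ` extracts the additional power of z.
    rcases he with rfl | ⟨rfl, rfl⟩
    · exact ⟨_, hG.mul (hn.sub (.const a)), hr⟩
    · refine ⟨_, hG.mul hn.divZ, ?_⟩
      filter_upwards [hr] with z hz
      rw [hz, verblunsky_eq, ← smul_divZ, Matrix.mul_smul, smul_smul, ← pow_succ]
  -- Replacing F by its Taylor polynomial changes only terms of order n + e + 1 and makes the left
  -- side a polynomial.
  obtain ⟨R, hR⟩ := exists_evalMat_eq_pow_smul (m := n + e + 1)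
    (q := caratheodoryPoly (moment τ M) (n + e) * szegoPoly (verblunsky μ) a n -
      szegoPoly₂ (verblunsky μ) a n)
    (hK.sub (hH.mul (EntriesAnalytic.evalMat (szegoPoly (verblunsky μ) a n)))) (by
      filter_upwards [hr'', Metric.ball_mem_nhds (0 : ℂ) one_pos] with z hz hz1
      rw [hr' z (by simpa using hz1), add_mul] at hz
      rw [evalMat_sub, evalMat_mul, smul_sub, ← hz, Matrix.smul_mul]
      abel)
  exact ⟨R, fun z => by rw [← hR z, evalMat_sub, evalMat_mul]⟩

end Moments

/-! ### Moments determine quadratic forms on polynomials of bounded degree. -/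

section QuadraticForms

variable {p : ℕ}

theorem continuous_evalMat (P : Polynomial (Mat p)) : Continuous fun θ => evalMat P (expI θ) :=
  continuous_matrix fun i j => continuous_evalMat_expI P i j

theorem integrable_continuous_mul {ν : Measure UCircle} {u f : UCircle → ℂ} (hu : Continuous u)
    (hf : Integrable f ν) : Integrable (fun θ => u θ * f θ) ν := by
  obtain ⟨C, hC⟩ := isCompact_univ.exists_bound_of_continuousOn hu.continuousOn
  exact hf.bdd_mul hu.aestronglyMeasurable (.of_forall fun θ => hC θ (Set.mem_univ _))

/-- The integrals of `star (e^{ikθ}) e^{ilθ} f`, `k, l ≤ N`, are determined by moments. -/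
theorem integral_star_pow_mul_pow_eq {ν₁ ν₂ : Measure UCircle} {f₁ f₂ : UCircle → ℂ} {N : ℕ}
    (h : ∀ k ≤ N, ∫ θ, star (expI θ) ^ k * f₁ θ ∂ν₁ = ∫ θ, star (expI θ) ^ k * f₂ θ ∂ν₂)
    (h' : ∀ k ≤ N, ∫ θ, expI θ ^ k * f₁ θ ∂ν₁ = ∫ θ, expI θ ^ k * f₂ θ ∂ν₂) {k l : ℕ}
    (hk : k ≤ N) (hl : l ≤ N) :
    ∫ θ, star (expI θ) ^ k * expI θ ^ l * f₁ θ ∂ν₁ =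
      ∫ θ, star (expI θ) ^ k * expI θ ^ l * f₂ θ ∂ν₂ := by
  rcases le_total k l with hkl | hkl
  · have e : ∀ θ, star (expI θ) ^ k * expI θ ^ l = expI θ ^ (l - k) := fun θ => by
      obtain ⟨m, rfl⟩ := Nat.exists_eq_add_of_le hkl
      rw [pow_add, ← mul_assoc, ← mul_pow, star_expI_mul, one_pow, one_mul, Nat.add_sub_cancel_left]
    simp_rw [e]
    exact h' _ (by omega)
  · have e : ∀ θ, star (expI θ) ^ k * expI θ ^ l = star (expI θ) ^ (k - l) := fun θ => by
      obtain ⟨m, rfl⟩ := Nat.exists_eq_add_of_le hkl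
      rw [add_comm l m, pow_add, mul_assoc, ← mul_pow, star_expI_mul, one_pow, mul_one,
        Nat.add_sub_cancel]
    simp_rw [e]
    exact h _ (by omega)

theorem integral_star_sum_mul_sum {ν : Measure UCircle} {f : UCircle → ℂ} (hf : Integrable f ν)
    (N : ℕ) (q r : ℕ → ℂ) :
    ∫ θ, star (∑ k ∈ Finset.range N, expI θ ^ k * q k) * (∑ l ∈ Finset.range N, expI θ ^ l * r l) *
      f θ ∂ν = ∑ k ∈ Finset.range N, ∑ l ∈ Finset.range N, star (q k) * r l *
        ∫ θ, star (expI θ) ^ k * expI θ ^ l * f θ ∂ν := by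
  have e : ∀ θ, star (∑ k ∈ Finset.range N, expI θ ^ k * q k) *
      (∑ l ∈ Finset.range N, expI θ ^ l * r l) * f θ = ∑ k ∈ Finset.range N, ∑ l ∈ Finset.range N,
        star (q k) * r l * (star (expI θ) ^ k * expI θ ^ l * f θ) := by
    intro θ
    rw [star_sum, Finset.sum_mul_sum, Finset.sum_mul]
    refine Finset.sum_congr rfl fun k _ => ?_
    rw [Finset.sum_mul]
    refine Finset.sum_congr rfl fun l _ => ?_
    rw [star_mul, star_pow]
    ring
  simp_rw [e]
  have hi : ∀ k l, Integrable (fun θ => star (q k) * r l *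
      (star (expI θ) ^ k * expI θ ^ l * f θ)) ν := fun k l =>
    (integrable_continuous_mul ((continuous_expI.star.pow k).mul (continuous_expI.pow l))
      hf).const_mul _
  rw [integral_finsetSum _ fun k _ => integrable_finsetSum _ fun l _ => hi k l]
  refine Finset.sum_congr rfl fun k _ => ?_
  rw [integral_finsetSum _ fun l _ => hi k l]
  exact Finset.sum_congr rfl fun l _ => integral_const_mul _ _

theorem sandwich_apply (A B W : Mat p) (a b : Fin p) :
    (Aᴴ * W * B) a b = ∑ j, ∑ i, star (A i a) * B j b * W i j := by
  rw [Matrix.mul_apply]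
  refine Finset.sum_congr rfl fun j _ => ?_
  rw [Matrix.mul_apply, Finset.sum_mul]
  refine Finset.sum_congr rfl fun i _ => ?_
  rw [Matrix.conjTranspose_apply]
  ring

theorem integral_sandwich_apply {ν : Measure UCircle} {A B W : UCircle → Mat p}
    (hA : Continuous A) (hB : Continuous B) (hW : ∀ i j, Integrable (fun θ => W θ i j) ν)
    (a b : Fin p) : ∫ θ, ((A θ)ᴴ * W θ * B θ) a b ∂ν =
      ∑ j, ∑ i, ∫ θ, star (A θ i a) * B θ j b * W θ i j ∂ν := by
  simp_rw [sandwich_apply]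
  have hi : ∀ i j, Integrable (fun θ => star (A θ i a) * B θ j b * W θ i j) ν := fun i j =>
    integrable_continuous_mul ((hA.matrix_elem i a).star.mul (hB.matrix_elem j b)) (hW i j)
  rw [integral_finsetSum _ fun j _ => integrable_finsetSum _ fun i _ => hi i j]
  exact Finset.sum_congr rfl fun j _ => integral_finsetSum _ fun i _ => hi i j

theorem integrable_sandwich_apply {ν : Measure UCircle} {A B W : UCircle → Mat p}
    (hA : Continuous A) (hB : Continuous B) (hW : ∀ i j, Integrable (fun θ => W θ i j) ν)
    (a b : Fin p) : Integrable (fun θ => ((A θ)ᴴ * W θ * B θ) a b) ν := by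
  simp_rw [sandwich_apply]
  exact integrable_finsetSum _ fun j _ => integrable_finsetSum _ fun i _ =>
    integrable_continuous_mul ((hA.matrix_elem i a).star.mul (hB.matrix_elem j b)) (hW i j)

theorem integral_expI_pow_mul_hermitian {ν : Measure UCircle} {W : UCircle → Mat p}
    (hH : ∀ θ, (W θ).IsHermitian) (k : ℕ) (i j : Fin p) :
    ∫ θ, expI θ ^ k * W θ i j ∂ν = star (moment ν W k j i) := by
  rw [moment, Matrix.of_apply, Complex.star_def, ← integral_conj]
  refine integral_congr_ae (.of_forall fun θ => ?_)
  simp only [map_mul, map_pow, Complex.conj_conj]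
  rw [← (hH θ).apply i j]
  rfl

/-- Equality of moments up to the order `N` implies equality of the quadratic forms on
polynomials of degree at most `N`. -/
theorem integral_sandwich_eq_of_moment_eq {ν₁ ν₂ : Measure UCircle} {W₁ W₂ : UCircle → Mat p}
    (h₁ : ∀ i j, Integrable (fun θ => W₁ θ i j) ν₁) (h₂ : ∀ i j, Integrable (fun θ => W₂ θ i j) ν₂)
    (H₁ : ∀ θ, (W₁ θ).IsHermitian) (H₂ : ∀ θ, (W₂ θ).IsHermitian) {N : ℕ}
    (hm : ∀ k ≤ N, moment ν₁ W₁ k = moment ν₂ W₂ k) {P Q : Polynomial (Mat p)}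
    (hP : ∀ m, N + 1 ≤ m → P.coeff m = 0) (hQ : ∀ m, N + 1 ≤ m → Q.coeff m = 0) (a b : Fin p) :
    ∫ θ, ((evalMat P (expI θ))ᴴ * W₁ θ * evalMat Q (expI θ)) a b ∂ν₁ =
      ∫ θ, ((evalMat P (expI θ))ᴴ * W₂ θ * evalMat Q (expI θ)) a b ∂ν₂ := by
  rw [integral_sandwich_apply (continuous_evalMat P) (continuous_evalMat Q) h₁,
    integral_sandwich_apply (continuous_evalMat P) (continuous_evalMat Q) h₂]
  refine Finset.sum_congr rfl fun j _ => Finset.sum_congr rfl fun i _ => ?_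
  have eP : ∀ (P : Polynomial (Mat p)), (∀ m, N + 1 ≤ m → P.coeff m = 0) → ∀ θ i j,
      evalMat P (expI θ) i j = ∑ k ∈ Finset.range (N + 1), expI θ ^ k * P.coeff k i j := by
    intro P hP θ i j
    rw [evalMat_eq_sum P hP, Matrix.sum_apply]
    rfl
  simp_rw [eP P hP, eP Q hQ]
  rw [integral_star_sum_mul_sum (h₁ i j), integral_star_sum_mul_sum (h₂ i j)]
  refine Finset.sum_congr rfl fun k hk => Finset.sum_congr rfl fun l hl => ?_
  rw [Finset.mem_range] at hk hl
  congr 1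
  refine integral_star_pow_mul_pow_eq (N := N) (fun k hk => ?_) (fun k hk => ?_) (by omega)
    (by omega)
  · exact congrFun (congrFun (hm k hk) i) j
  · rw [integral_expI_pow_mul_hermitian H₁, integral_expI_pow_mul_hermitian H₂, hm k hk]

end QuadraticForms

/-! ### Moments of Re T and of the Bernstein–Szegő weight. -/

section TrigonometricWeights

variable {p : ℕ}

theorem integral_star_expI_pow_mul {f : ℂ → ℂ} {U : Set ℂ} (hf : DifferentiableOn ℂ f U)
    (hU : Metric.closedBall 0 1 ⊆ U) {k N : ℕ} (hk : k < N) :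
    ∫ θ, star (expI θ) ^ k * (expI θ ^ N * f (expI θ)) ∂lam0 = 0 := by
  obtain ⟨m, rfl⟩ := Nat.exists_eq_add_of_lt hk
  have e : ∀ θ, star (expI θ) ^ k * (expI θ ^ (k + m + 1) * f (expI θ)) =
      expI θ * (expI θ ^ m * f (expI θ)) := fun θ => by
    have h1 : star (expI θ) ^ k * expI θ ^ k = 1 := by rw [← mul_pow, star_expI_mul, one_pow]
    rw [pow_succ, pow_add]
    linear_combination (expI θ ^ m * expI θ * f (expI θ)) * h1
  simp_rw [e]
  exact integral_expI_mul ((differentiableOn_id.pow m).mul hf) hU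

theorem integral_expI_pow_mul {f : ℂ → ℂ} {U : Set ℂ} (hf : DifferentiableOn ℂ f U)
    (hU : Metric.closedBall 0 1 ⊆ U) {k : ℕ} (hk : 0 < k) :
    ∫ θ, expI θ ^ k * f (expI θ) ∂lam0 = 0 := by
  simpa using integral_star_expI_pow_mul hf hU hk

theorem integral_star_pow_mul_star {f : UCircle → ℂ} (k : ℕ) :
    ∫ θ, star (expI θ) ^ k * star (f θ) ∂lam0 = star (∫ θ, expI θ ^ k * f θ ∂lam0) := by
  rw [Complex.star_def, ← integral_conj]
  simp

theorem integral_star_pow_mul_pow (k l : ℕ) :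
    ∫ θ, star (expI θ) ^ k * expI θ ^ l ∂lam0 = if k = l then 1 else 0 := by
  have hone : DifferentiableOn ℂ (fun _ : ℂ => (1 : ℂ)) Set.univ := differentiableOn_const 1
  rcases lt_trichotomy k l with h | rfl | h
  · rw [if_neg h.ne]
    simpa using integral_star_expI_pow_mul hone (Set.subset_univ _) h
  · simp_rw [← mul_pow, star_expI_mul]
    simp
  · rw [if_neg h.ne']
    have h1 := integral_star_expI_pow_mul hone (Set.subset_univ _) h
    have h2 := congrArg star h1
    rw [star_zero, Complex.star_def, ← integral_conj] at h2
    rw [← h2]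
    refine integral_congr_ae (.of_forall fun θ => ?_)
    simp [mul_comm]

/-- The real part of a matrix polynomial, as a weight on the circle. -/
noncomputable def realPart (A : UCircle → Mat p) (θ : UCircle) : Mat p :=
  (1 / 2 : ℂ) • (A θ + (A θ)ᴴ)

theorem realPart_isHermitian (A : UCircle → Mat p) (θ : UCircle) : (realPart A θ).IsHermitian := by
  rw [Matrix.IsHermitian, realPart, Matrix.conjTranspose_smul, Matrix.conjTranspose_add,
    Matrix.conjTranspose_conjTranspose, add_comm]
  simp

theorem continuous_realPart {A : UCircle → Mat p} (hA : Continuous A) : Continuous (realPart A) :=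
  continuous_matrix fun i j =>
    continuous_const.mul ((hA.matrix_elem i j).add (hA.matrix_elem j i).star)

theorem moment_realPart {A : UCircle → Mat p} (hA : Continuous A) (k : ℕ) (i j : Fin p) :
    moment lam0 (realPart A) k i j = (1 / 2 : ℂ) * (∫ θ, star (expI θ) ^ k * A θ i j ∂lam0 +
      star (∫ θ, expI θ ^ k * A θ j i ∂lam0)) := by
  rw [← integral_star_pow_mul_star, ← integral_add, ← integral_const_mul]
  · rw [moment, Matrix.of_apply]
    refine integral_congr_ae (.of_forall fun θ => ?_)
    simp only [realPart, Matrix.smul_apply, Matrix.add_apply, Matrix.conjTranspose_apply,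
      smul_eq_mul]
    ring
  · exact continuous_integrable ((continuous_expI.star.pow k).mul (hA.matrix_elem i j)) _
  · exact continuous_integrable ((continuous_expI.star.pow k).mul (hA.matrix_elem j i).star) _

/-- The factor 2 of the higher coefficients cancels the 1/2 of `realPart`; the constant term carries
none since it occurs in the adjoint too. -/
theorem moment_realPart_caratheodoryPoly {c : ℕ → Mat p} (hc : c 0 = 1) {N k : ℕ} (hk : k ≤ N) :
    moment lam0 (realPart fun θ => evalMat (caratheodoryPoly c N) (expI θ)) k = c k := by
  ext i j
  rw [moment_realPart (continuous_evalMat _)]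
  have e : ∀ θ i j, evalMat (caratheodoryPoly c N) (expI θ) i j =
      ∑ l ∈ Finset.range (N + 1), (if l = 0 then (1 : Mat p) i j else 2 * c l i j) *
        expI θ ^ l := by
    intro θ i j
    rw [evalMat_caratheodoryPoly, Finset.sum_range_succ', Matrix.add_apply, Matrix.sum_apply,
      add_comm]
    congr 1
    · refine Finset.sum_congr rfl fun l _ => ?_
      rw [if_neg (by omega), Matrix.smul_apply, smul_eq_mul]
      ring
    · simp
  have s1 : ∫ θ, star (expI θ) ^ k * evalMat (caratheodoryPoly c N) (expI θ) i j ∂lam0 =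
      if k = 0 then (1 : Mat p) i j else 2 * c k i j := by
    simp_rw [e, Finset.mul_sum]
    rw [integral_finsetSum _ fun l _ => continuous_integrable (by
      have := continuous_expI; fun_prop) _]
    simp_rw [mul_left_comm, integral_const_mul, integral_star_pow_mul_pow]
    simp [Nat.lt_succ_of_le hk]
  have s2 : ∫ θ, expI θ ^ k * evalMat (caratheodoryPoly c N) (expI θ) j i ∂lam0 =
      if k = 0 then (1 : Mat p) j i else 0 := by
    have hd : DifferentiableOn ℂ (fun z => evalMat (caratheodoryPoly c N) z j i) Set.univ := by
      simp_rw [evalMat_apply]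
      exact (Polynomial.differentiable _).differentiableOn
    rcases Nat.eq_zero_or_pos k with rfl | h0
    · simp only [pow_zero, one_mul, if_true]
      rw [integral_lam0_of_differentiableOn hd (Set.subset_univ _), evalMat_caratheodoryPoly]
      simp
    · rw [integral_expI_pow_mul hd (Set.subset_univ _) h0, if_neg h0.ne']
  rw [s1, s2]
  rcases Nat.eq_zero_or_pos k with rfl | h0
  · rw [if_pos rfl, if_pos rfl, hc, ← Matrix.conjTranspose_apply, Matrix.conjTranspose_one]
    ring
  · rw [if_neg h0.ne', if_neg h0.ne', star_zero]
    ring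

/-- P† has frequencies above -N and z^N R has frequencies at least N, so the product contains
positive frequencies only. -/
theorem integral_star_polynomial_mul {P : Polynomial (Mat p)} {N : ℕ}
    (hP : ∀ m, N ≤ m → P.coeff m = 0) (R : Polynomial (Mat p)) (a b : Fin p) :
    ∫ θ, ((evalMat P (expI θ))ᴴ * (expI θ ^ N • evalMat R (expI θ))) a b ∂lam0 = 0 := by
  have e : ∀ θ, ((evalMat P (expI θ))ᴴ * (expI θ ^ N • evalMat R (expI θ))) a b =
      ∑ k ∈ Finset.range N, star (expI θ) ^ k * (expI θ ^ N *
        evalMat (Polynomial.C (P.coeff k)ᴴ * R) (expI θ) a b) := by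
    intro θ
    rw [evalMat_eq_sum P hP, Matrix.conjTranspose_sum, Finset.sum_mul, Matrix.sum_apply]
    refine Finset.sum_congr rfl fun k _ => ?_
    rw [Matrix.conjTranspose_smul, Matrix.smul_mul, Matrix.mul_smul, star_pow, evalMat_mul,
      evalMat_C]
    rfl
  simp_rw [e]
  have hc : ∀ k, Continuous fun θ => star (expI θ) ^ k * (expI θ ^ N *
      evalMat (Polynomial.C (P.coeff k)ᴴ * R) (expI θ) a b) := fun k =>
    (continuous_expI.star.pow k).mul ((continuous_expI.pow N).mul (continuous_evalMat_expI _ a b))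
  rw [integral_finsetSum _ fun k _ => continuous_integrable (hc k) _]
  refine Finset.sum_eq_zero fun k hk => ?_
  refine integral_star_expI_pow_mul (f := fun z =>
    evalMat (Polynomial.C (P.coeff k)ᴴ * R) z a b) (U := Set.univ) ?_ (Set.subset_univ _)
    (Finset.mem_range.1 hk)
  simp_rw [evalMat_apply]
  exact (Polynomial.differentiable _).differentiableOn

/-- If `T D = E + z^N R` and `D† E + E† D = 2 K` on the circle, then `K` is the integral of the
quadratic form of `Re T` at `D`. -/
theorem integral_sandwich_realPart {T D E R : Polynomial (Mat p)} {K : Mat p} {N : ℕ}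
    (hD : ∀ m, N ≤ m → D.coeff m = 0)
    (hR : ∀ z, evalMat T z * evalMat D z - evalMat E z = z ^ N • evalMat R z)
    (hK : ∀ z : ℂ, ‖z‖ = 1 → (evalMat D z)ᴴ * evalMat E z + (evalMat E z)ᴴ * evalMat D z =
      (2 : ℂ) • K) (a b : Fin p) :
    ∫ θ, ((evalMat D (expI θ))ᴴ * realPart (fun θ => evalMat T (expI θ)) θ *
      evalMat D (expI θ)) a b ∂lam0 = K a b := by
  have e : ∀ θ, ((evalMat D (expI θ))ᴴ * realPart (fun θ => evalMat T (expI θ)) θ *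
      evalMat D (expI θ)) a b = K a b + (1 / 2 : ℂ) *
        (((evalMat D (expI θ))ᴴ * (expI θ ^ N • evalMat R (expI θ))) a b +
        star (((evalMat D (expI θ))ᴴ * (expI θ ^ N • evalMat R (expI θ))) b a)) := by
    intro θ
    have h1 := hR (expI θ)
    have h2 := hK (expI θ) (norm_expI θ)
    set T' := evalMat T (expI θ)
    set D' := evalMat D (expI θ)
    set E' := evalMat E (expI θ)
    -- D† (Re T) D is half of D†(TD) plus its adjoint; substituting TD = E + z^N R turns the E part
    -- into K.
    have h3 : D'ᴴ * realPart (fun θ => evalMat T (expI θ)) θ * D' =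
        K + (1 / 2 : ℂ) • (D'ᴴ * (expI θ ^ N • evalMat R (expI θ)) +
          (D'ᴴ * (expI θ ^ N • evalMat R (expI θ)))ᴴ) := by
      have hK' : K = (1 / 2 : ℂ) • (D'ᴴ * E' + E'ᴴ * D') := by
        rw [h2, smul_smul]; norm_num
      rw [← h1, hK', realPart, ← smul_add, Matrix.mul_smul, Matrix.smul_mul]
      congr 1
      simp only [Matrix.conjTranspose_mul, Matrix.conjTranspose_sub,
        Matrix.conjTranspose_conjTranspose]
      noncomm_ring
    rw [h3]
    simp only [Matrix.add_apply, Matrix.smul_apply, Matrix.conjTranspose_apply, smul_eq_mul]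
  have hc : ∀ a b, Continuous fun θ =>
      ((evalMat D (expI θ))ᴴ * (expI θ ^ N • evalMat R (expI θ))) a b := fun a b =>
    (((continuous_evalMat D).matrix_conjTranspose).matrix_mul
      ((continuous_expI.pow N).smul (continuous_evalMat R))).matrix_elem a b
  simp_rw [e]
  have hs : ∫ θ, star (((evalMat D (expI θ))ᴴ * (expI θ ^ N • evalMat R (expI θ))) b a) ∂lam0 =
      0 := by
    have := integral_star_pow_mul_star (f := fun θ =>
      ((evalMat D (expI θ))ᴴ * (expI θ ^ N • evalMat R (expI θ))) b a) 0
    simp only [pow_zero, one_mul] at this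
    rw [this, integral_star_polynomial_mul hD, star_zero]
  have hi : Integrable (fun θ => (1 / 2 : ℂ) *
      (((evalMat D (expI θ))ᴴ * (expI θ ^ N • evalMat R (expI θ))) a b +
        star (((evalMat D (expI θ))ᴴ * (expI θ ^ N • evalMat R (expI θ))) b a))) lam0 :=
    continuous_integrable (continuous_const.mul ((hc a b).add (hc b a).star)) _
  rw [integral_add (integrable_const _) hi, integral_const_mul,
    integral_add (continuous_integrable (hc a b) _) (continuous_integrable (hc b a).star _), hs,
    integral_star_polynomial_mul hD]
  simp

theorem differentiableOn_mul_inv (R D : Polynomial (Mat p)) (i j : Fin p) :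
    DifferentiableOn ℂ (fun z => (evalMat R z * (evalMat D z)⁻¹) i j)
      {z | (evalMat D z).det ≠ 0} := by
  set q := matPolyEquiv.symm D
  have e : ∀ z k j, (evalMat D z)⁻¹ k j = (q.det.eval z)⁻¹ * (q.adjugate k j).eval z := by
    intro z k j
    have e1 : evalMat D z = (Polynomial.evalRingHom z).mapMatrix q := by
      ext i j; exact evalMat_apply D z i j
    rw [Matrix.inv_def, Ring.inverse_eq_inv', Matrix.smul_apply, det_evalMat, smul_eq_mul, e1,
      ← RingHom.map_adjugate]
    rfl
  simp_rw [Matrix.mul_apply, e, evalMat_apply]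
  refine DifferentiableOn.fun_sum fun k _ => ?_
  refine (Polynomial.differentiable _).differentiableOn.mul
    ((DifferentiableOn.inv (Polynomial.differentiable _).differentiableOn fun z hz => ?_).mul
      (Polynomial.differentiable _).differentiableOn)
  rw [← det_evalMat]
  exact hz

/-- The Bernstein–Szegő weight `(D D†)⁻¹`. -/
noncomputable def szegoWeight (D : Polynomial (Mat p)) (θ : UCircle) : Mat p :=
  (evalMat D (expI θ) * (evalMat D (expI θ))ᴴ)⁻¹

theorem continuous_inv_evalMat {D : Polynomial (Mat p)}
    (hD : ∀ z : ℂ, ‖z‖ ≤ 1 → (evalMat D z).det ≠ 0) :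
    Continuous fun θ => (evalMat D (expI θ))⁻¹ := by
  simp_rw [Matrix.inv_def, Ring.inverse_eq_inv']
  exact ((continuous_evalMat D).matrix_det.inv₀ fun θ => hD _ (norm_expI θ).le).smul
    (continuous_evalMat D).matrix_adjugate

theorem szegoWeight_eq (D : Polynomial (Mat p)) (θ : UCircle) :
    szegoWeight D θ = ((evalMat D (expI θ))⁻¹)ᴴ * (evalMat D (expI θ))⁻¹ := by
  rw [szegoWeight, Matrix.mul_inv_rev, Matrix.conjTranspose_nonsing_inv]

theorem continuous_szegoWeight {D : Polynomial (Mat p)}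
    (hD : ∀ z : ℂ, ‖z‖ ≤ 1 → (evalMat D z).det ≠ 0) : Continuous (szegoWeight D) := by
  have e : szegoWeight D = fun θ => ((evalMat D (expI θ))⁻¹)ᴴ * (evalMat D (expI θ))⁻¹ :=
    funext fun θ => szegoWeight_eq D θ
  rw [e]
  exact (continuous_inv_evalMat hD).matrix_conjTranspose.matrix_mul (continuous_inv_evalMat hD)

theorem szegoWeight_isHermitian (D : Polynomial (Mat p)) (θ : UCircle) :
    (szegoWeight D θ).IsHermitian := by
  rw [szegoWeight_eq]
  exact Matrix.isHermitian_conjTranspose_mul_self _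

/-- The moments of the Bernstein–Szegő weight. -/
theorem moment_szegoWeight {T D E R : Polynomial (Mat p)} {N : ℕ}
    (hD : ∀ z : ℂ, ‖z‖ ≤ 1 → (evalMat D z).det ≠ 0)
    (hR : ∀ z, evalMat T z * evalMat D z - evalMat E z = z ^ (N + 1) • evalMat R z)
    (hK : ∀ z : ℂ, ‖z‖ = 1 → (evalMat D z)ᴴ * evalMat E z + (evalMat E z)ᴴ * evalMat D z =
      (2 : ℂ) • 1) {k : ℕ} (hk : k ≤ N) :
    moment lam0 (szegoWeight D) k = moment lam0 (realPart fun θ => evalMat T (expI θ)) k := by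
  have hU : Metric.closedBall (0 : ℂ) 1 ⊆ {z | (evalMat D z).det ≠ 0} := fun z hz =>
    hD z (by simpa using hz)
  have hc : Continuous fun θ => expI θ ^ (N + 1) •
      (evalMat R (expI θ) * (evalMat D (expI θ))⁻¹) :=
    (continuous_expI.pow _).smul ((continuous_evalMat R).matrix_mul (continuous_inv_evalMat hD))
  -- T = ED⁻¹ + z^{N+1}RD⁻¹, and the real part of ED⁻¹ is (DD†)⁻¹. As D is invertible on the closed
  -- disc, the second term is analytic there with a zero of order N + 1, hence invisible to moments
  -- up to N.
  have e : ∀ θ, realPart (fun θ => evalMat T (expI θ)) θ = szegoWeight D θ +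
      realPart (fun θ => expI θ ^ (N + 1) • (evalMat R (expI θ) * (evalMat D (expI θ))⁻¹)) θ := by
    intro θ
    have h1 := hR (expI θ)
    have h2 := hK (expI θ) (norm_expI θ)
    have hu : IsUnit (evalMat D (expI θ)).det := isUnit_iff_ne_zero.2 (hD _ (norm_expI θ).le)
    rw [szegoWeight_eq, realPart, realPart, ← Matrix.smul_mul, ← h1]
    have h2' := congrArg (fun A => ((evalMat D (expI θ))⁻¹)ᴴ * A * (evalMat D (expI θ))⁻¹) h2
    set T' := evalMat T (expI θ)
    set D' := evalMat D (expI θ)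
    set E' := evalMat E (expI θ)
    have i1 : D' * D'⁻¹ = 1 := Matrix.mul_nonsing_inv _ hu
    have i2 : (D'⁻¹)ᴴ * D'ᴴ = 1 := by rw [← Matrix.conjTranspose_mul, i1, Matrix.conjTranspose_one]
    have h3 : E' * D'⁻¹ + (E' * D'⁻¹)ᴴ = (2 : ℂ) • ((D'⁻¹)ᴴ * D'⁻¹) := by
      have l : (D'⁻¹)ᴴ * (D'ᴴ * E' + E'ᴴ * D') * D'⁻¹ =
          ((D'⁻¹)ᴴ * D'ᴴ) * E' * D'⁻¹ + (D'⁻¹)ᴴ * E'ᴴ * (D' * D'⁻¹) := by noncomm_ring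
      simp only [l, i1, i2] at h2'
      rw [Matrix.conjTranspose_mul]
      simpa using h2'
    have h4 : (T' * D' - E') * D'⁻¹ = T' - E' * D'⁻¹ := by
      rw [sub_mul, mul_assoc, i1, mul_one]
    have h5 : (D'⁻¹)ᴴ * D'⁻¹ = (1 / 2 : ℂ) • (E' * D'⁻¹ + (E' * D'⁻¹)ᴴ) := by
      rw [h3, smul_smul]; norm_num
    rw [h5, ← smul_add, h4, Matrix.conjTranspose_sub]
    congr 1
    abel
  have hz : moment lam0 (realPart fun θ =>
      expI θ ^ (N + 1) • (evalMat R (expI θ) * (evalMat D (expI θ))⁻¹)) k = 0 := by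
    ext i j
    rw [moment_realPart hc]
    simp only [Matrix.smul_apply, smul_eq_mul]
    rw [integral_star_expI_pow_mul (differentiableOn_mul_inv R D i j) hU (by omega : k < N + 1)]
    simp_rw [← mul_assoc, ← pow_add]
    rw [integral_expI_pow_mul (differentiableOn_mul_inv R D j i) hU (by omega)]
    simp
  ext i j
  have hz' := congrFun (congrFun hz i) j
  simp only [moment, Matrix.of_apply, Matrix.zero_apply] at hz' ⊢
  simp_rw [e, Matrix.add_apply, mul_add]
  rw [integral_add, hz', add_zero]
  · exact continuous_integrable
      ((continuous_expI.star.pow k).mul ((continuous_szegoWeight hD).matrix_elem i j)) _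
  · exact continuous_integrable
      ((continuous_expI.star.pow k).mul ((continuous_realPart hc).matrix_elem i j)) _

end TrigonometricWeights

/-! ### Non-triviality, strict contractivity and orthonormality. -/

section Orthogonality

variable {p : ℕ} {μ : MatMeasure p} {τ : Measure UCircle} {M : UCircle → Mat p}

theorem Represents.integrable (h : Represents μ τ M) (i j : Fin p) :
    Integrable (fun θ => M θ i j) τ :=
  have := h.finite
  Integrable.of_bound (h.measurable i j).aestronglyMeasurable 1
    (.of_forall fun θ => h.norm_le θ i j)

theorem Represents.moment_zero (h : Represents μ τ M) : moment τ M 0 = 1 := by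
  ext i j
  rw [moment, Matrix.of_apply, ← h.integral_eq]
  simp

theorem Represents.innerR_apply (h : Represents μ τ M) (f g : Polynomial (Mat p)) (a b : Fin p) :
    innerR μ f g a b = ∫ θ, ((evalMat f (expI θ))ᴴ * M θ * evalMat g (expI θ)) a b ∂τ := by
  rw [integral_sandwich_apply (continuous_evalMat f) (continuous_evalMat g) h.integrable,
    Finset.sum_comm, innerR, Matrix.of_apply]
  refine Finset.sum_congr rfl fun i _ => Finset.sum_congr rfl fun j _ => ?_
  rw [h.entryIntegral_eq]
  · rfl
  · exact ((continuous_evalMat f).matrix_elem i a).star.mul ((continuous_evalMat g).matrix_elem j b)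

theorem posDef_of_trace_pos {G : Mat p} (hG : G.IsHermitian)
    (h : ∀ B : Mat p, B ≠ 0 → 0 < (Bᴴ * G * B).trace) : G.PosDef := by
  refine Matrix.PosDef.of_dotProduct_mulVec_pos hG fun x hx => ?_
  obtain ⟨i₀, hi⟩ := Function.ne_iff.1 hx
  -- With x as its only nonzero column, this matrix turns the trace into the form of G at x.
  have hB : (Matrix.of fun i j => if j = i₀ then x i else 0 : Mat p) ≠ 0 := fun h0 => hi (by
    simpa using congrFun (congrFun h0 i₀) i₀)
  have h1 := h _ hB
  have h2 : ∀ j, ((Matrix.of fun i j => if j = i₀ then x i else 0 : Mat p)ᴴ * G *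
      (Matrix.of fun i j => if j = i₀ then x i else 0 : Mat p)) j j =
      if j = i₀ then star x ⬝ᵥ G *ᵥ x else 0 := by
    intro j
    rw [sandwich_apply]
    by_cases hj : j = i₀
    · simp only [hj, Matrix.of_apply, if_true, dotProduct, Matrix.mulVec, Finset.mul_sum]
      rw [Finset.sum_comm]
      refine Finset.sum_congr rfl fun i _ => Finset.sum_congr rfl fun k _ => ?_
      rw [Pi.star_apply]
      ring
    · simp [hj]
  rw [Matrix.trace] at h1
  simpa [h2] using h1

/-- Terminating the recursion with a = α_n uses only the earlier contractions, and the form of μ at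
the resulting D is 1 - a†a. Non-triviality applied to the nonzero polynomials DB makes it positive
definite. -/
theorem posDef_one_sub_verblunsky (h : Represents μ τ M) (hnt : IsNontrivial μ) (n : ℕ) :
    (1 - (verblunsky μ n)ᴴ * verblunsky μ n).PosDef := by
  induction n using Nat.strong_induction_on with
  | _ n ih =>
    set a := verblunsky μ n with ha
    obtain ⟨R, hR⟩ := exists_caratheodoryPoly_mul_szegoPoly h n ih a 1 (Or.inr ⟨rfl, ha⟩)
    set D := szegoPoly (verblunsky μ) a n with hDdef
    have hdeg : ∀ m, n + 1 + 1 ≤ m → D.coeff m = 0 :=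
      szegoPoly_coeff_eq_zero (e := 1) le_rfl
        (fun m hm => Polynomial.coeff_C_of_ne_zero (by omega)) n
    have hD0 : IsUnit (D.coeff 0).det := by
      rw [hDdef, szegoPoly_coeff_zero]
      exact isUnit_det_schurDen_coeff_zero n 0 fun j _ hj => ih j (by omega)
    have hform : ∀ i j, ∫ θ, ((evalMat D (expI θ))ᴴ * M θ * evalMat D (expI θ)) i j ∂τ =
        (1 - aᴴ * a) i j := by
      intro i j
      have hc := continuous_realPart (continuous_evalMat (caratheodoryPoly (moment τ M) (n + 1)))
      rw [integral_sandwich_eq_of_moment_eq (ν₂ := lam0) h.integrable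
        (fun i j => continuous_integrable (hc.matrix_elem i j) _) (fun θ => (h.posSemidef θ).1)
        (realPart_isHermitian _)
        (fun k hk => (moment_realPart_caratheodoryPoly h.moment_zero hk).symm) hdeg hdeg,
        integral_sandwich_realPart hdeg hR fun z hz => szegoPoly_defect_circle n ih hz]
    refine posDef_of_trace_pos
      (Matrix.isHermitian_one.sub (Matrix.isHermitian_conjTranspose_mul_self a)) fun B hB => ?_
    have hf : D * Polynomial.C B ≠ 0 := by
      intro h0
      have h1 := congrArg (fun f => (D.coeff 0)⁻¹ * Polynomial.coeff f 0) h0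
      simp only [Polynomial.coeff_mul_C, Polynomial.coeff_zero, mul_zero] at h1
      rw [← mul_assoc, Matrix.nonsing_inv_mul _ hD0, one_mul] at h1
      exact hB h1
    have := hnt _ hf
    convert this using 2
    ext i j
    rw [h.innerR_apply]
    simp_rw [evalMat_mul, evalMat_C]
    have e : ∀ θ, (evalMat D (expI θ) * B)ᴴ * M θ * (evalMat D (expI θ) * B) =
        Bᴴ * ((evalMat D (expI θ))ᴴ * M θ * evalMat D (expI θ)) * B := fun θ => by
      rw [Matrix.conjTranspose_mul]; noncomm_ring
    simp_rw [e]
    rw [integral_sandwich_apply continuous_const continuous_const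
      (integrable_sandwich_apply (continuous_evalMat D) (continuous_evalMat D) h.integrable),
      sandwich_apply]
    simp_rw [integral_const_mul, hform]

/-- The quadratic forms of the measure and of its Bernstein–Szegő approximation agree on
polynomials of degree at most `n`. -/
theorem integral_sandwich_szegoWeight (h : Represents μ τ M) (hnt : IsNontrivial μ) (n : ℕ)
    {P : Polynomial (Mat p)}
    (hP : ∀ m, n + 1 ≤ m → P.coeff m = 0) (a b : Fin p) :
    ∫ θ, ((evalMat P (expI θ))ᴴ * M θ * evalMat P (expI θ)) a b ∂τ =
      ∫ θ, ((evalMat P (expI θ))ᴴ * szegoWeight (szegoPoly (verblunsky μ) 0 n) θ *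
        evalMat P (expI θ)) a b ∂lam0 := by
  have hpd := posDef_one_sub_verblunsky h hnt
  have hdet : ∀ z : ℂ, ‖z‖ ≤ 1 → (evalMat (szegoPoly (verblunsky μ) 0 n) z).det ≠ 0 :=
    fun z hz => det_szegoPoly_ne_zero n (fun j _ => hpd j) hz
  obtain ⟨R, hR⟩ := exists_caratheodoryPoly_mul_szegoPoly h n (fun j _ => hpd j) 0 0 (Or.inl rfl)
  refine integral_sandwich_eq_of_moment_eq (ν₂ := lam0) h.integrable
    (fun i j => continuous_integrable ((continuous_szegoWeight hdet).matrix_elem i j) _)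
    (fun θ => (h.posSemidef θ).1) (szegoWeight_isHermitian _) (fun k hk => ?_) hP hP a b
  rw [add_zero] at hR
  rw [moment_szegoWeight hdet hR (fun z hz => ?_) hk,
    moment_realPart_caratheodoryPoly h.moment_zero hk]
  rw [szegoPoly_defect_circle n (fun j _ => hpd j) hz]
  simp

/-- D has degree at most n, so μ may be replaced by the weight (DD†)⁻¹, for which D†(DD†)⁻¹D = 1
pointwise. -/
theorem integral_trace_szegoPoly (h : Represents μ τ M) (hnt : IsNontrivial μ) (n : ℕ) (a : Fin p) :
    ∫ θ, ((evalMat (szegoPoly (verblunsky μ) 0 n) (expI θ))ᴴ * M θ *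
      evalMat (szegoPoly (verblunsky μ) 0 n) (expI θ)) a a ∂τ = 1 := by
  have hpd := posDef_one_sub_verblunsky h hnt
  rw [integral_sandwich_szegoWeight h hnt n
    (szegoPoly_coeff_eq_zero (e := 0) (by omega) (fun m _ => by simp) n)]
  have e : ∀ θ, (evalMat (szegoPoly (verblunsky μ) 0 n) (expI θ))ᴴ *
      szegoWeight (szegoPoly (verblunsky μ) 0 n) θ *
        evalMat (szegoPoly (verblunsky μ) 0 n) (expI θ) = 1 := by
    intro θ
    have hu := isUnit_iff_ne_zero.2 (det_szegoPoly_ne_zero n (fun j _ => hpd j) (norm_expI θ).le)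
    rw [szegoWeight_eq, ← mul_assoc, ← Matrix.conjTranspose_mul, Matrix.nonsing_inv_mul _ hu,
      mul_assoc, Matrix.nonsing_inv_mul _ hu]
    simp
  simp_rw [e]
  simp

end Orthogonality

/-! ### The absolutely continuous part and the finiteness of the entropy. -/

section Density

variable {p : ℕ} {μ : MatMeasure p} {τ σ : Measure UCircle} {M : UCircle → Mat p}

/-- The density with respect to `σ` of the matrix measure `M τ`. -/
noncomputable def acDensity (τ σ : Measure UCircle) (M : UCircle → Mat p) (θ : UCircle) : Mat p :=
  ((τ.rnDeriv σ θ).toReal : ℂ) • M θ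

theorem Represents.acDensity_posSemidef (h : Represents μ τ M) (σ : Measure UCircle)
    (θ : UCircle) : (acDensity τ σ M θ).PosSemidef :=
  (h.posSemidef θ).smul (by exact_mod_cast ENNReal.toReal_nonneg)

theorem Represents.measurable_acDensity (h : Represents μ τ M) (σ : Measure UCircle)
    (i j : Fin p) : Measurable fun θ => acDensity τ σ M θ i j :=
  (Complex.measurable_ofReal.comp (Measure.measurable_rnDeriv τ σ).ennreal_toReal).mul
    (h.measurable i j)

theorem measurable_det {A : UCircle → Mat p} (hA : ∀ i j, Measurable fun θ => A θ i j) :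
    Measurable fun θ => (A θ).det := by
  simp only [Matrix.det_apply, Units.smul_def, zsmul_eq_mul]
  exact Finset.measurable_sum _ fun s _ =>
    measurable_const.mul (Finset.measurable_prod _ fun i _ => hA _ _)

theorem measurable_trace {A : UCircle → Mat p} (hA : ∀ i j, Measurable fun θ => A θ i j) :
    Measurable fun θ => (A θ).trace :=
  Finset.measurable_sum _ fun i _ => hA i i

/-- Discarding the singular part can only decrease the integral of a nonnegative function. -/
theorem setIntegral_rnDeriv_mul_le [IsFiniteMeasure τ] [IsFiniteMeasure σ] {t : UCircle → ℝ}
    (ht : Measurable t) (h0 : ∀ θ, 0 ≤ t θ) (hi : Integrable t τ) :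
    Integrable (fun θ => (τ.rnDeriv σ θ).toReal * t θ) σ ∧
      ∫ θ, (τ.rnDeriv σ θ).toReal * t θ ∂σ ≤ ∫ θ, t θ ∂τ := by
  have hm := Measure.measurable_rnDeriv τ σ
  have h1 : ∫⁻ θ, ENNReal.ofReal ((τ.rnDeriv σ θ).toReal * t θ) ∂σ ≤
      ∫⁻ θ, ENNReal.ofReal (t θ) ∂τ := by
    calc _ ≤ ∫⁻ θ, τ.rnDeriv σ θ * ENNReal.ofReal (t θ) ∂σ := by
          refine lintegral_mono fun θ => ?_
          rw [ENNReal.ofReal_mul ENNReal.toReal_nonneg]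
          gcongr
          exact ENNReal.ofReal_toReal_le
      _ = ∫⁻ θ, ENNReal.ofReal (t θ) ∂(σ.withDensity (τ.rnDeriv σ)) := by
          rw [lintegral_withDensity_eq_lintegral_mul _ hm ht.ennreal_ofReal]
          rfl
      _ ≤ _ := lintegral_mono' (Measure.withDensity_rnDeriv_le τ σ) le_rfl
  have hnn : ∀ θ, 0 ≤ (τ.rnDeriv σ θ).toReal * t θ := fun θ =>
    mul_nonneg ENNReal.toReal_nonneg (h0 θ)
  have hmeas : Measurable fun θ => (τ.rnDeriv σ θ).toReal * t θ := hm.ennreal_toReal.mul ht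
  have hτ : ∫⁻ θ, ENNReal.ofReal (t θ) ∂τ ≠ ⊤ := by
    rw [← ofReal_integral_eq_lintegral_ofReal hi (.of_forall h0)]
    exact ENNReal.ofReal_ne_top
  refine ⟨⟨hmeas.aestronglyMeasurable, ?_⟩, ?_⟩
  · rw [hasFiniteIntegral_iff_ofReal (.of_forall hnn)]
    exact h1.trans_lt hτ.lt_top
  · rw [integral_eq_lintegral_of_nonneg_ae (.of_forall hnn) hmeas.aestronglyMeasurable,
      integral_eq_lintegral_of_nonneg_ae (.of_forall h0) ht.aestronglyMeasurable]
    exact ENNReal.toReal_mono hτ h1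

theorem Represents.acDensity_trace (θ : UCircle) :
    (acDensity τ σ M θ).trace.re = (τ.rnDeriv σ θ).toReal * (M θ).trace.re := by
  rw [acDensity, Matrix.trace_smul, smul_eq_mul, Complex.re_ofReal_mul]

theorem Represents.integrable_trace (h : Represents μ τ M) [IsFiniteMeasure σ] :
    Integrable (fun θ => (acDensity τ σ M θ).trace.re) σ := by
  have := h.finite
  simp_rw [Represents.acDensity_trace]
  refine (setIntegral_rnDeriv_mul_le (t := fun θ => (M θ).trace.re)
    (Complex.measurable_re.comp (measurable_trace h.measurable))
    (fun θ => posSemidef_trace_re_nonneg (h.posSemidef θ)) ?_).1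
  exact (integrable_finsetSum _ fun i _ => h.integrable i i).re

/-- The positive part of `-log d`, equal to `∞` for `d ≤ 0`. -/
noncomputable def negLogPart (d : ℝ) : ENNReal :=
  (-ENNReal.log (ENNReal.ofReal d)).toENNReal

theorem negLogPart_of_pos {d : ℝ} (hd : 0 < d) :
    negLogPart d = ENNReal.ofReal (-Real.log d) := by
  rw [negLogPart, ENNReal.log_ofReal_of_pos hd, ← EReal.coe_neg, EReal.real_coe_toENNReal]

theorem negLogPart_of_nonpos {d : ℝ} (hd : d ≤ 0) : negLogPart d = ⊤ := by
  rw [negLogPart, ENNReal.log_ofReal, if_pos hd, EReal.neg_bot, EReal.toENNReal_top]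

/-- The subtracted integral is finite because log det h ≤ tr h - p with tr h integrable, so
finiteness depends on the positive part of -log det h alone. -/
theorem relEntropy_lt_top_iff (h : Represents μ τ M) [IsFiniteMeasure σ]
    (hd : ∀ᵐ θ ∂σ, density μ σ θ = acDensity τ σ M θ) :
    relEntropy σ μ < ⊤ ↔ ∫⁻ θ, negLogPart (acDensity τ σ M θ).det.re ∂σ ≠ ⊤ := by
  have e1 : ∫⁻ θ, (negLogDet μ σ θ).toENNReal ∂σ =
      ∫⁻ θ, negLogPart (acDensity τ σ M θ).det.re ∂σ :=
    lintegral_congr_ae (hd.mono fun θ hθ => by simp only [negLogDet, hθ, negLogPart])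
  have e2 : ∫⁻ θ, (-negLogDet μ σ θ).toENNReal ∂σ ≠ ⊤ := by
    have hi := h.integrable_trace (σ := σ)
    refine ne_top_of_le_ne_top (b := ∫⁻ θ, ENNReal.ofReal (acDensity τ σ M θ).trace.re ∂σ) ?_
      (lintegral_mono_ae (hd.mono fun θ hθ => ?_))
    · rw [← ofReal_integral_eq_lintegral_ofReal hi (.of_forall fun θ =>
        posSemidef_trace_re_nonneg (h.acDensity_posSemidef σ θ))]
      exact ENNReal.ofReal_ne_top
    · rw [negLogDet, neg_neg, hθ]
      rcases le_or_gt (acDensity τ σ M θ).det.re 0 with h0 | h0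
      · rw [ENNReal.log_ofReal, if_pos h0, EReal.toENNReal_bot]
        exact zero_le
      · rw [ENNReal.log_ofReal_of_pos h0, EReal.real_coe_toENNReal]
        refine ENNReal.ofReal_le_ofReal
          ((log_det_le_trace_sub (h.acDensity_posSemidef σ θ) h0).trans ?_)
        have : (0 : ℝ) ≤ p := p.cast_nonneg
        linarith
  rw [relEntropy, e1]
  generalize ∫⁻ θ, (-negLogDet μ σ θ).toENNReal ∂σ = b at e2 ⊢
  lift b to NNReal using e2
  cases ∫⁻ θ, negLogPart (acDensity τ σ M θ).det.re ∂σ with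
  | top => simp
  | coe a =>
    simp only [ne_eq, ENNReal.coe_ne_top, not_false_eq_true, iff_true]
    exact EReal.coe_lt_top _

end Density

/-! ### Finite entropy bounds the Szegő integrals. -/

section EntropyBound

variable {p : ℕ} {μ : MatMeasure p} {τ : Measure UCircle} {M : UCircle → Mat p}

/-- The logarithmic integral of the `n`-th Szegő polynomial. -/
noncomputable def szegoSum (α : ℕ → Mat p) (g : ℝ) (n : ℕ) : ℝ :=
  ∫ θ, 2 * Real.log ‖(evalMat (szegoPoly α 0 n) (expI θ)).det‖ ∂(lam g)

theorem continuous_log_norm_det {D : Polynomial (Mat p)}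
    (hD : ∀ z : ℂ, ‖z‖ ≤ 1 → (evalMat D z).det ≠ 0) :
    Continuous fun θ => 2 * Real.log ‖(evalMat D (expI θ)).det‖ :=
  continuous_const.mul ((continuous_evalMat D).matrix_det.norm.log
    fun θ => norm_ne_zero_iff.2 (hD _ (norm_expI θ).le))

theorem det_sandwich_self (D X : Mat p) : (Dᴴ * X * D).det = ((‖D.det‖ ^ 2 : ℝ) : ℂ) * X.det := by
  rw [Matrix.det_mul, Matrix.det_mul, Matrix.det_conjTranspose, mul_right_comm,
    Complex.star_def, mul_comm (starRingEnd ℂ _), Complex.mul_conj, Complex.normSq_eq_norm_sq]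

/-- Finite entropy bounds the logarithmic integrals of the Szegő polynomials. -/
theorem szegoSum_le_of_entropy (h : Represents μ τ M) (hnt : IsNontrivial μ) {g : ℝ}
    (hg : |g| ≤ 1)
    (hfin : ∫⁻ θ, negLogPart (acDensity τ (lam g) M θ).det.re ∂(lam g) ≠ ⊤) (n : ℕ) :
    szegoSum (verblunsky μ) g n ≤
      -∫ θ, Real.log (acDensity τ (lam g) M θ).det.re ∂(lam g) := by
  have := h.finite
  have := isProbabilityMeasure_lam hg
  set σ := lam g
  set H := acDensity τ σ M
  set D := szegoPoly (verblunsky μ) 0 n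
  have hHm := h.measurable_acDensity σ
  have hdm : Measurable fun θ => (H θ).det.re := Complex.measurable_re.comp (measurable_det hHm)
  have hHp := h.acDensity_posSemidef σ
  have hdet : ∀ z : ℂ, ‖z‖ ≤ 1 → (evalMat D z).det ≠ 0 := fun z hz =>
    det_szegoPoly_ne_zero n (fun j _ => posDef_one_sub_verblunsky h hnt j) hz
  have hmeas : Measurable fun θ => negLogPart (H θ).det.re := by
    unfold negLogPart
    exact (hdm.ennreal_ofReal.ennreal_log).neg.ereal_toENNReal
  have hpos : ∀ᵐ θ ∂σ, 0 < (H θ).det.re := by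
    filter_upwards [ae_lt_top hmeas hfin] with θ hθ
    by_contra hle
    rw [negLogPart_of_nonpos (not_lt.1 hle)] at hθ
    exact lt_irrefl _ hθ
  -- Finite entropy controls log det h from below and the trace controls it from above.
  have hlog : Integrable (fun θ => Real.log (H θ).det.re) σ := by
    have i1 : Integrable (fun θ => (negLogPart (H θ).det.re).toReal + (H θ).trace.re) σ :=
      (integrable_toReal_of_lintegral_ne_top hmeas.aemeasurable hfin).add h.integrable_trace
    refine i1.mono' (Real.measurable_log.comp hdm).aestronglyMeasurable (hpos.mono fun θ hθ => ?_)
    have h1 := log_det_le_trace_sub (hHp θ) hθ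
    have h2 := posSemidef_trace_re_nonneg (hHp θ)
    have hp : (0 : ℝ) ≤ p := p.cast_nonneg
    rw [negLogPart_of_pos hθ, ENNReal.toReal_ofReal', Real.norm_eq_abs, abs_le]
    constructor
    · linarith [le_max_left (-Real.log (H θ).det.re) 0]
    · linarith [le_max_right (-Real.log (H θ).det.re) 0]
  set t : UCircle → ℝ := fun θ => ((evalMat D (expI θ))ᴴ * M θ * evalMat D (expI θ)).trace.re
  have hti : ∀ i, Integrable
      (fun θ => ((evalMat D (expI θ))ᴴ * M θ * evalMat D (expI θ)) i i) τ := fun i =>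
    integrable_sandwich_apply (continuous_evalMat D) (continuous_evalMat D) h.integrable i i
  have htm : Measurable t := by
    refine Complex.measurable_re.comp (Finset.measurable_sum _ fun a _ => ?_)
    simp only [Matrix.diag_apply, sandwich_apply]
    refine Finset.measurable_sum _ fun j _ => Finset.measurable_sum _ fun i _ => ?_
    exact ((((continuous_evalMat D).matrix_elem i a).star.mul
      ((continuous_evalMat D).matrix_elem j a)).measurable).mul (h.measurable i j)
  have htint : Integrable t τ := (integrable_finsetSum _ fun i _ => hti i).re
  have ht1 : ∫ θ, t θ ∂τ = p := by
    have h1 : ∫ θ, t θ ∂τ = (∫ θ, ∑ i, ((evalMat D (expI θ))ᴴ * M θ *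
        evalMat D (expI θ)) i i ∂τ).re :=
      integral_re (integrable_finsetSum Finset.univ fun i _ => hti i)
    rw [h1, integral_finsetSum _ fun i _ => hti i]
    simp [D, integral_trace_szegoPoly h hnt n]
  obtain ⟨hri, hrle⟩ := setIntegral_rnDeriv_mul_le (σ := σ) htm (fun θ =>
    posSemidef_trace_re_nonneg ((h.posSemidef θ).conjTranspose_mul_mul_same _)) htint
  -- This is log det ≤ tr - p for D†hD. On integration the right side is at most 0, since the trace
  -- integral for μ is p and the absolutely continuous part contributes no more.
  have key : ∀ᵐ θ ∂σ, 2 * Real.log ‖(evalMat D (expI θ)).det‖ + Real.log (H θ).det.re ≤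
      (τ.rnDeriv σ θ).toReal * t θ - p := by
    filter_upwards [hpos] with θ hθ
    have hn : 0 < ‖(evalMat D (expI θ)).det‖ := norm_pos_iff.2 (hdet _ (norm_expI θ).le)
    have e := det_sandwich_self (evalMat D (expI θ)) (H θ)
    have e' : ((evalMat D (expI θ))ᴴ * H θ * evalMat D (expI θ)).det.re =
        ‖(evalMat D (expI θ)).det‖ ^ 2 * (H θ).det.re := by rw [e, Complex.re_ofReal_mul]
    have h1 := log_det_le_trace_sub ((hHp θ).conjTranspose_mul_mul_same (evalMat D (expI θ)))
      (by rw [e']; positivity)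
    rw [e', Real.log_mul (by positivity) hθ.ne', Real.log_pow] at h1
    have e2 : ((evalMat D (expI θ))ᴴ * H θ * evalMat D (expI θ)).trace.re =
        (τ.rnDeriv σ θ).toReal * t θ := by
      simp only [H, acDensity, t]
      rw [Matrix.mul_smul, Matrix.smul_mul, Matrix.trace_smul, smul_eq_mul, Complex.re_ofReal_mul]
    rw [e2] at h1
    exact_mod_cast h1
  have hc := continuous_integrable (continuous_log_norm_det hdet) σ
  have := integral_mono_ae (hc.add hlog) (hri.sub (integrable_const (p : ℝ))) key
  simp only [Pi.add_apply, Pi.sub_apply] at this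
  rw [integral_add hc hlog, integral_sub hri (integrable_const _), integral_const] at this
  simp only [probReal_univ, one_smul] at this
  rw [szegoSum]
  linarith

end EntropyBound

/-! ### The variational inequality for polynomial test matrices. -/

section PolynomialTest

variable {p : ℕ} {μ : MatMeasure p} {τ : Measure UCircle} {M : UCircle → Mat p}

theorem integral_trace_re {ν : Measure UCircle} {F : UCircle → Mat p}
    (hF : ∀ a, Integrable (fun θ => F θ a a) ν) :
    Integrable (fun θ => (F θ).trace.re) ν ∧
      ∫ θ, (F θ).trace.re ∂ν = (∑ a, ∫ θ, F θ a a ∂ν).re := by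
  have hs : Integrable (fun θ => (F θ).trace) ν := integrable_finsetSum Finset.univ fun a _ => hF a
  refine ⟨hs.re, ?_⟩
  rw [← integral_finsetSum _ fun a _ => hF a]
  exact integral_re hs

theorem trace_scalar_add_mul (c : ℝ) (P W : Mat p) :
    (((c : ℂ) • (1 : Mat p) + P * Pᴴ) * W).trace.re = c * W.trace.re + (Pᴴ * W * P).trace.re := by
  rw [add_mul, Matrix.trace_add, Complex.add_re, Matrix.smul_mul, one_mul, Matrix.trace_smul,
    smul_eq_mul, Complex.re_ofReal_mul, mul_assoc P, Matrix.trace_mul_comm P]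

theorem posDef_smul_one {c : ℝ} (hc : 0 < c) : ((c : ℂ) • (1 : Mat p)).PosDef :=
  Matrix.PosDef.one.smul (by exact_mod_cast hc)

theorem posDef_smul_one_add {c : ℝ} (hc : 0 < c) {A : Mat p} (hA : A.PosSemidef) :
    ((c : ℂ) • (1 : Mat p) + A).PosDef :=
  (posDef_smul_one hc).add_posSemidef hA

theorem mul_log_le {u : ℝ} (h0 : 0 < u) (h2 : u ≤ 2) : u * Real.log u ≤ 2 * Real.log 2 := by
  have h3 := Real.log_le_log h0 h2
  have h4 := Real.log_pos (by norm_num : (1 : ℝ) < 2)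
  rcases le_total (Real.log u) 0 with h | h
  · nlinarith
  · exact mul_le_mul h2 h3 h (by norm_num)

/-- Gibbs' inequality for A and X = u⁻¹(DD†)⁻¹, the density relative to λ_g when u is its weight,
multiplied by u. The leftover p u log u is bounded since u ≤ 2. Where u = 0, possible for g = ±1,
the right side is merely nonnegative. -/
theorem mul_log_det_le {A D : Mat p} (hA : A.PosDef) (hD : D.det ≠ 0) {u : ℝ} (h0 : 0 ≤ u)
    (h2 : u ≤ 2) (htr : 0 ≤ (A * (D * Dᴴ)⁻¹).trace.re) :
    u * Real.log A.det.re ≤ u * (2 * Real.log ‖D.det‖) + p * (2 * Real.log 2) +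
      (A * (D * Dᴴ)⁻¹).trace.re := by
  have h4 := Real.log_pos (by norm_num : (1 : ℝ) < 2)
  have hp : (0 : ℝ) ≤ p := p.cast_nonneg
  rcases h0.eq_or_lt with rfl | h0
  · have : 0 ≤ p * (2 * Real.log 2) := by positivity
    linarith
  · have hW : (D * Dᴴ)⁻¹.PosSemidef := (Matrix.posSemidef_self_mul_conjTranspose D).inv
    have hn : 0 < ‖D.det‖ := norm_pos_iff.2 hD
    have hX : (((u⁻¹ : ℝ) : ℂ) • (D * Dᴴ)⁻¹).PosSemidef :=
      hW.smul (by exact_mod_cast (inv_pos.2 h0).le)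
    have hdet : (((u⁻¹ : ℝ) : ℂ) • (D * Dᴴ)⁻¹).det =
        ((u⁻¹ ^ p * (‖D.det‖ ^ 2)⁻¹ : ℝ) : ℂ) := by
      rw [Matrix.det_smul, Matrix.det_nonsing_inv, Ring.inverse_eq_inv', Matrix.det_mul,
        Matrix.det_conjTranspose, Complex.star_def, Complex.mul_conj, Complex.normSq_eq_norm_sq]
      simp
    have hG := log_det_add_log_det_le hA hX (by
      rw [hdet, Complex.ofReal_re]; positivity)
    rw [hdet, Complex.ofReal_re, Real.log_mul (by positivity) (by positivity), Real.log_pow,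
      Real.log_inv, Real.log_inv, Real.log_pow, Matrix.mul_smul, Matrix.trace_smul, smul_eq_mul,
      Complex.re_ofReal_mul] at hG
    have h5 := mul_le_mul_of_nonneg_left hG h0.le
    have h6 : u * (u⁻¹ * (A * (D * Dᴴ)⁻¹).trace.re - p) =
        (A * (D * Dᴴ)⁻¹).trace.re - u * p := by field_simp
    rw [h6] at h5
    have h7 := mul_le_mul_of_nonneg_left (mul_log_le h0 h2) hp
    push_cast at h5
    nlinarith [mul_nonneg h0.le hp]

theorem continuous_log_det {A : UCircle → Mat p} (hA : Continuous A) (h : ∀ θ, (A θ).PosDef) :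
    Continuous fun θ => Real.log (A θ).det.re :=
  (Complex.continuous_re.comp hA.matrix_det).log fun θ => (posDef_det_re_pos (h θ)).ne'

/-- The pointwise inequality is integrated with A = c + PP†. As P has degree at most n, the trace
integrals against the Bernstein–Szegő weight equal those against μ, which yields c p and the last
term. -/
theorem integral_log_det_le_of_polynomial (h : Represents μ τ M) (hnt : IsNontrivial μ) {g : ℝ}
    (hg : |g| ≤ 1) {c : ℝ} (hc : 0 < c) {n : ℕ} {P : Polynomial (Mat p)}
    (hP : ∀ m, n + 1 ≤ m → P.coeff m = 0) :
    ∫ θ, Real.log ((c : ℂ) • 1 + evalMat P (expI θ) * (evalMat P (expI θ))ᴴ).det.re ∂(lam g) ≤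
      szegoSum (verblunsky μ) g n + p * (2 * Real.log 2) + c * p +
        ∫ θ, ((evalMat P (expI θ))ᴴ * M θ * evalMat P (expI θ)).trace.re ∂τ := by
  have := h.finite
  set D := szegoPoly (verblunsky μ) 0 n with hDdef
  have hdet : ∀ z : ℂ, ‖z‖ ≤ 1 → (evalMat D z).det ≠ 0 := fun z hz =>
    det_szegoPoly_ne_zero n (fun j _ => posDef_one_sub_verblunsky h hnt j) hz
  have hwc := continuous_szegoWeight hdet
  have hwi : ∀ i j, Integrable (fun θ => szegoWeight D θ i j) lam0 := fun i j =>
    continuous_integrable (hwc.matrix_elem i j) _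
  have hPc := continuous_evalMat P
  obtain ⟨iτ, eτ⟩ := integral_trace_re (ν := τ)
    (F := fun θ => (evalMat P (expI θ))ᴴ * M θ * evalMat P (expI θ))
    fun a => integrable_sandwich_apply hPc hPc h.integrable a a
  obtain ⟨i0, e0⟩ := integral_trace_re (ν := lam0)
    (F := fun θ => (evalMat P (expI θ))ᴴ * szegoWeight D θ * evalMat P (expI θ))
    fun a => integrable_sandwich_apply hPc hPc hwi a a
  obtain ⟨i1, e1⟩ := integral_trace_re (ν := lam0) (F := szegoWeight D) fun a => hwi a a
  have f0 : ∫ θ, ((evalMat P (expI θ))ᴴ * szegoWeight D θ * evalMat P (expI θ)).trace.re ∂lam0 =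
      ∫ θ, ((evalMat P (expI θ))ᴴ * M θ * evalMat P (expI θ)).trace.re ∂τ := by
    rw [e0, eτ]
    simp_rw [integral_sandwich_szegoWeight h hnt n hP]
    rfl
  have f1 : ∫ θ, (szegoWeight D θ).trace.re ∂lam0 = p := by
    rw [e1]
    have : ∀ a, ∫ θ, szegoWeight D θ a a ∂lam0 = 1 := fun a => by
      have h1 := integral_sandwich_szegoWeight h hnt n (P := 1)
        (fun m hm => by rw [Polynomial.coeff_one, if_neg (by omega)]) a a
      simp only [evalMat_one, Matrix.conjTranspose_one, one_mul, mul_one, h.integral_eq,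
        Matrix.one_apply_eq] at h1
      exact h1.symm
    simp [this]
  have hAp : ∀ θ, ((c : ℂ) • (1 : Mat p) +
      evalMat P (expI θ) * (evalMat P (expI θ))ᴴ).PosDef := fun θ =>
    posDef_smul_one_add hc (Matrix.posSemidef_self_mul_conjTranspose _)
  have hAc : Continuous fun θ => (c : ℂ) • (1 : Mat p) +
      evalMat P (expI θ) * (evalMat P (expI θ))ᴴ :=
    continuous_const.add (hPc.matrix_mul hPc.matrix_conjTranspose)
  have hw := continuous_weight g
  have key : ∀ θ, weight g θ * Real.log ((c : ℂ) • (1 : Mat p) +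
      evalMat P (expI θ) * (evalMat P (expI θ))ᴴ).det.re ≤
      weight g θ * (2 * Real.log ‖(evalMat D (expI θ)).det‖) + p * (2 * Real.log 2) +
        (c * (szegoWeight D θ).trace.re +
          ((evalMat P (expI θ))ᴴ * szegoWeight D θ * evalMat P (expI θ)).trace.re) := by
    intro θ
    rw [← trace_scalar_add_mul]
    refine mul_log_det_le (hAp θ) (hdet _ (norm_expI θ).le) (weight_nonneg hg θ)
      (weight_le_two hg θ) ?_
    rw [trace_scalar_add_mul]
    have hps : (szegoWeight D θ).PosSemidef :=
      (Matrix.posSemidef_self_mul_conjTranspose (evalMat D (expI θ))).inv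
    exact add_nonneg (mul_nonneg hc.le (posSemidef_trace_re_nonneg hps))
      (posSemidef_trace_re_nonneg (hps.conjTranspose_mul_mul_same _))
  have j1 : Integrable (fun θ => weight g θ *
      (2 * Real.log ‖(evalMat D (expI θ)).det‖)) lam0 :=
    continuous_integrable (hw.mul (continuous_log_norm_det hdet)) lam0
  have j2 : Integrable (fun _ : UCircle => (p : ℝ) * (2 * Real.log 2)) lam0 := integrable_const _
  have j3 := i1.const_mul c
  have j12 : Integrable (fun θ => weight g θ * (2 * Real.log ‖(evalMat D (expI θ)).det‖) +
      p * (2 * Real.log 2)) lam0 := j1.add j2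
  have j34 : Integrable (fun θ => c * (szegoWeight D θ).trace.re +
      ((evalMat P (expI θ))ᴴ * szegoWeight D θ * evalMat P (expI θ)).trace.re) lam0 := j3.add i0
  have hle := integral_mono (μ := lam0)
    (continuous_integrable (hw.mul (continuous_log_det hAc hAp)) lam0) (j12.add j34) key
  have hsum := integral_add j12 j34
  rw [integral_add j1 j2, integral_add j3 i0, integral_const_mul c, integral_const, f0, f1] at hsum
  have hle' := hle.trans_eq hsum
  simp only [probReal_univ, one_smul, Pi.mul_apply] at hle'
  rw [szegoSum, integral_lam hg, integral_lam hg]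
  simp only [smul_eq_mul]
  linarith

end PolynomialTest

/-! ### From polynomials to trigonometric polynomials, and L² approximation. -/

section TrigonometricPolynomials

variable {p : ℕ} {μ : MatMeasure p} {τ : Measure UCircle} {M : UCircle → Mat p}

/-- `q` is a trigonometric polynomial. -/
def IsTrig (q : UCircle → ℂ) : Prop :=
  ∃ l : ℕ, ∀ k, l ≤ k → ∃ P : Polynomial ℂ, ∀ θ, P.eval (expI θ) = expI θ ^ k * q θ

/-- That every power k ≥ l clears the negative frequencies is what lets sums, and later all matrix
entries, share one shift. -/
theorem isTrig_of_mem_span {q : C(UCircle, ℂ)}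
    (hq : q ∈ Submodule.span ℂ (Set.range fun n => (fourier n : C(UCircle, ℂ)))) :
    IsTrig q := by
  induction hq using Submodule.span_induction with
  | mem x hx =>
    obtain ⟨n, rfl⟩ := hx
    refine ⟨n.natAbs, fun k hk => ⟨Polynomial.X ^ ((k : ℤ) + n).toNat, fun θ => ?_⟩⟩
    have h1 : (((k : ℤ) + n).toNat : ℤ) = k + n := Int.toNat_of_nonneg (by omega)
    have h2 : fourier n θ = expI θ ^ n := by
      rw [fourier_apply, AddCircle.toCircle_zsmul]
      simp [expI]
    rw [h2, Polynomial.eval_pow, Polynomial.eval_X, ← zpow_natCast, h1,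
      zpow_add₀ (expI_ne_zero θ), zpow_natCast]
  | zero => exact ⟨0, fun k _ => ⟨0, fun θ => by simp⟩⟩
  | add x y _ _ hx hy =>
    obtain ⟨l, hl⟩ := hx
    obtain ⟨m, hm⟩ := hy
    refine ⟨max l m, fun k hk => ?_⟩
    obtain ⟨P, hP⟩ := hl k (by omega)
    obtain ⟨Q, hQ⟩ := hm k (by omega)
    exact ⟨P + Q, fun θ => by simp [hP, hQ, mul_add]⟩
  | smul a x _ hx =>
    obtain ⟨l, hl⟩ := hx
    refine ⟨l, fun k hk => ?_⟩
    obtain ⟨P, hP⟩ := hl k hk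
    exact ⟨Polynomial.C a * P, fun θ => by simp [hP, mul_left_comm]⟩

theorem exists_isTrig_approx {ν : Measure UCircle} [IsFiniteMeasure ν] {b : UCircle → ℂ}
    (hb : Measurable b) {C : ℝ} (hC : ∀ θ, ‖b θ‖ ≤ C) {η : ℝ} (hη : 0 < η) :
    ∃ q : UCircle → ℂ, Continuous q ∧ IsTrig q ∧ ∫ θ, ‖b θ - q θ‖ ^ 2 ∂ν ≤ η := by
  set m := ν.real Set.univ
  have hm : 0 ≤ m := measureReal_nonneg
  -- The first term pays for an L² approximation by a continuous function, the second for a uniform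
  -- approximation of that function, integrated over mass m.
  obtain ⟨e, he, hem⟩ : ∃ e : ℝ, 0 < e ∧ 2 * e ^ 2 + 2 * e ^ 2 * m ≤ η := by
    refine ⟨Real.sqrt (η / (2 * (1 + m))), Real.sqrt_pos.2 (by positivity), ?_⟩
    rw [Real.sq_sqrt (by positivity)]
    field_simp
    rfl
  have hmem : MemLp b 2 ν := MemLp.of_bound hb.aestronglyMeasurable C (.of_forall hC)
  obtain ⟨f, hf, hfm⟩ := hmem.exists_boundedContinuous_eLpNorm_sub_le (by norm_num)
    (ε := ENNReal.ofReal e) (by simpa using he)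
  have h1 : ∫ θ, ‖b θ - f θ‖ ^ 2 ∂ν ≤ e ^ 2 := by
    have h2 := eLpNorm_nnreal_pow_eq_lintegral (f := b - ⇑f) (μ := ν) (p := 2) (by norm_num)
    have h3 : ∫⁻ θ, ENNReal.ofReal (‖b θ - f θ‖ ^ 2) ∂ν ≤ ENNReal.ofReal (e ^ 2) := by
      have e1 : ∀ θ, ENNReal.ofReal (‖b θ - f θ‖ ^ 2) = ‖(b - ⇑f) θ‖ₑ ^ ((2 : NNReal) : ℝ) := by
        intro θ
        rw [ENNReal.ofReal_pow (norm_nonneg _), ofReal_norm]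
        simp
      simp_rw [e1]
      rw [← h2, ENNReal.ofReal_pow he.le]
      simp only [NNReal.coe_ofNat, ENNReal.rpow_ofNat]
      gcongr
      exact hf
    rw [integral_eq_lintegral_of_nonneg_ae (f := fun θ => ‖b θ - f θ‖ ^ 2)
      (.of_forall fun θ => by positivity)
      (((hb.sub f.continuous.measurable).norm.pow_const 2).aestronglyMeasurable)]
    exact ENNReal.toReal_le_of_le_ofReal (by positivity) h3
  set F : C(UCircle, ℂ) := f.toContinuousMap
  have hcl : F ∈ closure (Submodule.span ℂ
      (Set.range fun n => (fourier n : C(UCircle, ℂ))) : Set C(UCircle, ℂ)) := by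
    have := (span_fourier_closure_eq_top (T := 2 * Real.pi)).ge (Submodule.mem_top (x := F))
    exact this
  obtain ⟨q, hq, hdist⟩ := Metric.mem_closure_iff.1 hcl e he
  have hle : ∀ θ, ‖f θ - q θ‖ ≤ e := fun θ =>
    (ContinuousMap.norm_coe_le_norm (F - q) θ).trans (by rw [← dist_eq_norm]; exact hdist.le)
  refine ⟨q, q.continuous, isTrig_of_mem_span hq, le_trans ?_ hem⟩
  have i1 : Integrable (fun θ => ‖b θ - f θ‖ ^ 2) ν := by
    have := (hmem.sub hfm).integrable_norm_pow (by norm_num)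
    simpa using this
  have : ∫ θ, ‖b θ - q θ‖ ^ 2 ∂ν ≤ ∫ θ, (2 * ‖b θ - f θ‖ ^ 2 + 2 * e ^ 2) ∂ν := by
    refine integral_mono_of_nonneg (.of_forall fun θ => by positivity)
      ((i1.const_mul 2).add (integrable_const _)) (.of_forall fun θ => ?_)
    have h2 : ‖b θ - q θ‖ ≤ ‖b θ - f θ‖ + ‖f θ - q θ‖ := by
      rw [← sub_add_sub_cancel (b θ) (f θ) (q θ)]; exact norm_add_le _ _
    have h3 := hle θ
    have h4 := norm_nonneg (f θ - q θ)
    have h5 := norm_nonneg (b θ - q θ)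
    have h6 := norm_nonneg (b θ - f θ)
    simp only
    nlinarith [sq_nonneg (‖b θ - f θ‖ - ‖f θ - q θ‖), mul_self_le_mul_self h5 h2]
  rw [integral_add (i1.const_mul 2) (integrable_const _), integral_const_mul, integral_const] at this
  simp only [smul_eq_mul] at this
  change _ ≤ _ + m * _ at this
  linarith

theorem exists_matrix_isTrig_approx {ν : Measure UCircle} [IsFiniteMeasure ν] {B : UCircle → Mat p}
    (hB : ∀ i j, Measurable fun θ => B θ i j) {C : ℝ} (hC : ∀ θ i j, ‖B θ i j‖ ≤ C) {η : ℝ}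
    (hη : 0 < η) : ∃ Q : UCircle → Mat p, Continuous Q ∧
      (∃ (l : ℕ) (P : Polynomial (Mat p)), ∀ θ, evalMat P (expI θ) = expI θ ^ l • Q θ) ∧
      ∀ i j, ∫ θ, ‖B θ i j - Q θ i j‖ ^ 2 ∂ν ≤ η := by
  choose q hqc hqt hq using fun i j => exists_isTrig_approx (ν := ν) (hB i j)
    (fun θ => hC θ i j) hη
  choose l hl using hqt
  have hle : ∀ i j, l i j ≤ ∑ i, ∑ j, l i j := fun i j =>
    (Finset.single_le_sum (f := fun j => l i j) (fun _ _ => Nat.zero_le _)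
      (Finset.mem_univ j)).trans
    (Finset.single_le_sum (f := fun i => ∑ j, l i j) (fun _ _ => Nat.zero_le _)
      (Finset.mem_univ i))
  choose P hP using fun i j => hl i j _ (hle i j)
  refine ⟨fun θ => Matrix.of fun i j => q i j θ, continuous_matrix hqc,
    ⟨∑ i, ∑ j, l i j, matPolyEquiv (Matrix.of P), fun θ => ?_⟩, hq⟩
  ext i j
  rw [evalMat_apply, AlgEquiv.symm_apply_apply]
  exact hP i j θ

/-- The unimodular shift cancels in QQ† and Q†MQ. The degree of the shifted polynomial is arbitrary,
hence the need for a bound K uniform in n. -/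
theorem integral_log_det_le_of_trig (h : Represents μ τ M) (hnt : IsNontrivial μ) {g : ℝ}
    (hg : |g| ≤ 1) {K : ℝ} (hK : ∀ n, szegoSum (verblunsky μ) g n ≤ K) {c : ℝ} (hc : 0 < c)
    {Q : UCircle → Mat p} {l : ℕ} {P : Polynomial (Mat p)}
    (hP : ∀ θ, evalMat P (expI θ) = expI θ ^ l • Q θ) :
    ∫ θ, Real.log ((c : ℂ) • 1 + Q θ * (Q θ)ᴴ).det.re ∂(lam g) ≤
      K + p * (2 * Real.log 2) + c * p + ∫ θ, ((Q θ)ᴴ * M θ * Q θ).trace.re ∂τ := by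
  have hu : ∀ θ, star (expI θ ^ l) * expI θ ^ l = 1 := fun θ => by
    rw [star_pow, ← mul_pow, star_expI_mul, one_pow]
  have e1 : ∀ θ, evalMat P (expI θ) * (evalMat P (expI θ))ᴴ = Q θ * (Q θ)ᴴ := fun θ => by
    rw [hP, Matrix.conjTranspose_smul, Matrix.smul_mul, Matrix.mul_smul, smul_smul, mul_comm,
      hu, one_smul]
  have e2 : ∀ θ, (evalMat P (expI θ))ᴴ * M θ * evalMat P (expI θ) = (Q θ)ᴴ * M θ * Q θ := by
    intro θ
    rw [hP, Matrix.conjTranspose_smul, Matrix.smul_mul, Matrix.smul_mul, Matrix.mul_smul,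
      smul_smul, hu, one_smul]
  have := integral_log_det_le_of_polynomial h hnt hg hc (n := P.natDegree) (P := P)
    fun m hm => Polynomial.coeff_eq_zero_of_natDegree_lt (by omega)
  simp_rw [e1, e2] at this
  linarith [hK P.natDegree]

end TrigonometricPolynomials

/-! ### Stability of the variational inequality under L² errors. -/

section GramEstimates

variable {p : ℕ}

/-- No bound on q, q' is available, so errors linear in b - q are traded for squares through t ≤ s +
t²/s, with s to be sent to 0. -/
theorem norm_mul_star_sub_le {b b' q q' : ℂ} {C s : ℝ} (hs : 0 < s) (hb : ‖b‖ ≤ C)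
    (hb' : ‖b'‖ ≤ C) : ‖b * star b' - q * star q'‖ ≤
      2 * C * s + (C / s + 1 / 2) * (‖b - q‖ ^ 2 + ‖b' - q'‖ ^ 2) := by
  have e : b * star b' - q * star q' = b * star (b' - q') + (b - q) * star b' -
      (b - q) * star (b' - q') := by
    rw [star_sub]; ring
  have h1 : ‖b * star b' - q * star q'‖ ≤ ‖b‖ * ‖b' - q'‖ + ‖b - q‖ * ‖b'‖ +
      ‖b - q‖ * ‖b' - q'‖ := by
    rw [e]
    refine (norm_sub_le _ _).trans (add_le_add ((norm_add_le _ _).trans (add_le_add ?_ ?_)) ?_) <;>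
    rw [norm_mul, norm_star]
  have hC : 0 ≤ C := (norm_nonneg b).trans hb
  set x := ‖b - q‖
  set y := ‖b' - q'‖
  have hx : 0 ≤ x := norm_nonneg _
  have hy : 0 ≤ y := norm_nonneg _
  have aux : ∀ t : ℝ, 0 ≤ t → t ≤ s + t ^ 2 / s := by
    intro t ht
    have : s * t ≤ s * (s + t ^ 2 / s) := by
      rw [mul_add, mul_div_cancel₀ _ hs.ne']
      nlinarith [sq_nonneg (s - t)]
    exact le_of_mul_le_mul_left this hs
  have h2 : ‖b‖ * y ≤ C * (s + y ^ 2 / s) := mul_le_mul hb (aux y hy) hy hC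
  have h3 : x * ‖b'‖ ≤ (s + x ^ 2 / s) * C :=
    mul_le_mul (aux x hx) hb' (norm_nonneg _) (by positivity)
  have h4 : x * y ≤ (x ^ 2 + y ^ 2) / 2 := by nlinarith [sq_nonneg (x - y)]
  calc _ ≤ C * (s + y ^ 2 / s) + (s + x ^ 2 / s) * C + (x ^ 2 + y ^ 2) / 2 := by linarith
    _ = _ := by ring

/-- A bound for the difference of the Gram matrices of `B` and `Q`. -/
noncomputable def gramError (C s : ℝ) (B Q : Mat p) : ℝ :=
  p ^ 3 * (2 * C * s) + (C / s + 1 / 2) * (2 * p * ∑ i, ∑ k, ‖B i k - Q i k‖ ^ 2)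

theorem sum_norm_gram_sub_le {B Q : Mat p} {C s : ℝ} (hs : 0 < s) (hB : ∀ i j, ‖B i j‖ ≤ C) :
    ∑ i, ∑ j, ∑ k, ‖B i k * star (B j k) - Q i k * star (Q j k)‖ ≤ gramError C s B Q := by
  calc _ ≤ ∑ i : Fin p, ∑ j : Fin p, ∑ k : Fin p, (2 * C * s +
        (C / s + 1 / 2) * (‖B i k - Q i k‖ ^ 2 + ‖B j k - Q j k‖ ^ 2)) :=
      Finset.sum_le_sum fun i _ => Finset.sum_le_sum fun j _ => Finset.sum_le_sum fun k _ =>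
        norm_mul_star_sub_le hs (hB i k) (hB j k)
    _ = _ := by
      simp only [Finset.sum_add_distrib, ← Finset.mul_sum, Finset.sum_const, Finset.card_univ,
        Fintype.card_fin, nsmul_eq_mul, gramError]
      ring

theorem re_trace_sandwich_le {B Q W : Mat p} {C s : ℝ} (hs : 0 < s)
    (hB : ∀ i j, ‖B i j‖ ≤ C) (hW : ∀ i j, ‖W i j‖ ≤ 1) :
    (Qᴴ * W * Q).trace.re ≤ (Bᴴ * W * B).trace.re + gramError C s B Q := by
  have h1 : (Qᴴ * W * Q).trace - (Bᴴ * W * B).trace =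
      ∑ k, ∑ j, ∑ i, (star (Q i k) * Q j k - star (B i k) * B j k) * W i j := by
    simp only [Matrix.trace, Matrix.diag_apply, sandwich_apply, ← Finset.sum_sub_distrib, sub_mul]
  have h2 : ‖(Qᴴ * W * Q).trace - (Bᴴ * W * B).trace‖ ≤ gramError C s B Q := by
    rw [h1]
    refine le_trans ?_ (sum_norm_gram_sub_le hs hB)
    calc _ ≤ ∑ k, ∑ j, ∑ i, ‖B j k * star (B i k) - Q j k * star (Q i k)‖ := by
          refine norm_sum_le_of_le _ fun k _ => norm_sum_le_of_le _ fun j _ =>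
            norm_sum_le_of_le _ fun i _ => ?_
          rw [norm_mul, norm_sub_rev, mul_comm (star (B i k)), mul_comm (star (Q i k))]
          exact mul_le_of_le_one_right (norm_nonneg _) (hW i j)
      _ = _ := by
          rw [Finset.sum_comm]
          refine Finset.sum_congr rfl fun j _ => ?_
          rw [Finset.sum_comm]
  have h3 := (Complex.re_le_norm _).trans h2
  rw [Complex.sub_re] at h3
  linarith

/-- The tangent of log det at c + QQ† needs only (c + QQ†)⁻¹, whose entries are bounded by p / c
whatever the size of Q. -/
theorem log_det_sub_le_gramError {B Q : Mat p} {C s c : ℝ} (hc : 0 < c) (hs : 0 < s)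
    (hB : ∀ i j, ‖B i j‖ ≤ C) :
    Real.log ((c : ℂ) • (1 : Mat p) + B * Bᴴ).det.re ≤
      Real.log ((c : ℂ) • (1 : Mat p) + Q * Qᴴ).det.re + p / c * gramError C s B Q := by
  have hQ := posDef_smul_one_add hc (Matrix.posSemidef_self_mul_conjTranspose Q)
  have h1 := log_det_sub_log_det_le
    (posDef_smul_one_add hc (Matrix.posSemidef_self_mul_conjTranspose B)) hQ
  rw [add_sub_add_left_eq_sub] at h1
  have h2 : ‖(((c : ℂ) • (1 : Mat p) + Q * Qᴴ)⁻¹ * (B * Bᴴ - Q * Qᴴ)).trace‖ ≤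
      p / c * gramError C s B Q := by
    refine le_trans ?_ (mul_le_mul_of_nonneg_left (sum_norm_gram_sub_le (Q := Q) hs hB)
      (by positivity : (0 : ℝ) ≤ p / c))
    rw [Finset.mul_sum, Matrix.trace_mul_comm]
    refine norm_sum_le_of_le _ fun i _ => ?_
    rw [Matrix.diag_apply, Matrix.mul_apply, Finset.mul_sum]
    refine norm_sum_le_of_le _ fun j _ => ?_
    rw [norm_mul, mul_comm]
    have h3 := norm_inv_entry_le hc (Matrix.posSemidef_self_mul_conjTranspose Q) j i
    have h4 : (c : ℂ) • (1 : Mat p) = Matrix.scalar (Fin p) (c : ℂ) := by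
      rw [Matrix.scalar_apply, Matrix.smul_one_eq_diagonal]
    rw [h4]
    refine mul_le_mul h3 ?_ (norm_nonneg _) (by positivity)
    rw [Matrix.sub_apply, Matrix.mul_apply, Matrix.mul_apply, ← Finset.sum_sub_distrib]
    exact norm_sum_le _ _
  have h5 := (Complex.re_le_norm _).trans h2
  linarith

theorem abs_log_det_le {B : Mat p} {C c : ℝ} (hc : 0 < c) (hB : ∀ i j, ‖B i j‖ ≤ C) :
    |Real.log ((c : ℂ) • (1 : Mat p) + B * Bᴴ).det.re| ≤
      |p * Real.log c| + |c * p| + p ^ 2 * C ^ 2 := by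
  have hps := Matrix.posSemidef_self_mul_conjTranspose B
  have hpd := posDef_smul_one_add hc hps
  have h1 := log_det_le_trace_sub hpd.posSemidef (posDef_det_re_pos hpd)
  have h2 : ((c : ℂ) • (1 : Mat p) + B * Bᴴ).trace.re ≤ c * p + p ^ 2 * C ^ 2 := by
    rw [Matrix.trace_add, Complex.add_re, Matrix.trace_smul, smul_eq_mul, Complex.re_ofReal_mul,
      Matrix.trace_one, Fintype.card_fin, Complex.natCast_re]
    have h3 : (B * Bᴴ).trace.re = ∑ i, ∑ j, ‖B i j‖ ^ 2 := by
      simp only [Matrix.trace, Matrix.diag_apply, Matrix.mul_apply, Matrix.conjTranspose_apply,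
        Complex.re_sum]
      refine Finset.sum_congr rfl fun i _ => Finset.sum_congr rfl fun j _ => ?_
      rw [Complex.star_def, Complex.mul_conj, Complex.normSq_eq_norm_sq, Complex.ofReal_re]
    have h4 : ∑ i : Fin p, ∑ j : Fin p, ‖B i j‖ ^ 2 ≤ ∑ _i : Fin p, ∑ _j : Fin p, C ^ 2 :=
      Finset.sum_le_sum fun i _ => Finset.sum_le_sum fun j _ =>
        pow_le_pow_left₀ (norm_nonneg _) (hB i j) 2
    simp only [Finset.sum_const, Finset.card_univ, Fintype.card_fin, nsmul_eq_mul] at h4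
    rw [h3]
    linarith
  have h5 : p * Real.log c ≤ Real.log ((c : ℂ) • (1 : Mat p) + B * Bᴴ).det.re := by
    have e : (c : ℂ) • (1 : Mat p) + B * Bᴴ =
        (c : ℂ) • (1 + ((c⁻¹ : ℝ) : ℂ) • (B * Bᴴ)) := by
      rw [smul_add, smul_smul, ← Complex.ofReal_mul, mul_inv_cancel₀ hc.ne', Complex.ofReal_one,
        one_smul]
    have h6 := one_le_det_one_add (hps.smul (a := ((c⁻¹ : ℝ) : ℂ))
      (by exact_mod_cast (inv_pos.2 hc).le))
    rw [e, Matrix.det_smul, Fintype.card_fin, ← Complex.ofReal_pow, Complex.re_ofReal_mul,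
      Real.log_mul (by positivity) (by linarith), Real.log_pow]
    linarith [Real.log_nonneg h6]
  have hp : (0 : ℝ) ≤ p := p.cast_nonneg
  rw [abs_le]
  have h7 := neg_abs_le (p * Real.log c)
  have h8 := le_abs_self (c * p)
  have h9 := abs_nonneg (c * p)
  have h10 := abs_nonneg (p * Real.log c)
  have h11 : 0 ≤ (p : ℝ) ^ 2 * C ^ 2 := by positivity
  constructor <;> linarith

end GramEstimates

/-! ### The variational inequality for bounded measurable test matrices. -/

section BoundedTest

variable {p : ℕ} {μ : MatMeasure p} {τ : Measure UCircle} {M : UCircle → Mat p}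

theorem integral_gramError_le {ν : Measure UCircle} [IsFiniteMeasure ν] {B Q : UCircle → Mat p}
    {C s : ℝ} (hC : 0 ≤ C) (hs : 0 < s)
    (hi : ∀ i j, Integrable (fun θ => ‖B θ i j - Q θ i j‖ ^ 2) ν)
    (h : ∀ i j, ∫ θ, ‖B θ i j - Q θ i j‖ ^ 2 ∂ν ≤ s ^ 2) :
    Integrable (fun θ => gramError C s (B θ) (Q θ)) ν ∧
      ∫ θ, gramError C s (B θ) (Q θ) ∂ν ≤
        ν.real Set.univ * (p ^ 3 * (2 * C * s)) + (C * s + s ^ 2 / 2) * (2 * p * (p * p)) := by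
  have hi1 : ∀ i, Integrable (fun θ => ∑ j, ‖B θ i j - Q θ i j‖ ^ 2) ν := fun i =>
    integrable_finsetSum _ fun j _ => hi i j
  have hi2 : Integrable (fun θ => ∑ i, ∑ j, ‖B θ i j - Q θ i j‖ ^ 2) ν :=
    integrable_finsetSum _ fun i _ => hi1 i
  have hi3 : Integrable (fun θ => (C / s + 1 / 2) *
      (2 * p * ∑ i, ∑ j, ‖B θ i j - Q θ i j‖ ^ 2)) ν := (hi2.const_mul _).const_mul _
  refine ⟨(integrable_const _).add hi3, ?_⟩
  simp only [gramError]
  rw [integral_add (integrable_const _) hi3, integral_const, integral_const_mul,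
    integral_const_mul, integral_finsetSum _ fun i _ => hi1 i]
  simp_rw [integral_finsetSum _ fun j _ => hi _ j]
  have h1 : ∑ i : Fin p, ∑ j : Fin p, ∫ θ, ‖B θ i j - Q θ i j‖ ^ 2 ∂ν ≤
      ∑ _i : Fin p, ∑ _j : Fin p, s ^ 2 :=
    Finset.sum_le_sum fun i _ => Finset.sum_le_sum fun j _ => h i j
  simp only [Finset.sum_const, Finset.card_univ, Fintype.card_fin, nsmul_eq_mul] at h1
  have h2 : (C / s + 1 / 2) * (2 * p * ∑ i : Fin p, ∑ j : Fin p,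
      ∫ θ, ‖B θ i j - Q θ i j‖ ^ 2 ∂ν) ≤ (C / s + 1 / 2) * (2 * p * (p * (p * s ^ 2))) := by
    gcongr
  rw [smul_eq_mul]
  have h3 : (C / s + 1 / 2) * (2 * p * (p * (p * s ^ 2))) =
      (C * s + s ^ 2 / 2) * (2 * p * (p * p)) := by field_simp
  linarith

/-- Approximation by trigonometric polynomials in L²(λ_g + τ), which controls both integrals at
once. Squared errors of at most s² cost a multiple of `bound s`, which tends to 0 with s. -/
theorem integral_log_det_le_of_bounded (h : Represents μ τ M) (hnt : IsNontrivial μ) {g : ℝ}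
    (hg : |g| ≤ 1) {K : ℝ} (hK : ∀ n, szegoSum (verblunsky μ) g n ≤ K) {c : ℝ} (hc : 0 < c)
    {B : UCircle → Mat p} (hB : ∀ i j, Measurable fun θ => B θ i j) {C : ℝ}
    (hC : ∀ θ i j, ‖B θ i j‖ ≤ C) :
    Integrable (fun θ => Real.log ((c : ℂ) • 1 + B θ * (B θ)ᴴ).det.re) (lam g) ∧
    ∫ θ, Real.log ((c : ℂ) • 1 + B θ * (B θ)ᴴ).det.re ∂(lam g) ≤
      K + p * (2 * Real.log 2) + c * p + ∫ θ, ((B θ)ᴴ * M θ * B θ).trace.re ∂τ := by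
  have := h.finite
  have := isProbabilityMeasure_lam hg
  wlog hC0 : 0 ≤ C generalizing C
  · exact this (C := |C|) (fun θ i j => (hC θ i j).trans (le_abs_self C)) (abs_nonneg C)
  set σ := lam g
  have hBB : ∀ i j, Measurable fun θ => ((c : ℂ) • (1 : Mat p) + B θ * (B θ)ᴴ) i j := fun i j => by
    simp only [Matrix.add_apply, Matrix.mul_apply, Matrix.conjTranspose_apply]
    exact measurable_const.add (Finset.measurable_sum _ fun k _ =>
      (hB i k).mul (continuous_star.measurable.comp (hB j k)))
  have hlogi : Integrable (fun θ => Real.log ((c : ℂ) • 1 + B θ * (B θ)ᴴ).det.re) σ :=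
    Integrable.of_bound (Real.measurable_log.comp (Complex.measurable_re.comp
      (measurable_det hBB))).aestronglyMeasurable _
      (.of_forall fun θ => abs_log_det_le hc (hC θ))
  refine ⟨hlogi, ?_⟩
  have htr : ∀ a, Integrable (fun θ => ((B θ)ᴴ * M θ * B θ) a a) τ := by
    intro a
    simp only [sandwich_apply]
    refine integrable_finsetSum _ fun j _ => integrable_finsetSum _ fun i _ =>
      Integrable.of_bound (((continuous_star.measurable.comp (hB i a)).mul (hB j a)).mul
        (h.measurable i j)).aestronglyMeasurable (C * C * 1) (.of_forall fun θ => ?_)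
    rw [norm_mul, norm_mul]
    refine mul_le_mul (mul_le_mul ?_ (hC θ j a) (norm_nonneg _) hC0) (h.norm_le θ i j)
      (norm_nonneg _) (by positivity)
    exact (norm_star _).trans_le (hC θ i a)
  set m := (σ + τ).real Set.univ
  set bound : ℝ → ℝ := fun s =>
    m * (p ^ 3 * (2 * C * s)) + (C * s + s ^ 2 / 2) * (2 * p * (p * p)) with hbound
  have key : ∀ s : ℝ, 0 < s → ∫ θ, Real.log ((c : ℂ) • 1 + B θ * (B θ)ᴴ).det.re ∂σ ≤
      K + p * (2 * Real.log 2) + c * p + ∫ θ, ((B θ)ᴴ * M θ * B θ).trace.re ∂τ +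
        (1 + p / c) * bound s := by
    intro s hs
    obtain ⟨Q, hQc, ⟨l, P, hP⟩, hQ⟩ := exists_matrix_isTrig_approx (ν := σ + τ) hB hC
      (by positivity : 0 < s ^ 2)
    obtain ⟨D, hD⟩ : ∃ D : ℝ, ∀ θ i j, ‖Q θ i j‖ ≤ D := by
      choose D hD using fun i j => isCompact_univ.exists_bound_of_continuousOn
        (hQc.matrix_elem i j).continuousOn
      refine ⟨∑ i, ∑ j, |D i j|, fun θ i j => (hD i j θ (Set.mem_univ _)).trans
        ((le_abs_self _).trans ?_)⟩
      exact (Finset.single_le_sum (f := fun j => |D i j|) (fun _ _ => abs_nonneg _)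
        (Finset.mem_univ j)).trans
        (Finset.single_le_sum (f := fun i => ∑ j, |D i j|)
          (fun _ _ => Finset.sum_nonneg fun _ _ => abs_nonneg _) (Finset.mem_univ i))
    have hi : ∀ i j, Integrable (fun θ => ‖B θ i j - Q θ i j‖ ^ 2) (σ + τ) := fun i j =>
      Integrable.of_bound (((hB i j).sub (hQc.matrix_elem i j).measurable).norm.pow_const
        2).aestronglyMeasurable ((C + D) ^ 2) (.of_forall fun θ => by
          rw [norm_pow, norm_norm]
          exact pow_le_pow_left₀ (norm_nonneg _)
            ((norm_sub_le _ _).trans (add_le_add (hC θ i j) (hD θ i j))) 2)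
    obtain ⟨ei, ele⟩ := integral_gramError_le hC0 hs hi hQ
    have hnn : ∀ θ, 0 ≤ gramError C s (B θ) (Q θ) := fun θ => by
      unfold gramError; positivity
    have hσ : ∫ θ, gramError C s (B θ) (Q θ) ∂σ ≤ bound s :=
      (integral_mono_measure (Measure.le_add_right le_rfl) (.of_forall hnn) ei).trans ele
    have hτ : ∫ θ, gramError C s (B θ) (Q θ) ∂τ ≤ bound s :=
      (integral_mono_measure (Measure.le_add_left le_rfl) (.of_forall hnn) ei).trans ele
    have eσ := ei.mono_measure (Measure.le_add_right le_rfl : σ ≤ σ + τ)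
    have eτ := ei.mono_measure (Measure.le_add_left le_rfl : τ ≤ σ + τ)
    have hQl : Integrable (fun θ => Real.log ((c : ℂ) • 1 + Q θ * (Q θ)ᴴ).det.re) σ :=
      continuous_integrable (continuous_log_det
        (continuous_const.add (hQc.matrix_mul hQc.matrix_conjTranspose)) fun θ =>
        posDef_smul_one_add hc (Matrix.posSemidef_self_mul_conjTranspose _)) σ
    have l1 := integral_mono hlogi (hQl.add (eσ.const_mul (p / c))) fun θ =>
      log_det_sub_le_gramError hc hs (hC θ)
    have l1' := l1.trans_eq (integral_add hQl (eσ.const_mul (p / c)))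
    rw [integral_const_mul] at l1'
    have l2 := integral_log_det_le_of_trig h hnt hg hK hc hP
    have iB := (integral_trace_re htr).1
    have l3 := integral_mono (integral_trace_re fun a =>
      integrable_sandwich_apply hQc hQc h.integrable a a).1 (iB.add eτ) fun θ =>
      re_trace_sandwich_le hs (hC θ) (h.norm_le θ)
    have l3' := l3.trans_eq (integral_add iB eτ)
    have l4 : p / c * ∫ θ, gramError C s (B θ) (Q θ) ∂σ ≤ p / c * bound s :=
      mul_le_mul_of_nonneg_left hσ (by positivity)
    linarith
  have hlim : Filter.Tendsto (fun s : ℝ => K + p * (2 * Real.log 2) + c * p +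
      ∫ θ, ((B θ)ᴴ * M θ * B θ).trace.re ∂τ + (1 + p / c) * bound s)
      (nhdsWithin 0 (Set.Ioi 0)) (nhds (K + p * (2 * Real.log 2) + c * p +
      ∫ θ, ((B θ)ᴴ * M θ * B θ).trace.re ∂τ + (1 + p / c) * bound 0)) := by
    refine Filter.Tendsto.mono_left (Continuous.tendsto ?_ 0) nhdsWithin_le_nhds
    fun_prop
  have h0 : bound 0 = 0 := by simp [hbound]
  rw [h0, mul_zero, add_zero] at hlim
  exact ge_of_tendsto hlim (by filter_upwards [self_mem_nhdsWithin] with s hs using key s hs)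

end BoundedTest

/-! ### Continuity of the matrix square root. -/

section MeasurableSquareRoot

open scoped Matrix.Norms.L2Operator

theorem continuousOn_matrix_sqrt {p : ℕ} : ContinuousOn (CFC.sqrt : Mat p → Mat p) {A | 0 ≤ A} :=
  CFC.continuousOn_sqrt

end MeasurableSquareRoot

/-! ### Measurability and resolvent inequalities for the test matrix. -/

section MeasurableMatrices

variable {p : ℕ}

theorem measurable_sqrt {A : UCircle → Mat p} (hA : ∀ i j, Measurable fun θ => A θ i j)
    (hps : ∀ θ, (A θ).PosSemidef) (i j : Fin p) : Measurable fun θ => CFC.sqrt (A θ) i j := by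
  set S : Set (Fin p → Fin p → ℂ) := {X | 0 ≤ (Matrix.of X : Mat p)}
  have hv : Continuous fun X : S => (Matrix.of X.1 : Mat p) := continuous_subtype_val
  have hc : Continuous fun X : S => CFC.sqrt (Matrix.of X.1 : Mat p) i j :=
    (continuousOn_matrix_sqrt.comp_continuous hv fun X => X.2).matrix_elem i j
  have hm : Measurable fun θ => (fun i j => A θ i j : Fin p → Fin p → ℂ) :=
    measurable_pi_lambda _ fun i => measurable_pi_lambda _ fun j => hA i j
  exact hc.measurable.comp (hm.subtype_mk (h := fun θ => (hps θ).nonneg))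

theorem measurable_inv {A : UCircle → Mat p} (hA : ∀ i j, Measurable fun θ => A θ i j)
    (i j : Fin p) : Measurable fun θ => (A θ)⁻¹ i j := by
  simp only [Matrix.inv_def, Ring.inverse_eq_inv', Matrix.smul_apply, smul_eq_mul,
    Matrix.adjugate_apply]
  refine (measurable_det hA).inv.mul (measurable_det fun k l => ?_)
  by_cases hk : k = j
  · subst hk
    simp only [Matrix.updateRow_self]
    exact measurable_const
  · simp only [Matrix.updateRow_ne hk]
    exact hA k l

theorem sqrt_mul_conjTranspose_sqrt {A : Mat p} (hA : A.PosSemidef) :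
    CFC.sqrt A * (CFC.sqrt A)ᴴ = A := by
  rw [(Matrix.nonneg_iff_posSemidef.1 (CFC.sqrt_nonneg A)).1.eq,
    CFC.sqrt_mul_sqrt_self A hA.nonneg]

theorem norm_entry_sq_le_gram (B : Mat p) (i j : Fin p) : ‖B i j‖ ^ 2 ≤ ‖(B * Bᴴ) i i‖ := by
  have e : (B * Bᴴ) i i = ((∑ j, ‖B i j‖ ^ 2 : ℝ) : ℂ) := by
    simp only [Matrix.mul_apply, Matrix.conjTranspose_apply, Complex.star_def, Complex.mul_conj,
      Complex.normSq_eq_norm_sq]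
    push_cast
    rfl
  rw [e, Complex.norm_real, Real.norm_eq_abs]
  exact (Finset.single_le_sum (f := fun j => ‖B i j‖ ^ 2) (fun _ _ => by positivity)
    (Finset.mem_univ j)).trans (le_abs_self _)

theorem trace_mul_inv_le {c : ℝ} (hc : 0 < c) {H : Mat p} (hH : H.PosSemidef) :
    (H * ((c : ℂ) • (1 : Mat p) + H)⁻¹).trace.re ≤ p := by
  have hX := posDef_smul_one_add hc hH
  have hu := (Matrix.isUnit_iff_isUnit_det _).1 hX.isUnit
  have e : H * ((c : ℂ) • (1 : Mat p) + H)⁻¹ = 1 - (c : ℂ) • ((c : ℂ) • (1 : Mat p) + H)⁻¹ := by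
    have := Matrix.mul_nonsing_inv _ hu
    rw [add_mul, Matrix.smul_mul, one_mul] at this
    exact eq_sub_of_add_eq' this
  have h0 := posSemidef_trace_re_nonneg hX.inv.posSemidef
  rw [e, Matrix.trace_sub, Complex.sub_re, Matrix.trace_one, Fintype.card_fin, Complex.natCast_re,
    Matrix.trace_smul, smul_eq_mul, Complex.re_ofReal_mul]
  nlinarith

/-- The product of the two determinants is det(1 + cX) ≥ 1. -/
theorem neg_log_det_le_log_det_add_inv {c : ℝ} (hc : 0 < c) {X : Mat p} (hX : X.PosDef) :
    -Real.log X.det.re ≤ Real.log ((c : ℂ) • (1 : Mat p) + X⁻¹).det.re := by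
  have hu := (Matrix.isUnit_iff_isUnit_det _).1 hX.isUnit
  have hA := posDef_smul_one_add hc hX.inv.posSemidef
  have e : ((c : ℂ) • (1 : Mat p) + X⁻¹).det * X.det = (1 + (c : ℂ) • X).det := by
    rw [← Matrix.det_mul, add_mul, Matrix.smul_mul, one_mul, Matrix.nonsing_inv_mul _ hu, add_comm]
  have h1 := one_le_det_one_add (hX.posSemidef.smul (a := (c : ℂ)) (by exact_mod_cast hc.le))
  rw [← e, posSemidef_det_eq hA.posSemidef, posSemidef_det_eq hX.posSemidef, ← Complex.ofReal_mul,
    Complex.ofReal_re] at h1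
  have h2 := Real.log_nonneg h1
  rw [Real.log_mul (posDef_det_re_pos hA).ne' (posDef_det_re_pos hX).ne'] at h2
  linarith

end MeasurableMatrices

/-! ### Bounded Szegő integrals force finite entropy. -/

section EntropyFinite

variable {p : ℕ} {μ : MatMeasure p} {τ : Measure UCircle} {M : UCircle → Mat p}

/-- The integral of a function supported off the singular part. -/
theorem integral_le_of_acDensity {σ : Measure UCircle} [IsFiniteMeasure τ] [IsProbabilityMeasure σ]
    {N : Set UCircle} (hN : τ.singularPart σ N = 0) {F : UCircle → ℝ} (hF : Measurable F)
    {b : ℝ} (hb : ∀ θ, |F θ| ≤ b) (hF0 : ∀ θ, θ ∉ N → F θ = 0) {D : ℝ}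
    (hD : ∀ θ, (τ.rnDeriv σ θ).toReal * F θ ≤ D) : ∫ θ, F θ ∂τ ≤ D := by
  have hi : Integrable F τ := Integrable.of_bound hF.aestronglyMeasurable b (.of_forall hb)
  have : τ.HaveLebesgueDecomposition σ := Measure.haveLebesgueDecomposition_of_sigmaFinite τ σ
  have hdec := Measure.haveLebesgueDecomposition_add τ σ
  have h1 : ∫ θ, F θ ∂(τ.singularPart σ) = 0 := by
    refine integral_eq_zero_of_ae ?_
    filter_upwards [measure_eq_zero_iff_ae_notMem.1 hN] with θ hθ using hF0 θ hθ
  have i1 : Integrable F (τ.singularPart σ) := hi.mono_measure (Measure.singularPart_le τ σ)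
  have i2 : Integrable F (σ.withDensity (τ.rnDeriv σ)) :=
    hi.mono_measure (Measure.withDensity_rnDeriv_le τ σ)
  rw [hdec, integral_add_measure i1 i2, h1, zero_add,
    integral_withDensity_eq_integral_toReal_smul (Measure.measurable_rnDeriv τ σ)
      (Measure.rnDeriv_lt_top τ σ)]
  have i3 : Integrable (fun θ => (τ.rnDeriv σ θ).toReal • F θ) σ :=
    (integrable_withDensity_iff_integrable_smul' (Measure.measurable_rnDeriv τ σ)
      (Measure.rnDeriv_lt_top τ σ)).1 i2
  have := integral_mono i3 (integrable_const D) hD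
  simpa using this

/-- The near-optimal test matrix is B = (c + h)^{-1/2}, cut off on the support of the singular part.
Then ∫ tr B† dμ B = ∫ tr h(c + h)⁻¹ dλ_g ≤ p. -/
theorem integral_log_det_add_inv_le (h : Represents μ τ M) (hnt : IsNontrivial μ) {g : ℝ}
    (hg : |g| ≤ 1) {K : ℝ} (hK : ∀ n, szegoSum (verblunsky μ) g n ≤ K) {c : ℝ} (hc : 0 < c) :
    Integrable (fun θ => Real.log
      ((c : ℂ) • 1 + ((c : ℂ) • 1 + acDensity τ (lam g) M θ)⁻¹).det.re) (lam g) ∧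
    ∫ θ, Real.log ((c : ℂ) • 1 + ((c : ℂ) • 1 + acDensity τ (lam g) M θ)⁻¹).det.re ∂(lam g) ≤
      K + p * (2 * Real.log 2) + c * p + p := by
  classical
  have := h.finite
  have := isProbabilityMeasure_lam hg
  set σ := lam g
  set H := acDensity τ σ M
  set X : UCircle → Mat p := fun θ => (c : ℂ) • 1 + H θ with hXdef
  have hX : ∀ θ, (X θ).PosDef := fun θ => posDef_smul_one_add hc (h.acDensity_posSemidef σ θ)
  have hXm : ∀ i j, Measurable fun θ => X θ i j := fun i j =>
    measurable_const.add (h.measurable_acDensity σ i j)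
  have hXim := measurable_inv hXm
  -- N has full λ_g measure and is null for the singular part, so the cutoff loses nothing on the
  -- left and removes the singular part on the right.
  obtain ⟨N, hNm, hN0, hNc⟩ := Measure.mutuallySingular_singularPart τ σ
  set B : UCircle → Mat p := fun θ => if θ ∈ N then CFC.sqrt (X θ)⁻¹ else 0 with hBdef
  have hBm : ∀ i j, Measurable fun θ => B θ i j := by
    intro i j
    have e : (fun θ => B θ i j) = fun θ => if θ ∈ N then CFC.sqrt (X θ)⁻¹ i j else 0 := by
      funext θ
      by_cases hθ : θ ∈ N <;> simp [hBdef, hθ]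
    rw [e]
    exact Measurable.ite hNm (measurable_sqrt hXim (fun θ => (hX θ).inv.posSemidef) i j)
      measurable_const
  have hBB : ∀ θ, θ ∈ N → B θ * (B θ)ᴴ = (X θ)⁻¹ := fun θ hθ => by
    simp only [hBdef, if_pos hθ]
    exact sqrt_mul_conjTranspose_sqrt (hX θ).inv.posSemidef
  have hXi : ∀ θ i j, ‖(X θ)⁻¹ i j‖ ≤ p / c := fun θ i j => by
    have h1 := norm_inv_entry_le hc (h.acDensity_posSemidef σ θ) i j
    rwa [Matrix.scalar_apply, ← Matrix.smul_one_eq_diagonal] at h1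
  -- An entry x of B satisfies x² ≤ p / c, and x ≤ 1 + x² avoids a square root.
  have hBC : ∀ θ i j, ‖B θ i j‖ ≤ 1 + p / c := by
    intro θ i j
    have hpc : 0 ≤ p / c := by positivity
    by_cases hθ : θ ∈ N
    · have h1 := norm_entry_sq_le_gram (B θ) i j
      rw [hBB θ hθ] at h1
      nlinarith [hXi θ i i, norm_nonneg (B θ i j), sq_nonneg (‖B θ i j‖ - 1)]
    · simp only [hBdef, if_neg hθ, Matrix.zero_apply, norm_zero]
      linarith
  obtain ⟨hi, hle⟩ := integral_log_det_le_of_bounded h hnt hg hK hc hBm hBC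
  have hae : ∀ᵐ θ ∂σ, Real.log ((c : ℂ) • (1 : Mat p) + B θ * (B θ)ᴴ).det.re =
      Real.log ((c : ℂ) • (1 : Mat p) + (X θ)⁻¹).det.re := by
    have hmem : ∀ᵐ θ ∂σ, θ ∈ N := by
      rw [ae_iff]; exact hNc
    filter_upwards [hmem] with θ hθ
    rw [hBB θ hθ]
  refine ⟨hi.congr hae, (integral_congr_ae hae).symm.trans_le (hle.trans ?_)⟩
  have e2 : ∀ θ, ((B θ)ᴴ * M θ * B θ).trace.re =
      if θ ∈ N then (M θ * (X θ)⁻¹).trace.re else 0 := by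
    intro θ
    by_cases hθ : θ ∈ N
    · rw [if_pos hθ, Matrix.trace_mul_comm, ← mul_assoc, hBB θ hθ, Matrix.trace_mul_comm]
    · simp [hBdef, hθ]
  simp_rw [e2]
  have hfm : Measurable fun θ => (M θ * (X θ)⁻¹).trace.re := by
    refine Complex.measurable_re.comp (measurable_trace fun i j => ?_)
    simp only [Matrix.mul_apply]
    exact Finset.measurable_sum _ fun k _ => (h.measurable i k).mul (hXim k j)
  set F : UCircle → ℝ := fun θ => if θ ∈ N then (M θ * (X θ)⁻¹).trace.re else 0
  have hFN : ∀ θ, θ ∈ N → F θ = (M θ * (X θ)⁻¹).trace.re := fun θ hθ => if_pos hθ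
  have hFc : ∀ θ, θ ∉ N → F θ = 0 := fun θ hθ => if_neg hθ
  have hFm : Measurable F := Measurable.ite hNm hfm measurable_const
  have hfin : ∫ θ, F θ ∂τ ≤ p := by
    refine integral_le_of_acDensity hN0 hFm
      (b := ∑ _i : Fin p, ∑ _j : Fin p, 1 * (p / c)) (fun θ => ?_) hFc (fun θ => ?_)
    · by_cases hθ : θ ∈ N
      · rw [hFN θ hθ]
        refine (Complex.abs_re_le_norm _).trans (norm_sum_le_of_le _ fun i _ => ?_)
        rw [Matrix.diag_apply, Matrix.mul_apply]
        refine norm_sum_le_of_le _ fun j _ => ?_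
        rw [norm_mul]
        exact mul_le_mul (h.norm_le θ i j) (hXi θ j i) (norm_nonneg _) zero_le_one
      · rw [hFc θ hθ, abs_zero]
        positivity
    · by_cases hθ : θ ∈ N
      · have e3 : (τ.rnDeriv σ θ).toReal * (M θ * (X θ)⁻¹).trace.re =
            (H θ * (X θ)⁻¹).trace.re := by
          simp only [H, acDensity]
          rw [Matrix.smul_mul, Matrix.trace_smul, smul_eq_mul, Complex.re_ofReal_mul]
        rw [hFN θ hθ, e3]
        exact trace_mul_inv_le hc (h.acDensity_posSemidef σ θ)
      · rw [hFc θ hθ, mul_zero]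
        exact p.cast_nonneg
  linarith

theorem tendsto_det_smul_one_add (H : Mat p) :
    Filter.Tendsto (fun n : ℕ => (((1 / ((n : ℝ) + 1) : ℝ) : ℂ) • (1 : Mat p) + H).det.re)
      Filter.atTop (nhds H.det.re) := by
  have hc : Continuous fun c : ℝ => ((c : ℂ) • (1 : Mat p) + H).det.re :=
    Complex.continuous_re.comp (((Complex.continuous_ofReal.smul continuous_const).add
      continuous_const).matrix_det)
  have h1 := (hc.tendsto 0).comp tendsto_one_div_add_atTop_nhds_zero_nat
  simp only [Complex.ofReal_zero, zero_smul, zero_add] at h1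
  exact h1

/-- The added trace terms are the bound of log det(c + H) from above (up to p), so the regularized
integrand is nonnegative as Fatou's lemma needs. If det H = 0 the right side is infinite as well. -/
theorem negLogPart_le_liminf {H : Mat p} (hH : H.PosSemidef) :
    negLogPart H.det.re ≤ Filter.liminf (fun n : ℕ => ENNReal.ofReal
      (-Real.log (((1 / ((n : ℝ) + 1) : ℝ) : ℂ) • (1 : Mat p) + H).det.re +
        (H.trace.re + p * (1 / ((n : ℝ) + 1))))) Filter.atTop := by
  have ht := tendsto_det_smul_one_add H
  have h2 : Filter.Tendsto (fun n : ℕ => H.trace.re + p * (1 / ((n : ℝ) + 1))) Filter.atTop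
      (nhds (H.trace.re + p * 0)) :=
    tendsto_const_nhds.add (tendsto_const_nhds.mul tendsto_one_div_add_atTop_nhds_zero_nat)
  rw [mul_zero, add_zero] at h2
  rcases (posSemidef_det_re_nonneg hH).eq_or_lt with h0 | h0
  · have hpos : ∀ n : ℕ, 0 < (((1 / ((n : ℝ) + 1) : ℝ) : ℂ) • (1 : Mat p) + H).det.re := fun n =>
      posDef_det_re_pos (posDef_smul_one_add (by positivity) hH)
    have h1 : Filter.Tendsto (fun n : ℕ =>
        (((1 / ((n : ℝ) + 1) : ℝ) : ℂ) • (1 : Mat p) + H).det.re) Filter.atTop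
        (nhdsWithin 0 (Set.Ioi 0)) := by
      rw [tendsto_nhdsWithin_iff]
      rw [← h0] at ht
      exact ⟨ht, .of_forall hpos⟩
    have h3 := Filter.tendsto_neg_atBot_atTop.comp (Real.tendsto_log_nhdsGT_zero.comp h1)
    have h4 := ENNReal.tendsto_ofReal_atTop.comp (h3.atTop_add h2)
    exact le_top.trans_eq h4.liminf_eq.symm
  · have h3 := ((Real.continuousAt_log h0.ne').tendsto.comp ht).neg.add h2
    have h4 := (ENNReal.continuous_ofReal.tendsto _).comp h3
    rw [negLogPart_of_pos h0]
    refine le_trans ?_ h4.liminf_eq.symm.le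
    exact ENNReal.ofReal_le_ofReal (by linarith [posSemidef_trace_re_nonneg hH])

/-- Bounded logarithmic integrals of the Szegő polynomials force finite entropy. -/
theorem entropy_ne_top_of_szegoSum_le (h : Represents μ τ M) (hnt : IsNontrivial μ) {g : ℝ}
    (hg : |g| ≤ 1) {K : ℝ} (hK : ∀ n, szegoSum (verblunsky μ) g n ≤ K) :
    ∫⁻ θ, negLogPart (acDensity τ (lam g) M θ).det.re ∂(lam g) ≠ ⊤ := by
  have := isProbabilityMeasure_lam hg
  set σ := lam g
  set H := acDensity τ σ M
  have hH := h.acDensity_posSemidef σ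
  have hHm := h.measurable_acDensity σ
  have htr := h.integrable_trace (σ := σ)
  set f : ℕ → UCircle → ENNReal := fun n θ => ENNReal.ofReal
      (-Real.log (((1 / ((n : ℝ) + 1) : ℝ) : ℂ) • (1 : Mat p) + H θ).det.re +
        ((H θ).trace.re + p * (1 / ((n : ℝ) + 1)))) with hf
  have hfm : ∀ n, Measurable (f n) := by
    intro n
    have m1 : Measurable fun θ =>
        (((1 / ((n : ℝ) + 1) : ℝ) : ℂ) • (1 : Mat p) + H θ).det.re :=
      Complex.measurable_re.comp (measurable_det fun i j => measurable_const.add (hHm i j))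
    exact ((Real.measurable_log.comp m1).neg.add
      ((Complex.measurable_re.comp (measurable_trace hHm)).add_const _)).ennreal_ofReal
  set L : ℝ := K + p * (2 * Real.log 2) + p + p + (∫ θ, (H θ).trace.re ∂σ + p)
  have hint : ∀ n, ∫⁻ θ, f n θ ∂σ ≤ ENNReal.ofReal L := by
    intro n
    set c : ℝ := 1 / ((n : ℝ) + 1) with hcdef
    have hc : 0 < c := by positivity
    have hc1 : c ≤ 1 := by
      rw [hcdef, div_le_one (by positivity)]
      linarith [(n.cast_nonneg : (0 : ℝ) ≤ n)]
    obtain ⟨i1, l1⟩ := integral_log_det_add_inv_le h hnt hg hK hc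
    have i2 : Integrable (fun θ => (H θ).trace.re + p * c) σ := htr.add (integrable_const _)
    have i3 : Integrable (fun θ => Real.log ((c : ℂ) • 1 + ((c : ℂ) • 1 + H θ)⁻¹).det.re +
        ((H θ).trace.re + p * c)) σ := i1.add i2
    have hle : ∀ θ, -Real.log ((c : ℂ) • (1 : Mat p) + H θ).det.re + ((H θ).trace.re + p * c) ≤
        Real.log ((c : ℂ) • (1 : Mat p) + ((c : ℂ) • 1 + H θ)⁻¹).det.re +
          ((H θ).trace.re + p * c) := fun θ =>
      add_le_add_left (neg_log_det_le_log_det_add_inv hc (posDef_smul_one_add hc (hH θ))) _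
    have hnn : ∀ θ, 0 ≤ -Real.log ((c : ℂ) • (1 : Mat p) + H θ).det.re +
        ((H θ).trace.re + p * c) := by
      intro θ
      have hX := posDef_smul_one_add hc (hH θ)
      have h1 := log_det_le_trace_sub hX.posSemidef (posDef_det_re_pos hX)
      rw [Matrix.trace_add, Complex.add_re, Matrix.trace_smul, smul_eq_mul, Complex.re_ofReal_mul,
        Matrix.trace_one, Fintype.card_fin, Complex.natCast_re] at h1
      have : (0 : ℝ) ≤ p := p.cast_nonneg
      linarith
    calc ∫⁻ θ, f n θ ∂σ ≤ ∫⁻ θ, ENNReal.ofReal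
          (Real.log ((c : ℂ) • (1 : Mat p) + ((c : ℂ) • 1 + H θ)⁻¹).det.re +
            ((H θ).trace.re + p * c)) ∂σ :=
          lintegral_mono fun θ => ENNReal.ofReal_le_ofReal (hle θ)
      _ = ENNReal.ofReal (∫ θ, (Real.log ((c : ℂ) • (1 : Mat p) +
            ((c : ℂ) • 1 + H θ)⁻¹).det.re + ((H θ).trace.re + p * c)) ∂σ) :=
          (ofReal_integral_eq_lintegral_ofReal i3
            (.of_forall fun θ => (hnn θ).trans (hle θ))).symm
      _ ≤ ENNReal.ofReal L := by
          refine ENNReal.ofReal_le_ofReal ?_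
          rw [integral_add i1 i2, integral_add htr (integrable_const _), integral_const]
          simp only [probReal_univ, one_smul]
          have hp : (0 : ℝ) ≤ p := p.cast_nonneg
          have h1 : c * p ≤ p := mul_le_of_le_one_left hp hc1
          have h2 : p * c ≤ p := mul_le_of_le_one_right hp hc1
          linarith
  refine ne_top_of_le_ne_top ENNReal.ofReal_ne_top (b := ENNReal.ofReal L) ?_
  calc ∫⁻ θ, negLogPart (H θ).det.re ∂σ ≤
        ∫⁻ θ, Filter.liminf (fun n => f n θ) Filter.atTop ∂σ :=
        lintegral_mono fun θ => negLogPart_le_liminf (hH θ)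
    _ ≤ Filter.liminf (fun n => ∫⁻ θ, f n θ ∂σ) Filter.atTop := lintegral_liminf_le hfm
    _ ≤ ENNReal.ofReal L := by
        refine Filter.liminf_le_of_frequently_le' (Filter.Frequently.of_forall hint)

theorem relEntropy_lam_lt_top_iff (hμ : IsNormalizedMatMeasure μ) (hnt : IsNontrivial μ) {g : ℝ}
    (hg : |g| ≤ 1) : relEntropy (lam g) μ < ⊤ ↔
      ∃ K, ∀ n, szegoSum (verblunsky μ) g n ≤ K := by
  obtain ⟨τ, M, h1, h2, h3, h4, h5, h6, h7⟩ := exists_density hμ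
  have h : Represents μ τ M := ⟨h1, h2, h3, h4, h5, h6⟩
  have := isProbabilityMeasure_lam hg
  rw [relEntropy_lt_top_iff h (h7 (lam g) inferInstance)]
  exact ⟨fun hfin => ⟨_, szegoSum_le_of_entropy h hnt hg hfin⟩,
    fun ⟨K, hK⟩ => entropy_ne_top_of_szegoSum_le h hnt hg hK⟩

theorem posDef_one_sub_verblunsky_of_nontrivial (hμ : IsNormalizedMatMeasure μ)
    (hnt : IsNontrivial μ) (n : ℕ) : (1 - (verblunsky μ n)ᴴ * verblunsky μ n).PosDef := by
  obtain ⟨τ, M, h1, h2, h3, h4, h5, h6, -⟩ := exists_density hμ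
  exact posDef_one_sub_verblunsky (⟨h1, h2, h3, h4, h5, h6⟩ : Represents μ τ M) hnt n

end EntropyFinite

/-! ### Boundedness of the sum rule in terms of real sequences. -/

section RealSequences

open Filter Topology

theorem sum_range_succ_eq_sum_half_add (a : ℕ → ℝ) (n : ℕ) :
    ∑ j ∈ Finset.range (n + 1), a j =
      ∑ j ∈ Finset.range n, (a j + a (j + 1)) / 2 + a 0 / 2 + a n / 2 := by
  induction n with
  | zero => simp
  | succ n ih => rw [Finset.sum_range_succ, ih, Finset.sum_range_succ]; ring

variable {a b c l : ℕ → ℝ} {g t : ℝ}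

/-- Here a = tr α†α, l = -log det(1 - α†α) and c is the cross term. The cross terms use up at most
the fraction |g| of Σ a, leaving (1 - |g|) Σ a to be controlled by the bound. -/
theorem bddAbove_szego_iff_summable (hg : |g| < 1) (ha : ∀ j, 0 ≤ a j) (hal : ∀ j, a j ≤ l j)
    (hc : ∀ j, |c j| ≤ (a j + a (j + 1)) / 2) (hl : ∀ j, a j ≤ 1 / 4 → l j ≤ 3 * a j) :
    (∃ K, ∀ n, ∑ j ∈ Finset.range (n + 1), l j + g * t - g * ∑ j ∈ Finset.range n, c j ≤ K) ↔
      Summable a := by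
  constructor
  · rintro ⟨K, hK⟩
    have hg' : 0 < 1 - |g| := by linarith
    refine summable_of_sum_range_le (c := (K - g * t) / (1 - |g|)) ha fun n => ?_
    rw [le_div_iff₀ hg']
    have h1 : g * ∑ j ∈ Finset.range n, c j ≤ |g| * ∑ j ∈ Finset.range (n + 1), a j := by
      calc g * ∑ j ∈ Finset.range n, c j ≤ |g * ∑ j ∈ Finset.range n, c j| := le_abs_self _
        _ = |g| * |∑ j ∈ Finset.range n, c j| := abs_mul _ _
        _ ≤ |g| * ∑ j ∈ Finset.range (n + 1), a j := by
          gcongr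
          rw [sum_range_succ_eq_sum_half_add]
          have := (Finset.abs_sum_le_sum_abs c (Finset.range n)).trans
            (Finset.sum_le_sum fun j _ => hc j)
          linarith [ha 0, ha n]
    have h2 : ∑ j ∈ Finset.range (n + 1), a j ≤ ∑ j ∈ Finset.range (n + 1), l j :=
      Finset.sum_le_sum fun j _ => hal j
    have h3 : ∑ j ∈ Finset.range n, a j ≤ ∑ j ∈ Finset.range (n + 1), a j := by
      rw [Finset.sum_range_succ]
      linarith [ha n]
    have h4 := mul_le_mul_of_nonneg_right h3 hg'.le
    linarith [hK n]
  · intro hs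
    have hls : Summable l := by
      refine Summable.of_norm_bounded_eventually_nat (hs.mul_left 3) ?_
      filter_upwards [hs.tendsto_atTop_zero.eventually_le_const (by norm_num : (0 : ℝ) < 1 / 4)]
        with j hj
      rw [Real.norm_of_nonneg ((ha j).trans (hal j))]
      exact hl j hj
    have hcs : Summable c :=
      Summable.of_norm_bounded ((hs.add ((summable_nat_add_iff 1).2 hs)).div_const 2) hc
    obtain ⟨K, hK⟩ := (((((tendsto_add_atTop_iff_nat 1).2 hls.hasSum.tendsto_sum_nat).add_const
      (g * t)).sub (hcs.hasSum.tendsto_sum_nat.const_mul g))).bddAbove_range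
    exact ⟨K, fun n => hK ⟨n, rfl⟩⟩

/-- Sharing each a_j between its two neighbouring cross terms rewrites the sum rule as Σ (l - a) + ½
Σ d plus boundary terms. Both series are nonnegative, so both must converge. The boundary needs only
a ≤ P, since Σ a may diverge. -/
theorem bddAbove_szego_iff_summable_and_summable {d : ℕ → ℝ} {P : ℝ} (ha : ∀ j, 0 ≤ a j)
    (haP : ∀ j, a j ≤ P) (hb : ∀ j, 0 ≤ b j) (hd : ∀ j, 0 ≤ d j)
    (hd' : ∀ j, d j = a j + a (j + 1) - 2 * (g * c j))
    (hbl : ∀ j, a j + b j / 2 ≤ l j) (hl : ∀ j, b j ≤ 1 / 4 → l j ≤ a j + 2 * b j) :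
    (∃ K, ∀ n, ∑ j ∈ Finset.range (n + 1), l j + g * t - g * ∑ j ∈ Finset.range n, c j ≤ K) ↔
      Summable b ∧ Summable d := by
  have key : ∀ n, ∑ j ∈ Finset.range (n + 1), l j + g * t - g * ∑ j ∈ Finset.range n, c j =
      ∑ j ∈ Finset.range (n + 1), (l j - a j) + (∑ j ∈ Finset.range n, d j) / 2 +
        (a 0 / 2 + a n / 2 + g * t) := by
    intro n
    have h : (∑ j ∈ Finset.range n, d j) / 2 = ∑ j ∈ Finset.range n, (a j + a (j + 1)) / 2 -
        g * ∑ j ∈ Finset.range n, c j := by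
      rw [Finset.sum_div, Finset.mul_sum, ← Finset.sum_sub_distrib]
      exact Finset.sum_congr rfl fun j _ => by rw [hd']; ring
    rw [Finset.sum_sub_distrib, sum_range_succ_eq_sum_half_add a n, h]
    ring
  simp only [key]
  have hla : ∀ j, 0 ≤ l j - a j := fun j => by linarith [hbl j, hb j]
  constructor
  · rintro ⟨K, hK⟩
    have hD : ∀ n, 0 ≤ ∑ j ∈ Finset.range n, d j := fun n => Finset.sum_nonneg fun j _ => hd j
    have hL : ∀ n, 0 ≤ ∑ j ∈ Finset.range n, (l j - a j) := fun n =>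
      Finset.sum_nonneg fun j _ => hla j
    constructor
    · refine summable_of_sum_range_le (c := 2 * (K - g * t)) hb fun n => ?_
      have h : (∑ j ∈ Finset.range n, b j) / 2 ≤ ∑ j ∈ Finset.range n, (l j - a j) := by
        rw [Finset.sum_div]
        exact Finset.sum_le_sum fun j _ => by linarith [hbl j]
      have h' := hK n
      rw [Finset.sum_range_succ] at h'
      linarith [hD n, hla n, ha 0, ha n]
    · refine summable_of_sum_range_le (c := 2 * (K - g * t)) hd fun n => ?_
      linarith [hK n, hL (n + 1), ha 0, ha n]
  · rintro ⟨hbs, hds⟩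
    have hls : Summable fun j => l j - a j := by
      refine Summable.of_norm_bounded_eventually_nat (hbs.mul_left 2) ?_
      filter_upwards [hbs.tendsto_atTop_zero.eventually_le_const (by norm_num : (0 : ℝ) < 1 / 4)]
        with j hj
      rw [Real.norm_of_nonneg (hla j)]
      linarith [hl j hj]
    refine ⟨∑' j, (l j - a j) + (∑' j, d j) / 2 + (P / 2 + P / 2 + g * t), fun n => ?_⟩
    have h1 := hls.sum_le_tsum (Finset.range (n + 1)) fun j _ => hla j
    have h2 := hds.sum_le_tsum (Finset.range n) fun j _ => hd j
    linarith [haP 0, haP n]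

end RealSequences

/-! ### Application to the Verblunsky coefficients. -/

section Coefficients

variable {p : ℕ} {μ : MatMeasure p}

theorem trace_add_smul_mul_conjTranspose (x y : Mat p) (s : ℝ) :
    ((y + (s : ℂ) • x) * (yᴴ + (s : ℂ) • xᴴ)).trace.re =
      s ^ 2 * (xᴴ * x).trace.re + (yᴴ * y).trace.re + 2 * (s * (xᴴ * y).trace.re) := by
  have h : (x * yᴴ).trace.re = (y * xᴴ).trace.re := by
    rw [← Complex.conj_re, ← Complex.star_def, ← Matrix.trace_conjTranspose,
      Matrix.conjTranspose_mul, Matrix.conjTranspose_conjTranspose]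
  simp only [add_mul, mul_add, Matrix.smul_mul, Matrix.mul_smul, Matrix.trace_add,
    Matrix.trace_smul, smul_eq_mul, Complex.add_re, Complex.re_ofReal_mul]
  rw [h, Matrix.trace_mul_comm xᴴ x, Matrix.trace_mul_comm yᴴ y, Matrix.trace_mul_comm xᴴ y]
  ring

theorem trace_add_smul_mul_conjTranspose_nonneg (x y : Mat p) (s : ℝ) :
    0 ≤ ((y + (s : ℂ) • x) * (yᴴ + (s : ℂ) • xᴴ)).trace.re := by
  have h : yᴴ + (s : ℂ) • xᴴ = (y + (s : ℂ) • x)ᴴ := by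
    simp [Matrix.conjTranspose_add, Matrix.conjTranspose_smul]
  rw [h, Matrix.trace_mul_comm]
  exact trace_conjTranspose_mul_self_re_nonneg _

theorem abs_trace_conjTranspose_mul_le (x y : Mat p) :
    |(xᴴ * y).trace.re| ≤ ((xᴴ * x).trace.re + (yᴴ * y).trace.re) / 2 := by
  have h1 := trace_add_smul_mul_conjTranspose_nonneg x y 1
  have h2 := trace_add_smul_mul_conjTranspose_nonneg x y (-1)
  rw [trace_add_smul_mul_conjTranspose] at h1 h2
  exact abs_le.2 ⟨by linarith, by linarith⟩

theorem relEntropy_lam_lt_top_iff_bddAbove (hμ : IsNormalizedMatMeasure μ) (hnt : IsNontrivial μ)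
    {g : ℝ} (hg : |g| ≤ 1) : relEntropy (lam g) μ < ⊤ ↔
      ∃ K, ∀ n, ∑ j ∈ Finset.range (n + 1),
          -Real.log (1 - (verblunsky μ j)ᴴ * verblunsky μ j).det.re +
        g * (verblunsky μ 0).trace.re -
        g * ∑ j ∈ Finset.range n, ((verblunsky μ j)ᴴ * verblunsky μ (j + 1)).trace.re ≤ K := by
  have key : ∀ n, szegoSum (verblunsky μ) g (n + 1) = _ := fun n =>
    integral_log_norm_det_szegoPoly hg n fun j _ =>
      posDef_one_sub_verblunsky_of_nontrivial hμ hnt j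
  rw [relEntropy_lam_lt_top_iff hμ hnt hg]
  simp only [← key]
  constructor
  · rintro ⟨K, hK⟩
    exact ⟨K, fun n => hK (n + 1)⟩
  · rintro ⟨K, hK⟩
    -- The sum rule covers the indices n + 1; index 0 is accommodated by enlarging the bound.
    refine ⟨max K (szegoSum (verblunsky μ) g 0), fun n => ?_⟩
    cases n with
    | zero => exact le_max_right _ _
    | succ n => exact (hK n).trans (le_max_left _ _)

theorem relEntropy_lam_lt_top_iff_summable (hμ : IsNormalizedMatMeasure μ) (hnt : IsNontrivial μ)
    {g : ℝ} (hg : |g| < 1) : relEntropy (lam g) μ < ⊤ ↔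
      Summable fun k => (verblunsky μ k * (verblunsky μ k)ᴴ).trace.re := by
  have hP := posDef_one_sub_verblunsky_of_nontrivial hμ hnt
  simp only [fun k => Matrix.trace_mul_comm (verblunsky μ k) (verblunsky μ k)ᴴ]
  rw [relEntropy_lam_lt_top_iff_bddAbove hμ hnt hg.le]
  refine bddAbove_szego_iff_summable hg (fun j => trace_conjTranspose_mul_self_re_nonneg _)
    (fun j => ?_) (fun j => abs_trace_conjTranspose_mul_le _ _) (fun j hj => ?_)
  · linarith [trace_add_half_trace_sq_le (hP j), trace_sq_nonneg (verblunsky μ j)]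
  · have h := trace_sq_le_trace (hP j)
    linarith [neg_log_det_le (hP j) (h.trans hj)]

/-- The scalar -g treats both endpoints together: as g² = 1, expanding |α_{k+1} - gα_k|² gives
exactly the combination of diagonal and cross terms in the sum rule. -/
theorem relEntropy_lam_lt_top_iff_summable_and_summable (hμ : IsNormalizedMatMeasure μ)
    (hnt : IsNontrivial μ) {g : ℝ} (hg : g ^ 2 = 1) : relEntropy (lam g) μ < ⊤ ↔
      (Summable fun k => ((verblunsky μ k * (verblunsky μ k)ᴴ) ^ 2).trace.re) ∧
      Summable fun k => ((verblunsky μ (k + 1) + ((-g : ℝ) : ℂ) • verblunsky μ k) *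
        ((verblunsky μ (k + 1))ᴴ + ((-g : ℝ) : ℂ) • (verblunsky μ k)ᴴ)).trace.re := by
  have hP := posDef_one_sub_verblunsky_of_nontrivial hμ hnt
  simp only [trace_sq_mul_conjTranspose]
  rw [relEntropy_lam_lt_top_iff_bddAbove hμ hnt (by rw [← sq_le_one_iff_abs_le_one, hg])]
  refine bddAbove_szego_iff_summable_and_summable (P := p)
    (fun j => trace_conjTranspose_mul_self_re_nonneg (verblunsky μ j))
    (fun j => trace_le_card (hP j)) (fun j => trace_sq_nonneg _)
    (fun j => trace_add_smul_mul_conjTranspose_nonneg _ _ _) (fun j => ?_)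
    (fun j => trace_add_half_trace_sq_le (hP j)) (fun j hj => neg_log_det_le (hP j) hj)
  rw [trace_add_smul_mul_conjTranspose, neg_sq, hg]
  ring

end Coefficients

end MatrixOPUC

theorem proposition2p3 (p : ℕ) (hp : 1 < p) (μ : MatrixOPUC.MatMeasure p)
    (hμ : MatrixOPUC.IsNormalizedMatMeasure μ) (hnt : MatrixOPUC.IsNontrivial μ)
    (α : ℕ → Matrix (Fin p) (Fin p) ℂ) (hα : α = MatrixOPUC.verblunsky μ) :
    (∀ g : ℝ, |g| < 1 →
      (MatrixOPUC.relEntropy (MatrixOPUC.lam g) μ < ⊤ ↔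
        Summable fun k => (α k * (α k)ᴴ).trace.re)) ∧
    (MatrixOPUC.relEntropy (MatrixOPUC.lam 1) μ < ⊤ ↔
      (Summable fun k => ((α k * (α k)ᴴ) ^ 2).trace.re) ∧
        Summable fun k => ((α (k + 1) - α k) * ((α (k + 1))ᴴ - (α k)ᴴ)).trace.re) ∧
    (MatrixOPUC.relEntropy (MatrixOPUC.lam (-1)) μ < ⊤ ↔
      (Summable fun k => ((α k * (α k)ᴴ) ^ 2).trace.re) ∧
        Summable fun k => ((α (k + 1) + α k) * ((α (k + 1))ᴴ + (α k)ᴴ)).trace.re) := by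
  subst hα
  refine ⟨fun g hg => MatrixOPUC.relEntropy_lam_lt_top_iff_summable hμ hnt hg, ?_, ?_⟩
  · simpa only [Complex.ofReal_neg, Complex.ofReal_one, neg_smul, one_smul, ← sub_eq_add_neg] using
      MatrixOPUC.relEntropy_lam_lt_top_iff_summable_and_summable hμ hnt (g := 1) (by norm_num)
  · simpa only [neg_neg, Complex.ofReal_one, one_smul] using
      MatrixOPUC.relEntropy_lam_lt_top_iff_summable_and_summable hμ hnt (g := -1) (by norm_num)
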